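/- **Setting.** Let $\mathcal K$ be the space of convex bodies (nonempty compact convex sets) in $\mathbb R^2$ with the Hausdorff metric, and let $\mathcal K_0$ be the set of those whose smallest enclosing disc is centred at the origin. For $K\in\mathcal K$ let $h_K$ be its support function. $K$ is of class $C^2_+$ if $h_K$ is $C^2$ on $\mathbb R^2\setminus\{0\}$ and the radius of curvature $r(K,u)=d^2h_K(u)(u^\perp,u^\perp)$ is positive for all $u\in S^1$, where $u^\perp$ is $u$ rotated by $\pi/2$. Let $u(\varphi)=(\cos\varphi,\sin\varphi)$, let $\omega_n$ be the surface area of the unit sphere in $\mathbb R^n$, and let $\lambda$ be Lebesgue measure. For $s\in\mathbb N_0$ the surface tensor of $K$ is $$\Phi_1^{0,s}(K)=\frac1{s!}\frac{\omega_1}{\omega_{1+s}}\int_{\mathbb R^2\times S^1}u^s\,\Lambda_1(K;d(x,u)),$$ where $u^s$ is the symmetric tensor power and $\Lambda_1(K;\cdot)$ is the support measure of order $1$ from the local Steiner formula; $\Phi_1^{0,s}$ is extended additively to finite unions of convex bodies, with $\Phi_1^{0,s}(\emptyset)=0$. Let $\gamma>0$, let $\mathbb Q$ be a probability measure on $\mathcal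 K$ concentrated on $\mathcal K_0\cap C^2_+$ with $\int\lambda(K+B^2)\,\mathbb Q(dK)<\infty$, and let $Z_0$ be a random convex body with distribution $\mathbb Q$. Let $X$ be a Poisson process in $\mathcal K$ with intensity measure $\gamma\int_{\mathbb R^2}\int\mathbf 1\{K+x\in\cdot\}\,\mathbb Q(dK)\,dx$, and let $Z=\bigcup_{K\in X}K$ be the Boolean model. Put $$\overline\Phi_1^{\,0,s}(X)=\gamma\int\Phi_1^{0,s}\,d\mathbb Q,\qquad \overline V_2(X)=\gamma\int\lambda(K)\,\mathbb Q(dK),$$ $$\overline\Phi_1^{\,0,s}(Z)=\lim_{\varrho\to\infty}\frac{\mathbb E[\Phi_1^{0,s}(Z\cap\varrho W)]}{\lambda(\varrho W)},\qquad \overline V_2(Z)=\lim_{\varrho\to\infty}\frac{\mathbb E[\lambda(Z\cap\varrho W)]}{\lambda(\varrho W)},$$ where $W\in\mathcal K$ with $\lambda(W)>0$. Let $g(\varphi)=\gamma\,\mathbb E[r(Z_0,u(\varphi))]$ and $\hat g(n)=\frac1{2\pi}\int_0^{2\pi}g(\varphi)e^{-in\varphi}\,d\varphi$. **Claim.** 1.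 The function $g$ is finite almost everywhere and integrable on $[0,2\pi]$. For every $s\in\mathbb N_0$, $\Phi_1^{0,s}$ is $\mathbb Q$-integrable and $$\overline\Phi_1^{\,0,s}(X)=\frac{\gamma}{s!\,\omega_{1+s}}\int\int_0^{2\pi}r(K,u(\varphi))\,u(\varphi)^s\,d\varphi\,\mathbb Q(dK)=\frac{1}{s!\,\omega_{1+s}}\int_0^{2\pi}g(\varphi)\,u(\varphi)^s\,d\varphi.$$ 2. For every $s\in\mathbb N_0$, $$\hat g(\pm s)=\sum_{j=0}^s\binom sj(\mp i)^{s-j}\,\frac{s!\,\omega_{1+s}}{2\pi}\,\bigl(\overline\Phi_1^{\,0,s}(X)\bigr)_{\underbrace{\scriptstyle 1,\dots,1}_{j},\underbrace{\scriptstyle 2,\dots,2}_{s-j}},$$ and, for almost every $\varphi\in[0,2\pi]$, $$g(\varphi)=\lim_{N\to\infty}\sum_{n=-N}^{N}\Bigl(1-\frac{|n|}{N+1}\Bigr)\hat g(n)\,e^{in\varphi}.$$ 3. The tensors $\overline\Phi_1^{\,0,s}(X)$, $s\in\mathbb N_0$, determine $g(\varphi)=\gamma\,\mathbb E[r(Z_0,u(\varphi))]$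 for almost every $\varphi\in[0,2\pi]$: if two pairs $(\gamma,\mathbb Q)$ and $(\gamma',\mathbb Q')$ as above have the same densities for all $s$, then $g=g'$ almost everywhere. 4. The densities of $Z$ exist and do not depend on $W$, and $$\overline\Phi_1^{\,0,s}(Z)=e^{-\overline V_2(X)}\,\overline\Phi_1^{\,0,s}(X)\quad(s\in\mathbb N_0),\qquad \overline V_2(Z)=1-e^{-\overline V_2(X)}.$$ Consequently the surface tensor densities $\overline\Phi_1^{\,0,s}(Z)$, $s\in\mathbb N_0$, of $Z$ determine $g$ almost everywhere up to a positive constant factor, and together with the area fraction $\overline V_2(Z)$ they determine $g$ almost everywhere. -/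

import Mathlib

open MeasureTheory ProbabilityTheory Set Filter Topology
open scoped ENNReal Pointwise

noncomputable section

/-- The Euclidean plane. -/
abbrev Plane : Type := EuclideanSpace ℝ (Fin 2)

/-- The unit circle `S¹`. -/
abbrev UnitCircle : Type := Metric.sphere (0 : Plane) 1

/-- The space of convex bodies with the Hausdorff metric carries its Borel sigma-algebra. -/
instance instMeasurableSpaceConvexBodyPlane : MeasurableSpace (ConvexBody Plane) := borel _

instance instBorelSpaceConvexBodyPlane : BorelSpace (ConvexBody Plane) := ⟨rfl⟩

/-- Volume of the `n`-dimensional unit ball. -/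
def ballVolume (n : ℕ) : ℝ := Real.pi ^ ((n : ℝ) / 2) / Real.Gamma (1 + (n : ℝ) / 2)

/-- Surface area `ω_n = n κ_n` of the unit sphere in `ℝⁿ`. -/
def sphereArea (n : ℕ) : ℝ := n * ballVolume n

/-- The unit vector `u(φ) = (cos φ, sin φ)`. -/
def unitVec (φ : ℝ) : Plane := !₂[Real.cos φ, Real.sin φ]

/-- Rotation by a right angle. -/
def quarterTurn (u : Plane) : Plane := !₂[-(u 1), u 0]

/-- Tensors of rank `s`: `s`-linear functionals on the plane. All tensors below lie in the subspace
of symmetric ones. -/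
abbrev Tensor (s : ℕ) : Type := ContinuousMultilinearMap ℝ (fun _ : Fin s => Plane) ℝ

/-- The `s`-fold symmetric tensor power `u^s`, i.e. `(x₁, …, x_s) ↦ ⟨u, x₁⟩ ⋯ ⟨u, x_s⟩`. -/
def tensorPower (s : ℕ) (u : Plane) : Tensor s :=
  (ContinuousMultilinearMap.mkPiAlgebraFin ℝ s ℝ).compContinuousLinearMap
    (fun _ => innerSL ℝ u)

/-- The coordinate `T_{1,…,1,2,…,2}` with `j` ones and `s - j` twos. -/
def Tensor.coord {s : ℕ} (T : Tensor s) (j : ℕ) : ℝ :=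
  T (fun i : Fin s => if (i : ℕ) < j then EuclideanSpace.single 0 1 else EuclideanSpace.single 1 1)

/-! ### Convex bodies: centre, translation, support function, radius of curvature -/

/-- The translate `K + x`. -/
def translateBody (K : ConvexBody Plane) (x : Plane) : ConvexBody Plane where
  carrier := (fun y => x + y) '' (K : Set Plane)
  convex' := K.convex.translate x
  isCompact' := K.isCompact.image (by fun_prop)
  nonempty' := K.nonempty.image _

/-- The smallest ball containing `K` is centred at `c`. -/
def IsCircumcenter (K : ConvexBody Plane) (c : Plane) : Prop :=
  ∃ R : ℝ, (K : Set Plane) ⊆ Metric.closedBall c R ∧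
    ∀ (c' : Plane) (R' : ℝ), (K : Set Plane) ⊆ Metric.closedBall c' R' → R ≤ R'

/-- The support function `h_K(x) = max {⟨x, y⟩ : y ∈ K}`. -/
def supportFun (K : ConvexBody Plane) (x : Plane) : ℝ :=
  sSup ((fun y => inner ℝ x y) '' (K : Set Plane))

/-- The radius of curvature `r(K, u)` at the boundary point with outer unit normal `u`: the
eigenvalue of the second differential of the support function at `u` in the tangent direction. -/
def curvatureRadius (K : ConvexBody Plane) (u : Plane) : ℝ :=
  fderiv ℝ (fderiv ℝ (supportFun K)) u (quarterTurn u) (quarterTurn u)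

/-- Convex bodies of class `C²₊`: the support function is of class `C²` away from the origin and
the radius of curvature is positive for each outer normal. -/
def IsC2Plus (K : ConvexBody Plane) : Prop :=
  ContDiffOn ℝ 2 (supportFun K) {0}ᶜ ∧ ∀ u : Plane, ‖u‖ = 1 → 0 < curvatureRadius K u

/-! ### Support measures and Minkowski tensors -/

/-- `y` is the metric projection of `x` to `K`. -/
def IsMetricProjection (K : ConvexBody Plane) (x y : Plane) : Prop :=
  y ∈ K ∧ dist x y = Metric.infDist x (K : Set Plane)

/-- The local parallel set `M_ε(K, η)`: points `x` in `(K + ε B) \ K` such that the pair consisting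
of the metric projection `p(K, x)` and the unit vector from `p(K, x)` to `x` belongs to `η`. -/
def localParallelSet (K : ConvexBody Plane) (ε : ℝ) (η : Set (Plane × UnitCircle)) : Set Plane :=
  {x | x ∈ ((K : Set Plane) + Metric.closedBall (0 : Plane) ε) \ (K : Set Plane) ∧
    ∃ p ∈ η, IsMetricProjection K x p.1 ∧ (p.2 : Plane) = ‖x - p.1‖⁻¹ • (x - p.1)}

/-- The local Steiner formula, which characterizes the support measures `Λ₀(K; ·)`, `Λ₁(K; ·)`. -/
def IsSupportMeasures (K : ConvexBody Plane) (Λ₀ Λ₁ : Measure (Plane × UnitCircle)) : Prop :=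
  ∀ ε : ℝ, 0 < ε → ∀ η : Set (Plane × UnitCircle), MeasurableSet η →
    volume (localParallelSet K ε η) =
      ENNReal.ofReal (ε ^ 2 * ballVolume 2) * Λ₀ η + ENNReal.ofReal (ε * ballVolume 1) * Λ₁ η

open Classical in
/-- The support measure `Λ₁(K; ·)`, i.e. the measure `Λ₁` in the local Steiner formula (it is
unique, since the formula holds for all `ε`). -/
def supportMeasure (K : ConvexBody Plane) : Measure (Plane × UnitCircle) :=
  if h : ∃ Λ : Measure (Plane × UnitCircle) × Measure (Plane × UnitCircle),
    IsSupportMeasures K Λ.1 Λ.2 then h.choose.2 else 0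

/-- The surface tensor `Φ₁^{0,s}(K)` of a convex body. -/
def surfaceTensor (s : ℕ) (K : ConvexBody Plane) : Tensor s :=
  ((1 / (s.factorial : ℝ)) * (sphereArea 1 / sphereArea (1 + s))) •
    ∫ p, tensorPower s (p.2 : Plane) ∂(supportMeasure K)

open Classical in
/-- `Φ₁^{0,s}` on sets that are convex bodies or empty, with `Φ₁^{0,s}(∅) = 0`. -/
def surfaceTensorSet (s : ℕ) (A : Set Plane) : Tensor s :=
  if h : ∃ K : ConvexBody Plane, (K : Set Plane) = A then surfaceTensor s h.choose else 0

open Classical in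
/-- The additive extension of `Φ₁^{0,s}` to the convex ring (finite unions of convex bodies), given
by the inclusion-exclusion formula; the value does not depend on the chosen representation of `R`
as a finite union of convex bodies. -/
def surfaceTensorPoly (s : ℕ) (R : Set Plane) : Tensor s :=
  if h : ∃ F : Finset (ConvexBody Plane), R = ⋃ K ∈ F, (K : Set Plane) then
    ∑ I ∈ h.choose.powerset with I.Nonempty,
      (-1 : ℝ) ^ (I.card + 1) • surfaceTensorSet s (⋂ K ∈ I, (K : Set Plane))
  else 0

/-! ### The Boolean model -/

/-- The grain distribution `Q` is concentrated on the convex bodies of class `C²₊` with circumcentre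
at the origin, and the typical grain `Z₀` satisfies `E[λ(Z₀ + B)] < ∞`. -/
structure IsSmoothGrainDistribution (Q : Measure (ConvexBody Plane)) : Prop where
  isProbability : IsProbabilityMeasure Q
  concentrated : ∀ᵐ K ∂Q, IsCircumcenter K 0 ∧ IsC2Plus K
  integrability :
    ∫⁻ K, volume ((K : Set Plane) + Metric.closedBall (0 : Plane) 1) ∂Q < ∞

/-- The intensity measure `Θ(A) = γ ∫ ∫ 1_A(K + x) Q(dK) dx`. -/
def intensity (γ : ℝ) (Q : Measure (ConvexBody Plane)) (A : Set (ConvexBody Plane)) : ℝ≥0∞ :=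
  ENNReal.ofReal γ * ∫⁻ x : Plane, Q {K | translateBody K x ∈ A}

/-- `X` is a (simple) Poisson point process of convex bodies with intensity measure `Θ`: the numbers
of points in measurable sets are random variables, Poisson distributed with parameter `Θ(A)` if
this is finite, and independent for pairwise disjoint sets. -/
structure IsPoissonProcess {Ω : Type*} [MeasurableSpace Ω] (P : Measure Ω)
    (X : Ω → Set (ConvexBody Plane)) (Θ : Set (ConvexBody Plane) → ℝ≥0∞) : Prop where
  measurable_count : ∀ A, MeasurableSet A → Measurable (fun ω => (X ω ∩ A).encard)
  law_count : ∀ A, MeasurableSet A → Θ A ≠ ∞ → ∀ k : ℕ,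
    P {ω | (X ω ∩ A).encard = k} =
      ENNReal.ofReal (Real.exp (-(Θ A).toReal) * (Θ A).toReal ^ k / k.factorial)
  indep_count : ∀ (m : ℕ) (A : Fin m → Set (ConvexBody Plane)), (∀ i, MeasurableSet (A i)) →
    Pairwise (fun i j => Disjoint (A i) (A j)) →
    iIndepFun (fun i ω => (X ω ∩ A i).encard) P

/-- A planar Boolean model with intensity `γ`, smooth grains of distribution `Q`, and particle
process `X`, defined on the probability space `(Ω, P)`. -/
structure IsSmoothBooleanModel {Ω : Type*} [MeasurableSpace Ω] (P : Measure Ω)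
    (γ : ℝ) (Q : Measure (ConvexBody Plane)) (X : Ω → Set (ConvexBody Plane)) : Prop where
  isProbability : IsProbabilityMeasure P
  intensity_pos : 0 < γ
  grains : IsSmoothGrainDistribution Q
  poisson : IsPoissonProcess P X (intensity γ Q)

/-- The union set `Z` of the particles of `X`. -/
def unionSet {Ω : Type*} (X : Ω → Set (ConvexBody Plane)) (ω : Ω) : Set Plane :=
  ⋃ K ∈ X ω, (K : Set Plane)

/-! ### Densities -/

/-- The density of the surface tensor `Φ₁^{0,s}` of the particle process. -/
def particleSurfaceDensity (γ : ℝ) (Q : Measure (ConvexBody Plane)) (s : ℕ) : Tensor s :=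
  γ • ∫ K, surfaceTensor s K ∂Q

/-- The area density of the particle process. -/
def particleAreaDensity (γ : ℝ) (Q : Measure (ConvexBody Plane)) : ℝ :=
  γ * ∫ K, (volume (K : Set Plane)).toReal ∂Q

/-- `T` is the density of `Φ₁^{0,s}` of the random set `Z`: for each window `W` of positive area,
`E[Φ₁^{0,s}(Z ∩ ϱW)]` exists for `ϱ > 0`, and divided by the area of `ϱW` it converges to `T` as
`ϱ → ∞`. -/
def HasSurfaceDensity {Ω : Type*} [MeasurableSpace Ω] (P : Measure Ω) (Z : Ω → Set Plane)
    (s : ℕ) (T : Tensor s) : Prop :=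
  ∀ W : ConvexBody Plane, 0 < volume (W : Set Plane) →
    (∀ ϱ : ℝ, 0 < ϱ →
      Integrable (fun ω => surfaceTensorPoly s (Z ω ∩ ϱ • (W : Set Plane))) P) ∧
    Tendsto (fun ϱ : ℝ => (volume (ϱ • (W : Set Plane))).toReal⁻¹ •
      ∫ ω, surfaceTensorPoly s (Z ω ∩ ϱ • (W : Set Plane)) ∂P) atTop (𝓝 T)

/-- `v` is the area density (area fraction) of the random set `Z`. -/
def HasAreaDensity {Ω : Type*} [MeasurableSpace Ω] (P : Measure Ω) (Z : Ω → Set Plane)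
    (v : ℝ) : Prop :=
  ∀ W : ConvexBody Plane, 0 < volume (W : Set Plane) →
    (∀ ϱ : ℝ, 0 < ϱ →
      Integrable (fun ω => (volume (Z ω ∩ ϱ • (W : Set Plane))).toReal) P) ∧
    Tendsto (fun ϱ : ℝ => (volume (ϱ • (W : Set Plane))).toReal⁻¹ *
      ∫ ω, (volume (Z ω ∩ ϱ • (W : Set Plane))).toReal ∂P) atTop (𝓝 v)

/-- The function `g(φ) = γ E[r(Z₀, u(φ))]`. -/
def meanCurvatureRadius (γ : ℝ) (Q : Measure (ConvexBody Plane)) (φ : ℝ) : ℝ :=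
  γ * ∫ K, curvatureRadius K (unitVec φ) ∂Q

/-- The `n`-th Fourier coefficient `(2π)⁻¹ ∫₀^{2π} g(φ) e^{-inφ} dφ` of `g` on `[0, 2π]`. -/
def meanCurvatureCoeff (γ : ℝ) (Q : Measure (ConvexBody Plane)) (n : ℤ) : ℂ :=
  fourierCoeffOn Real.two_pi_pos (fun φ => (meanCurvatureRadius γ Q φ : ℂ)) n

end

noncomputable section

/-! ### Metric projection and normal pairs -/

/-! For one body, the surface tensor is up to a constant the integral of `u^s` against twice the
support measure `Λ₁`. The analytic core identifies `2Λ₁` on the circle with `H + H''` in the weak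
sense, where `H(φ) = h_K(u(φ))`: `IsRadialProduct.two_mul_integral_supportMeasure` gives `2 ∫ P dΛ₁
= ∫ H (P + P'')`, for arbitrary convex bodies and in particular for homogeneous polynomials `P`. To
obtain it, take a test function `F` that is a product `w(t) P(u)` in polar coordinates and compare
`∫ F(y) dy` with `∫ F(y - p(ny)/n) dy`, where `p` is the metric projection. The local Steiner
formula computes the second integral exactly as `α + b/n`, with `b` containing `Λ₁`. On the other
hand `p(ny) → ∇h(y)` for almost every `y`, so `n` times the difference tends to `-∫ DF(∇h)`. Polar
coordinates and an integration by parts turn this into the integral over the circle. The existence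
of `Λ₁` comes from the area formula for dilations along outer normals
(`volume_localParallelSet_eq_lintegral`). Smoothness enters only afterwards: two integrations by
parts move the derivatives onto `H`, and `H + H''` is the radius of curvature.

Averaging over the grains with Fubini's theorem makes the densities of `X` the moments of `g`
against `u(φ)^s`. Their coordinates are integrals against `cos^j sin^(s-j)`, and `e^{∓isφ} = (cos φ
∓ i sin φ)^s` expresses the Fourier coefficients through them. The Fejér-Lebesgue theorem
(`ae_tendsto_integral_fejerKernel`) recovers `g` at almost every point, which also gives uniqueness.

For the Boolean model three facts are combined. First, since the tensor depends linearly on the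
support function, and linear relations between indicators of compact convex sets pass to support
functions (`sum_supportSet_eq_zero`), inclusion-exclusion is legitimate for every representation of
a finite union. Secondly, `Λ₁` is determined locally, so for almost every `x` the measure of `K ∩ (L
+ x)` is the sum of two restricted measures (`supportMeasure_inter`); integration over `x` gives the
translative formula. Hence intersecting with a random particle acts, in the mean, on the pair
(tensor, area) as the linear operator `L(T, v) = (V T + v T₀, V v)`, where `V` and `T₀` are the
densities of `X`. Thirdly, the factorial moment measures of the Poisson process are powers of its
intensity measure (`HasIndepCounts.bind_factorialMeasure`). Inclusion-exclusion over the particles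
that meet a window `W` therefore has mean `∑ (-1)^k L^(k+1) / (k+1)! = 1 - e^{-L}`, applied to the
pair of `W`. The result is `(1 - e^{-V}) Φ(W) + e^{-V} λ(W) T₀` for the tensor and `(1 - e^{-V})
λ(W)` for the area. Under dilation of the window `Φ` grows linearly and the area quadratically, so
only the second term of the tensor survives in the limit. The area fraction determines `V` and with
it the factor `e^{-V}`; without it this factor is the undetermined constant. -/

theorem exists_isMetricProjection (K : ConvexBody Plane) (x : Plane) :
    ∃ y, IsMetricProjection K x y := by
  obtain ⟨y, hy, h⟩ := K.isCompact.exists_infDist_eq_dist K.nonempty x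
  exact ⟨y, hy, h.symm⟩

/-- The metric projection to a convex body. -/
def metricProj (K : ConvexBody Plane) (x : Plane) : Plane :=
  (exists_isMetricProjection K x).choose

theorem isMetricProjection_metricProj (K : ConvexBody Plane) (x : Plane) :
    IsMetricProjection K x (metricProj K x) :=
  (exists_isMetricProjection K x).choose_spec

theorem metricProj_mem (K : ConvexBody Plane) (x : Plane) : metricProj K x ∈ K :=
  (isMetricProjection_metricProj K x).1

theorem dist_metricProj (K : ConvexBody Plane) (x : Plane) :
    dist x (metricProj K x) = Metric.infDist x (K : Set Plane) :=
  (isMetricProjection_metricProj K x).2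

theorem norm_sub_metricProj (K : ConvexBody Plane) (x : Plane) :
    ‖x - metricProj K x‖ = Metric.infDist x (K : Set Plane) := by
  rw [← dist_eq_norm, dist_metricProj]

theorem isMetricProjection_iff_inner {K : ConvexBody Plane} {x y : Plane} :
    IsMetricProjection K x y ↔ y ∈ K ∧ ∀ z ∈ K, inner ℝ (x - y) (z - y) ≤ 0 := by
  refine and_congr_right fun hy => ?_
  have h1 := norm_eq_iInf_iff_real_inner_le_zero K.convex (u := x) (v := y) hy
  rw [Metric.infDist_eq_iInf, dist_eq_norm]
  simp only [dist_eq_norm]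
  exact h1

theorem inner_sub_metricProj_le (K : ConvexBody Plane) (x : Plane) {z : Plane} (hz : z ∈ K) :
    inner ℝ (x - metricProj K x) (z - metricProj K x) ≤ 0 :=
  (isMetricProjection_iff_inner.1 (isMetricProjection_metricProj K x)).2 z hz

theorem IsMetricProjection.eq_metricProj {K : ConvexBody Plane} {x y : Plane}
    (h : IsMetricProjection K x y) : y = metricProj K x := by
  obtain ⟨hy, h⟩ := isMetricProjection_iff_inner.1 h
  have h1 := h _ (metricProj_mem K x)
  have h2 := inner_sub_metricProj_le K x hy
  have h3 : inner ℝ (y - metricProj K x) (y - metricProj K x) ≤ 0 := by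
    have : inner ℝ (y - metricProj K x) (y - metricProj K x)
        = inner ℝ (x - y) (metricProj K x - y)
          + inner ℝ (x - metricProj K x) (y - metricProj K x) := by
      simp only [inner_sub_left, inner_sub_right]
      ring
    linarith
  rw [real_inner_self_eq_norm_sq] at h3
  have h4 : ‖y - metricProj K x‖ = 0 := by nlinarith [norm_nonneg (y - metricProj K x)]
  exact sub_eq_zero.1 (norm_eq_zero.1 h4)

theorem isMetricProjection_iff {K : ConvexBody Plane} {x y : Plane} :
    IsMetricProjection K x y ↔ y = metricProj K x :=
  ⟨fun h => h.eq_metricProj, fun h => h ▸ isMetricProjection_metricProj K x⟩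

/-- Add the two variational inequalities, each tested at the other projection. Both the Lipschitz
bound and the monotonicity of the derivative of the projection come from this. -/
theorem norm_metricProj_sub_sq_le (K : ConvexBody Plane) (x y : Plane) :
    ‖metricProj K x - metricProj K y‖ ^ 2 ≤ inner ℝ (x - y) (metricProj K x - metricProj K y) := by
  have h1 := inner_sub_metricProj_le K x (metricProj_mem K y)
  have h2 := inner_sub_metricProj_le K y (metricProj_mem K x)
  rw [← real_inner_self_eq_norm_sq]
  simp only [inner_sub_left, inner_sub_right] at *
  linarith

theorem lipschitzWith_metricProj (K : ConvexBody Plane) : LipschitzWith 1 (metricProj K) := by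
  refine LipschitzWith.of_dist_le_mul fun x y => ?_
  simp only [NNReal.coe_one, one_mul, dist_eq_norm]
  have h := (norm_metricProj_sub_sq_le K x y).trans (real_inner_le_norm _ _)
  by_contra! hlt
  have h0 := norm_nonneg (x - y)
  nlinarith

theorem continuous_metricProj (K : ConvexBody Plane) : Continuous (metricProj K) :=
  (lipschitzWith_metricProj K).continuous

theorem metricProj_of_mem {K : ConvexBody Plane} {x : Plane} (hx : x ∈ K) :
    metricProj K x = x := by
  have : IsMetricProjection K x x := ⟨hx, by
    rw [dist_self, Metric.infDist_zero_of_mem (by exact hx)]⟩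
  exact this.eq_metricProj.symm

theorem metricProj_eq_self_iff {K : ConvexBody Plane} {x : Plane} :
    metricProj K x = x ↔ x ∈ K :=
  ⟨fun h => h ▸ metricProj_mem K x, metricProj_of_mem⟩

/-- The unit normal vectors of `K`, attached to their boundary points. -/
def normalBundle (K : ConvexBody Plane) : Set (Plane × UnitCircle) :=
  {q | q.1 ∈ K ∧ ∀ z ∈ K, inner ℝ (q.2 : Plane) (z - q.1) ≤ 0}

theorem isClosed_normalBundle (K : ConvexBody Plane) : IsClosed (normalBundle K) := by
  have h1 : IsClosed {q : Plane × UnitCircle | q.1 ∈ K} :=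
    K.isClosed.preimage continuous_fst
  have h2 : IsClosed {q : Plane × UnitCircle | ∀ z ∈ K, inner ℝ (q.2 : Plane) (z - q.1) ≤ 0} := by
    simp only [ofPred_forall]
    exact isClosed_iInter fun z => isClosed_iInter fun _ =>
      isClosed_le (by fun_prop) continuous_const
  exact h1.inter h2

theorem measurableSet_normalBundle (K : ConvexBody Plane) : MeasurableSet (normalBundle K) :=
  (isClosed_normalBundle K).measurableSet

theorem metricProj_add_smul {K : ConvexBody Plane} {q : Plane × UnitCircle}
    (hq : q ∈ normalBundle K) {t : ℝ} (ht : 0 ≤ t) :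
    metricProj K (q.1 + t • (q.2 : Plane)) = q.1 := by
  refine (IsMetricProjection.eq_metricProj (isMetricProjection_iff_inner.2 ⟨hq.1, ?_⟩)).symm
  intro z hz
  rw [add_sub_cancel_left, real_inner_smul_left]
  exact mul_nonpos_of_nonneg_of_nonpos ht (hq.2 z hz)

theorem norm_unitCircle (u : UnitCircle) : ‖(u : Plane)‖ = 1 := by
  simp

theorem unitCircle_ne_zero (u : UnitCircle) : (u : Plane) ≠ 0 := by
  intro h
  have := norm_unitCircle u
  simp [h] at this

theorem mem_add_closedBall_iff (K : ConvexBody Plane) {ε : ℝ} (x : Plane) :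
    x ∈ (K : Set Plane) + Metric.closedBall (0 : Plane) ε ↔
      Metric.infDist x (K : Set Plane) ≤ ε := by
  constructor
  · rintro ⟨k, hk, b, hb, rfl⟩
    refine (Metric.infDist_le_dist_of_mem hk).trans ?_
    simpa [dist_eq_norm] using hb
  · intro h
    refine ⟨metricProj K x, metricProj_mem K x, x - metricProj K x, ?_, by simp⟩
    rw [mem_closedBall_zero_iff, norm_sub_metricProj]
    exact h

theorem exists_unitCircle : ∃ u : Plane, ‖u‖ = 1 := ⟨EuclideanSpace.single 0 1, by simp⟩

/-- Outer normal direction at a point: the unit vector from the projection to the point, with an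
arbitrary unit vector as value on the body itself. -/
def normalDirVec (K : ConvexBody Plane) (x : Plane) : Plane :=
  open Classical in
  if x ∈ (K : Set Plane) then EuclideanSpace.single 0 1
  else ‖x - metricProj K x‖⁻¹ • (x - metricProj K x)

theorem sub_metricProj_ne_zero {K : ConvexBody Plane} {x : Plane} (hx : x ∉ K) :
    x - metricProj K x ≠ 0 := by
  intro h
  exact hx (metricProj_eq_self_iff.1 (sub_eq_zero.1 h).symm)

theorem infDist_pos_of_notMem {K : ConvexBody Plane} {x : Plane} (hx : x ∉ K) :
    0 < Metric.infDist x (K : Set Plane) := by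
  rw [← norm_sub_metricProj]
  exact norm_pos_iff.2 (sub_metricProj_ne_zero hx)

theorem norm_normalDirVec (K : ConvexBody Plane) (x : Plane) : ‖normalDirVec K x‖ = 1 := by
  unfold normalDirVec
  split_ifs with h
  · simp
  · have := norm_ne_zero_iff.2 (sub_metricProj_ne_zero h)
    rw [norm_smul, norm_inv, norm_norm, inv_mul_cancel₀ this]

/-- The map sending a point to its metric projection and outer normal direction. -/
def normalMap (K : ConvexBody Plane) (x : Plane) : Plane × UnitCircle :=
  (metricProj K x, ⟨normalDirVec K x, by simpa using norm_normalDirVec K x⟩)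

theorem measurable_normalDirVec (K : ConvexBody Plane) : Measurable (normalDirVec K) := by
  have hp := (continuous_metricProj K).measurable
  unfold normalDirVec
  exact Measurable.ite K.isClosed.measurableSet measurable_const (by fun_prop)

theorem measurable_normalMap (K : ConvexBody Plane) : Measurable (normalMap K) :=
  (continuous_metricProj K).measurable.prodMk ((measurable_normalDirVec K).subtype_mk)

theorem normalMap_snd_of_notMem {K : ConvexBody Plane} {x : Plane} (hx : x ∉ K) :
    ((normalMap K x).2 : Plane) = ‖x - metricProj K x‖⁻¹ • (x - metricProj K x) :=
  if_neg hx

theorem metricProj_add_infDist_smul {K : ConvexBody Plane} {x : Plane} (hx : x ∉ K) :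
    (normalMap K x).1 + Metric.infDist x (K : Set Plane) • ((normalMap K x).2 : Plane) = x := by
  have h := (infDist_pos_of_notMem hx).ne'
  rw [normalMap_snd_of_notMem hx, norm_sub_metricProj, smul_smul, mul_inv_cancel₀ h, one_smul]
  simp [normalMap]

theorem normalMap_mem_normalBundle {K : ConvexBody Plane} {x : Plane} (hx : x ∉ K) :
    normalMap K x ∈ normalBundle K := by
  refine ⟨metricProj_mem K x, fun z hz => ?_⟩
  rw [normalMap_snd_of_notMem hx, real_inner_smul_left]
  exact mul_nonpos_of_nonneg_of_nonpos (by positivity) (inner_sub_metricProj_le K x hz)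

theorem add_smul_notMem {K : ConvexBody Plane} {q : Plane × UnitCircle}
    (hq : q ∈ normalBundle K) {t : ℝ} (ht : 0 < t) : q.1 + t • (q.2 : Plane) ∉ K := by
  intro h
  have := metricProj_of_mem h
  rw [metricProj_add_smul hq ht.le] at this
  have h2 : t • (q.2 : Plane) = 0 := by simpa using this.symm
  rcases smul_eq_zero.1 h2 with h3 | h3
  · exact ht.ne' h3
  · exact unitCircle_ne_zero _ h3

theorem normalMap_add_smul {K : ConvexBody Plane} {q : Plane × UnitCircle}
    (hq : q ∈ normalBundle K) {t : ℝ} (ht : 0 < t) :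
    normalMap K (q.1 + t • (q.2 : Plane)) = q := by
  refine Prod.ext (metricProj_add_smul hq ht.le) (Subtype.ext ?_)
  rw [normalMap_snd_of_notMem (add_smul_notMem hq ht), metricProj_add_smul hq ht.le,
    add_sub_cancel_left, norm_smul, norm_unitCircle, smul_smul, Real.norm_of_nonneg ht.le]
  rw [mul_one, inv_mul_cancel₀ ht.ne', one_smul]

theorem infDist_add_smul {K : ConvexBody Plane} {q : Plane × UnitCircle}
    (hq : q ∈ normalBundle K) {t : ℝ} (ht : 0 ≤ t) :
    Metric.infDist (q.1 + t • (q.2 : Plane)) (K : Set Plane) = t := by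
  rw [← norm_sub_metricProj, metricProj_add_smul hq ht, add_sub_cancel_left, norm_smul,
    norm_unitCircle, mul_one, Real.norm_of_nonneg ht]

theorem mem_localParallelSet_iff {K : ConvexBody Plane} {ε : ℝ} {η : Set (Plane × UnitCircle)}
    {x : Plane} : x ∈ localParallelSet K ε η ↔
      x ∉ K ∧ Metric.infDist x (K : Set Plane) ≤ ε ∧ normalMap K x ∈ η := by
  unfold localParallelSet
  rw [mem_ofPred_eq, Set.mem_sdiff, mem_add_closedBall_iff]
  constructor
  · rintro ⟨⟨h1, h2⟩, p, hp, h3, h4⟩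
    refine ⟨h2, h1, ?_⟩
    have h5 := isMetricProjection_iff.1 h3
    have : normalMap K x = p := by
      refine Prod.ext h5.symm (Subtype.ext ?_)
      rw [normalMap_snd_of_notMem h2, h4, h5]
    rwa [this]
  · rintro ⟨h1, h2, h3⟩
    exact ⟨⟨h2, h1⟩, _, h3, isMetricProjection_metricProj K x, normalMap_snd_of_notMem h1⟩

/-- Makes the volume of a local parallel set, as a function of `η`, the push-forward of Lebesgue
measure under `normalMap`. -/
theorem localParallelSet_eq_inter (K : ConvexBody Plane) (ε : ℝ) (η : Set (Plane × UnitCircle)) :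
    localParallelSet K ε η = normalMap K ⁻¹' η ∩ localParallelSet K ε univ := by
  ext x
  simp only [mem_inter_iff, mem_preimage, mem_localParallelSet_iff, mem_univ]
  tauto

/-- Normal pairs and distances are coordinates for the exterior of the body. In particular a local
parallel set depends on `K` only through `η ∩ normalBundle K`. -/
theorem mem_localParallelSet_iff_exists {K : ConvexBody Plane} {ε : ℝ}
    {η : Set (Plane × UnitCircle)} {x : Plane} : x ∈ localParallelSet K ε η ↔
      ∃ q ∈ η ∩ normalBundle K, ∃ t ∈ Ioc 0 ε, q.1 + t • (q.2 : Plane) = x := by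
  rw [mem_localParallelSet_iff]
  constructor
  · rintro ⟨h1, h2, h3⟩
    exact ⟨_, ⟨h3, normalMap_mem_normalBundle h1⟩, _, ⟨infDist_pos_of_notMem h1, h2⟩,
      metricProj_add_infDist_smul h1⟩
  · rintro ⟨q, ⟨h1, h2⟩, t, ht, rfl⟩
    refine ⟨add_smul_notMem h2 ht.1, ?_, ?_⟩
    · rw [infDist_add_smul h2 ht.1.le]
      exact ht.2
    · rwa [normalMap_add_smul h2 ht.1]

theorem localParallelSet_congr {K M : ConvexBody Plane} {η : Set (Plane × UnitCircle)}
    (h : η ∩ normalBundle K = η ∩ normalBundle M) (ε : ℝ) :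
    localParallelSet K ε η = localParallelSet M ε η := by
  ext x
  simp only [mem_localParallelSet_iff_exists, h]

theorem measurableSet_localParallelSet (K : ConvexBody Plane) (ε : ℝ)
    {η : Set (Plane × UnitCircle)} (hη : MeasurableSet η) :
    MeasurableSet (localParallelSet K ε η) := by
  have : localParallelSet K ε η = (K : Set Plane)ᶜ ∩ ({x | Metric.infDist x (K : Set Plane) ≤ ε} ∩
      normalMap K ⁻¹' η) := by
    ext x
    exact mem_localParallelSet_iff
  rw [this]
  refine K.isClosed.measurableSet.compl.inter (MeasurableSet.inter ?_ (measurable_normalMap K hη))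
  exact (isClosed_le (Metric.continuous_infDist_pt _) continuous_const).measurableSet

theorem isCompact_parallelBody (K : ConvexBody Plane) (ε : ℝ) :
    IsCompact ((K : Set Plane) + Metric.closedBall (0 : Plane) ε) :=
  K.isCompact.add (isCompact_closedBall _ _)

theorem localParallelSet_subset (K : ConvexBody Plane) (ε : ℝ) (η : Set (Plane × UnitCircle)) :
    localParallelSet K ε η ⊆ (K : Set Plane) + Metric.closedBall (0 : Plane) ε :=
  fun _ hx => hx.1.1

theorem volume_localParallelSet_lt_top (K : ConvexBody Plane) (ε : ℝ)
    (η : Set (Plane × UnitCircle)) : volume (localParallelSet K ε η) < ∞ :=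
  (measure_mono (localParallelSet_subset K ε η)).trans_lt (isCompact_parallelBody K ε).measure_lt_top

/-! ### The local Steiner formula -/

theorem clm_apply_plane (D : Plane →L[ℝ] Plane) (u : Plane) (i : Fin 2) :
    D u i = u 0 * D (EuclideanSpace.single 0 1) i + u 1 * D (EuclideanSpace.single 1 1) i := by
  have : u = u 0 • EuclideanSpace.single 0 (1 : ℝ) + u 1 • EuclideanSpace.single 1 (1 : ℝ) := by
    ext j
    fin_cases j <;> simp
  conv_lhs => rw [this]
  simp only [map_add, map_smul, PiLp.add_apply, PiLp.smul_apply, smul_eq_mul]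

theorem clm_det_plane (D : Plane →L[ℝ] Plane) :
    D.det = D (EuclideanSpace.single 0 1) 0 * D (EuclideanSpace.single 1 1) 1 -
      D (EuclideanSpace.single 1 1) 0 * D (EuclideanSpace.single 0 1) 1 := by
  have h : D.det = LinearMap.det (D : Plane →ₗ[ℝ] Plane) := rfl
  rw [h, ← LinearMap.det_toMatrix (EuclideanSpace.basisFun (Fin 2) ℝ).toBasis, Matrix.det_fin_two]
  simp [LinearMap.toMatrix_apply]

/-- The trace of an endomorphism of the plane. -/
def planeTrace (D : Plane →L[ℝ] Plane) : ℝ :=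
  D (EuclideanSpace.single 0 1) 0 + D (EuclideanSpace.single 1 1) 1

/-- In general there is a third term `b² det D`; it drops out because `D` has a kernel. -/
theorem det_smul_id_add_smul {D : Plane →L[ℝ] Plane} {u : Plane} (hu : u ≠ 0) (hD : D u = 0)
    (a b : ℝ) :
    (a • ContinuousLinearMap.id ℝ Plane + b • D).det = a ^ 2 + a * b * planeTrace D := by
  have h0 : D u 0 = 0 := by rw [hD]; rfl
  have h1 : D u 1 = 0 := by rw [hD]; rfl
  rw [clm_apply_plane] at h0 h1
  have hdet : D (EuclideanSpace.single 0 1) 0 * D (EuclideanSpace.single 1 1) 1 -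
      D (EuclideanSpace.single 1 1) 0 * D (EuclideanSpace.single 0 1) 1 = 0 := by
    by_contra hne
    -- Cramer's rule: the determinant annihilates both coordinates of a kernel vector.
    have e0 : u 0 = 0 := by
      refine (mul_eq_zero.1 ?_).resolve_right hne
      linear_combination D (EuclideanSpace.single 1 1) 1 * h0 -
        D (EuclideanSpace.single 1 1) 0 * h1
    have e1 : u 1 = 0 := by
      refine (mul_eq_zero.1 ?_).resolve_right hne
      linear_combination D (EuclideanSpace.single 0 1) 0 * h1 -
        D (EuclideanSpace.single 0 1) 1 * h0
    apply hu
    ext j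
    fin_cases j
    · exact e0
    · exact e1
  rw [clm_det_plane]
  simp [planeTrace]
  linear_combination b ^ 2 * hdet

theorem norm_sq_plane (u : Plane) : ‖u‖ ^ 2 = u 0 ^ 2 + u 1 ^ 2 := by
  rw [EuclideanSpace.norm_sq_eq]
  simp

theorem inner_plane (u v : Plane) : inner ℝ u v = u 0 * v 0 + u 1 * v 1 := by
  rw [PiLp.inner_apply]
  simp [mul_comm]

/-- The trace may be computed in the orthonormal frame `u`, `quarterTurn u`, where the first
diagonal entry vanishes. -/
theorem planeTrace_eq_inner {D : Plane →L[ℝ] Plane} {u : Plane} (hu : ‖u‖ = 1) (hD : D u = 0) :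
    planeTrace D = inner ℝ (D (quarterTurn u)) (quarterTurn u) := by
  have h0 : D u 0 = 0 := by rw [hD]; rfl
  have h1 : D u 1 = 0 := by rw [hD]; rfl
  rw [clm_apply_plane] at h0 h1
  have hn := norm_sq_plane u
  rw [hu] at hn
  rw [inner_plane, clm_apply_plane D (quarterTurn u) 0, clm_apply_plane D (quarterTurn u) 1,
    planeTrace]
  simp only [quarterTurn, PiLp.toLp_apply, Matrix.cons_val_zero, Matrix.cons_val_one]
  linear_combination u 0 * h0 + u 1 * h1 +
    (D (EuclideanSpace.single 0 1) 0 + D (EuclideanSpace.single 1 1) 1) * hn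

theorem norm_quarterTurn (u : Plane) : ‖quarterTurn u‖ = ‖u‖ := by
  have h : ‖quarterTurn u‖ ^ 2 = ‖u‖ ^ 2 := by
    rw [norm_sq_plane, norm_sq_plane]
    simp [quarterTurn]
    ring
  exact (pow_left_inj₀ (norm_nonneg _) (norm_nonneg _) two_ne_zero).1 h

/-- The projection is constant along the outer normal ray through `x`. -/
theorem fderiv_metricProj_apply_sub {K : ConvexBody Plane} {x : Plane} (hx : x ∉ K)
    (hd : DifferentiableAt ℝ (metricProj K) x) :
    fderiv ℝ (metricProj K) x (x - metricProj K x) = 0 := by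
  have h1 : HasDerivAt (fun t : ℝ => metricProj K (x + t • (x - metricProj K x)))
      (fderiv ℝ (metricProj K) x (x - metricProj K x)) 0 := by
    have hd' : HasFDerivAt (metricProj K) (fderiv ℝ (metricProj K) x)
        (x + (0 : ℝ) • (x - metricProj K x)) := by simpa using hd.hasFDerivAt
    have hl : HasDerivAt (fun t : ℝ => x + t • (x - metricProj K x)) (x - metricProj K x) 0 := by
      simpa using ((hasDerivAt_id (0 : ℝ)).smul_const (x - metricProj K x)).const_add x
    exact hd'.comp_hasDerivAt (0 : ℝ) hl
  have h2 : (fun t : ℝ => metricProj K (x + t • (x - metricProj K x))) =ᶠ[𝓝 0]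
      fun _ => metricProj K x := by
    -- For `t > -1` the point stays on the normal ray, at `1 + t` times the original distance.
    filter_upwards [lt_mem_nhds (show (-1 : ℝ) < 0 by norm_num)] with t ht
    have hq := normalMap_mem_normalBundle hx
    have hpos := infDist_pos_of_notMem hx
    have := metricProj_add_smul hq (t := (1 + t) * Metric.infDist x (K : Set Plane))
      (by nlinarith)
    have e : (normalMap K x).1 + ((1 + t) * Metric.infDist x (K : Set Plane)) •
        ((normalMap K x).2 : Plane) = x + t • (x - metricProj K x) := by
      have h3 := metricProj_add_infDist_smul hx
      have h4 : Metric.infDist x (K : Set Plane) • ((normalMap K x).2 : Plane) =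
          x - metricProj K x := eq_sub_of_add_eq' h3
      rw [mul_smul, h4, add_smul, one_smul, ← add_assoc]
      simp [normalMap]
    rw [e] at this
    exact this
  exact h1.unique ((hasDerivAt_const (0 : ℝ) (metricProj K x)).congr_of_eventuallyEq h2)

theorem inner_fderiv_metricProj_nonneg {K : ConvexBody Plane} {x : Plane}
    (hd : DifferentiableAt ℝ (metricProj K) x) (v : Plane) :
    0 ≤ inner ℝ (fderiv ℝ (metricProj K) x v) v := by
  have h1 := (hd.hasFDerivAt.hasLineDerivAt v).tendsto_slope_zero_right
  have h2 := h1.inner (𝕜 := ℝ) (tendsto_const_nhds (x := v))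
  refine ge_of_tendsto h2 ?_
  filter_upwards [self_mem_nhdsWithin] with t (ht : 0 < t)
  rw [real_inner_smul_left]
  have h3 := (sq_nonneg _).trans (norm_metricProj_sub_sq_le K (x + t • v) x)
  rw [add_sub_cancel_left, real_inner_smul_left, real_inner_comm] at h3
  exact mul_nonneg (by positivity) (nonneg_of_mul_nonneg_right h3 ht)

/-- The trace is the quadratic form of the derivative in the tangent direction, nonnegative by
monotonicity and at most one by the Lipschitz bound. These bounds make the coefficients of the
Steiner polynomial nonnegative measures. -/
theorem planeTrace_fderiv_metricProj_mem {K : ConvexBody Plane} {x : Plane} (hx : x ∉ K)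
    (hd : DifferentiableAt ℝ (metricProj K) x) :
    planeTrace (fderiv ℝ (metricProj K) x) ∈ Icc 0 1 := by
  have hD := fderiv_metricProj_apply_sub hx hd
  have hu : ‖‖x - metricProj K x‖⁻¹ • (x - metricProj K x)‖ = 1 := by
    rw [← normalMap_snd_of_notMem hx, norm_unitCircle]
  rw [planeTrace_eq_inner hu (by rw [map_smul, hD, smul_zero])]
  refine ⟨inner_fderiv_metricProj_nonneg hd _, (real_inner_le_norm _ _).trans ?_⟩
  have h1 : ‖fderiv ℝ (metricProj K) x‖ ≤ 1 := by
    simpa using norm_fderiv_le_of_lipschitz ℝ (lipschitzWith_metricProj K) (x₀ := x)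
  have h2 := (fderiv ℝ (metricProj K) x).le_of_opNorm_le h1
    (quarterTurn (‖x - metricProj K x‖⁻¹ • (x - metricProj K x)))
  rw [norm_quarterTurn, hu] at h2 ⊢
  linarith

/-- Dilation by the factor `c` along the outer normals of `K`. -/
def normalDilation (K : ConvexBody Plane) (c : ℝ) (x : Plane) : Plane :=
  c • x + (1 - c) • metricProj K x

theorem normalDilation_add_smul {K : ConvexBody Plane} {q : Plane × UnitCircle}
    (hq : q ∈ normalBundle K) (c : ℝ) {t : ℝ} (ht : 0 < t) :
    normalDilation K c (q.1 + t • (q.2 : Plane)) = q.1 + (c * t) • (q.2 : Plane) := by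
  rw [normalDilation, metricProj_add_smul hq ht.le]
  module

/-- In the coordinates given by normal pair and distance, the dilation multiplies the distance by
`c`. -/
theorem normalDilation_image_localParallelSet (K : ConvexBody Plane) {c : ℝ} (hc : 0 < c)
    (η : Set (Plane × UnitCircle)) :
    normalDilation K c '' localParallelSet K 1 η = localParallelSet K c η := by
  ext y
  simp only [mem_image, mem_localParallelSet_iff_exists]
  constructor
  · rintro ⟨x, ⟨q, hq, t, ht, rfl⟩, rfl⟩
    refine ⟨q, hq, c * t, ⟨mul_pos hc ht.1, by nlinarith [ht.2]⟩, ?_⟩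
    rw [normalDilation_add_smul hq.2 c ht.1]
  · rintro ⟨q, hq, t, ht, rfl⟩
    refine ⟨_, ⟨q, hq, t / c, ⟨div_pos ht.1 hc, (div_le_one hc).2 ht.2⟩, rfl⟩, ?_⟩
    rw [normalDilation_add_smul hq.2 c (div_pos ht.1 hc), mul_div_cancel₀ _ hc.ne']

theorem injOn_normalDilation (K : ConvexBody Plane) {c : ℝ} (hc : 0 < c) :
    InjOn (normalDilation K c) (K : Set Plane)ᶜ := by
  have key : ∀ x ∉ K, normalMap K (normalDilation K c x) = normalMap K x ∧
      Metric.infDist (normalDilation K c x) (K : Set Plane) =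
        c * Metric.infDist x (K : Set Plane) := by
    intro x hx
    have hq := normalMap_mem_normalBundle hx
    have hpos := infDist_pos_of_notMem hx
    have e := normalDilation_add_smul hq c hpos
    rw [metricProj_add_infDist_smul hx] at e
    rw [e]
    exact ⟨normalMap_add_smul hq (mul_pos hc hpos), infDist_add_smul hq (mul_pos hc hpos).le⟩
  intro x hx y hy hxy
  obtain ⟨h1, h2⟩ := key x hx
  obtain ⟨h3, h4⟩ := key y hy
  rw [hxy] at h1 h2
  rw [← metricProj_add_infDist_smul hx, ← metricProj_add_infDist_smul hy, ← h1, ← h3,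
    mul_left_cancel₀ hc.ne' (h2.symm.trans h4)]

/-- Two-dimensional Hausdorff measure is a Haar measure, so it has the same null sets as Lebesgue
measure, and Lipschitz maps increase it at most by a constant factor. -/
theorem LipschitzWith.volume_image_eq_zero {f : Plane → Plane} {C : NNReal} (hf : LipschitzWith C f)
    {s : Set Plane} (hs : volume s = 0) : volume (f '' s) = 0 := by
  have hH : (μH[(2 : ℕ)] : Measure Plane).IsAddHaarMeasure := by
    have := isAddHaarMeasure_hausdorffMeasure (E := Plane)
    rwa [finrank_euclideanSpace_fin] at this
  have h1 : (μH[(2 : ℕ)] : Measure Plane) s = 0 :=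
    Measure.absolutelyContinuous_isAddHaarMeasure _ volume hs
  have h2 := hf.hausdorffMeasure_image_le (d := ((2 : ℕ) : ℝ)) (by positivity) s
  rw [h1, mul_zero, nonpos_iff_eq_zero] at h2
  exact Measure.absolutelyContinuous_isAddHaarMeasure volume _ h2

theorem lipschitzWith_normalDilation (K : ConvexBody Plane) (c : ℝ) :
    ∃ C, LipschitzWith C (normalDilation K c) :=
  ⟨_, ((lipschitzWith_smul c).comp LipschitzWith.id).add
    ((lipschitzWith_smul (1 - c)).comp (lipschitzWith_metricProj K))⟩

theorem ae_differentiableAt_metricProj (K : ConvexBody Plane) :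
    ∀ᵐ x, DifferentiableAt ℝ (metricProj K) x :=
  (lipschitzWith_metricProj K).ae_differentiableAt

/-- The trace of the differential of the metric projection. -/
def projTrace (K : ConvexBody Plane) (x : Plane) : ℝ := planeTrace (fderiv ℝ (metricProj K) x)

theorem measurable_projTrace (K : ConvexBody Plane) : Measurable (projTrace K) := by
  have h (v : Plane) : Measurable fun x => fderiv ℝ (metricProj K) x v :=
    measurable_fderiv_apply_const ℝ _ v
  have h' (i : Fin 2) : Measurable fun x : Plane => x i := by fun_prop
  exact ((h' 0).comp (h _)).add ((h' 1).comp (h _))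

/-- Change of variables along `normalDilation K c`. With `τ = projTrace K` the Jacobian is `c² + c(1
- c)τ = c²(1 - τ) + cτ`, so that the volume is a polynomial in `c` whose coefficients are measures
in `η`. -/
theorem volume_localParallelSet_eq_lintegral (K : ConvexBody Plane) {c : ℝ} (hc : 0 < c)
    {η : Set (Plane × UnitCircle)} (hη : MeasurableSet η) :
    volume (localParallelSet K c η) =
      ENNReal.ofReal (c ^ 2) *
        (∫⁻ x in localParallelSet K 1 η, ENNReal.ofReal (1 - projTrace K x)) +
      ENNReal.ofReal c * ∫⁻ x in localParallelSet K 1 η, ENNReal.ofReal (projTrace K x) := by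
  set A := localParallelSet K 1 η with hA
  set G := {x | DifferentiableAt ℝ (metricProj K) x} with hG
  have hGm : MeasurableSet G := measurableSet_of_differentiableAt ℝ _
  have hAm : MeasurableSet A := measurableSet_localParallelSet K 1 hη
  have hGn : volume Gᶜ = 0 := ae_differentiableAt_metricProj K
  have hAK : ∀ x ∈ A, x ∉ K := fun x hx => (mem_localParallelSet_iff.1 hx).1
  obtain ⟨C, hC⟩ := lipschitzWith_normalDilation K c
  -- Points without derivative form a null set by Rademacher's theorem, and the Lipschitz dilation
  -- maps it to a null set.
  have h1 : volume (normalDilation K c '' A) = volume (normalDilation K c '' (A ∩ G)) := by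
    apply le_antisymm
    · have : A ⊆ (A ∩ G) ∪ Gᶜ := fun x hx => by
        by_cases h : x ∈ G
        · exact Or.inl ⟨hx, h⟩
        · exact Or.inr h
      refine (measure_mono (image_mono this)).trans ?_
      rw [image_union]
      refine (measure_union_le _ _).trans ?_
      rw [hC.volume_image_eq_zero hGn, add_zero]
    · exact measure_mono (image_mono inter_subset_left)
  have hder : ∀ x ∈ A ∩ G, HasFDerivWithinAt (normalDilation K c)
      (c • ContinuousLinearMap.id ℝ Plane + (1 - c) • fderiv ℝ (metricProj K) x) (A ∩ G) x := by
    intro x hx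
    have hd : DifferentiableAt ℝ (metricProj K) x := hx.2
    exact (((hasFDerivAt_id x).const_smul c).add
      (hd.hasFDerivAt.const_smul (1 - c))).hasFDerivWithinAt
  have hinj : InjOn (normalDilation K c) (A ∩ G) :=
    (injOn_normalDilation K hc).mono fun x hx => hAK x hx.1
  rw [← normalDilation_image_localParallelSet K hc, h1,
    ← lintegral_abs_det_fderiv_eq_addHaar_image volume (hAm.inter hGm) hder hinj]
  have hae : volume.restrict A = volume.restrict (A ∩ G) := by
    refine Measure.restrict_congr_set ?_
    filter_upwards [ae_differentiableAt_metricProj K] with x hx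
    have : x ∈ G := hx
    exact propext ⟨fun h => ⟨h, this⟩, fun h => h.1⟩
  have hm := measurable_projTrace K
  rw [← lintegral_const_mul _ (by fun_prop), ← lintegral_const_mul _ (by fun_prop),
    ← lintegral_add_left (by fun_prop), hae]
  refine setLIntegral_congr_fun (hAm.inter hGm) fun x hx => ?_
  have hxK := hAK x hx.1
  have htr := planeTrace_fderiv_metricProj_mem hxK hx.2
  rw [det_smul_id_add_smul (sub_metricProj_ne_zero hxK) (fderiv_metricProj_apply_sub hxK hx.2)]
  change _ = ENNReal.ofReal (c ^ 2) * ENNReal.ofReal (1 - planeTrace (fderiv ℝ (metricProj K) x)) +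
    ENNReal.ofReal c * ENNReal.ofReal (planeTrace (fderiv ℝ (metricProj K) x))
  generalize planeTrace (fderiv ℝ (metricProj K) x) = a at htr
  have h1a : 0 ≤ 1 - a := by linarith [htr.2]
  have ha : 0 ≤ a := htr.1
  rw [← ENNReal.ofReal_mul (by positivity), ← ENNReal.ofReal_mul (by positivity),
    ← ENNReal.ofReal_add (by positivity) (by positivity)]
  congr 1
  rw [abs_of_nonneg]
  · ring
  · have : c ^ 2 + c * (1 - c) * a = c ^ 2 * (1 - a) + c * a := by ring
    rw [this]
    positivity

theorem ballVolume_two : ballVolume 2 = Real.pi := by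
  norm_num [ballVolume, Real.Gamma_two]

theorem ballVolume_one : ballVolume 1 = 2 := by
  have hpi : √Real.pi ≠ 0 := by positivity
  have h : Real.Gamma (1 + 1 / 2) = 1 / 2 * √Real.pi := by
    rw [add_comm, Real.Gamma_add_one (by norm_num), Real.Gamma_one_half_eq]
  rw [ballVolume, Nat.cast_one, h, ← Real.sqrt_eq_rpow]
  field_simp

/-- Push the two densities forward under `normalMap`; the factors `1/π` and `1/2` compensate the
ball volumes in the Steiner formula. -/
theorem exists_isSupportMeasures (K : ConvexBody Plane) :
    ∃ Λ : Measure (Plane × UnitCircle) × Measure (Plane × UnitCircle),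
      IsSupportMeasures K Λ.1 Λ.2 := by
  set N := volume.restrict (localParallelSet K 1 univ)
  have hm := measurable_projTrace K
  refine ⟨(ENNReal.ofReal Real.pi⁻¹ • (N.withDensity fun x => ENNReal.ofReal (1 - projTrace K x)).map
      (normalMap K), ENNReal.ofReal 2⁻¹ •
      (N.withDensity fun x => ENNReal.ofReal (projTrace K x)).map (normalMap K)), ?_⟩
  intro ε hε η hη
  have key (f : Plane → ℝ≥0∞) : (N.withDensity f).map (normalMap K) η =
      ∫⁻ x in localParallelSet K 1 η, f x := by
    rw [Measure.map_apply (measurable_normalMap K) hη,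
      withDensity_apply _ (measurable_normalMap K hη),
      Measure.restrict_restrict (measurable_normalMap K hη), ← localParallelSet_eq_inter]
  rw [volume_localParallelSet_eq_lintegral K hε hη, ballVolume_two, ballVolume_one]
  simp only [Measure.smul_apply, key, smul_eq_mul, ← mul_assoc]
  have hpi := Real.pi_pos
  rw [← ENNReal.ofReal_mul (by positivity), ← ENNReal.ofReal_mul (by positivity)]
  congr 3
  · field_simp
  · ring

theorem exists_isSupportMeasures_supportMeasure (K : ConvexBody Plane) :
    ∃ Λ₀, IsSupportMeasures K Λ₀ (supportMeasure K) := by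
  have h := exists_isSupportMeasures K
  refine ⟨h.choose.1, ?_⟩
  rw [supportMeasure, dif_pos h]
  exact h.choose_spec

/-- Parallel volumes at the distances `1` and `2` determine the support measure of order one. -/
theorem four_mul_volume_localParallelSet (K : ConvexBody Plane) {η : Set (Plane × UnitCircle)}
    (hη : MeasurableSet η) :
    4 * volume (localParallelSet K 1 η) =
      volume (localParallelSet K 2 η) + 4 * supportMeasure K η := by
  obtain ⟨Λ₀, h⟩ := exists_isSupportMeasures_supportMeasure K
  rw [h 1 one_pos η hη, h 2 two_pos η hη, ballVolume_one, ballVolume_two]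
  have hpi := Real.pi_pos
  rw [ENNReal.ofReal_mul (by positivity), ENNReal.ofReal_mul (p := 2 ^ 2) (by positivity)]
  norm_num
  ring

theorem two_mul_supportMeasure_le (K : ConvexBody Plane) {η : Set (Plane × UnitCircle)}
    (hη : MeasurableSet η) {ε : ℝ} (hε : 0 < ε) :
    ENNReal.ofReal (ε * 2) * supportMeasure K η ≤ volume (localParallelSet K ε η) := by
  obtain ⟨Λ₀, h⟩ := exists_isSupportMeasures_supportMeasure K
  rw [h ε hε η hη, ballVolume_one]
  exact le_add_self

instance isFiniteMeasure_supportMeasure (K : ConvexBody Plane) :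
    IsFiniteMeasure (supportMeasure K) := by
  refine ⟨?_⟩
  have h := (two_mul_supportMeasure_le K MeasurableSet.univ one_pos).trans_lt
    (volume_localParallelSet_lt_top K 1 univ)
  by_contra htop
  rw [not_lt, top_le_iff] at htop
  rw [htop] at h
  norm_num at h

theorem supportMeasure_eq_of_volume_eq {K M : ConvexBody Plane} {η ζ : Set (Plane × UnitCircle)}
    (hη : MeasurableSet η) (hζ : MeasurableSet ζ)
    (h : ∀ ε, volume (localParallelSet K ε η) = volume (localParallelSet M ε ζ)) :
    supportMeasure K η = supportMeasure M ζ := by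
  have h1 := four_mul_volume_localParallelSet K hη
  have h2 := four_mul_volume_localParallelSet M hζ
  rw [h, h, h2] at h1
  have h3 := (ENNReal.add_right_inj (volume_localParallelSet_lt_top M 2 ζ).ne).1 h1
  exact ((ENNReal.mul_right_inj (by norm_num) (by norm_num)).1 h3).symm

/-- Local determination: parallel sets see only the normal pairs in `η`, and parallel volumes
determine the support measure. -/
theorem supportMeasure_congr {K M : ConvexBody Plane} {η : Set (Plane × UnitCircle)}
    (hη : MeasurableSet η) (h : η ∩ normalBundle K = η ∩ normalBundle M) :
    supportMeasure K η = supportMeasure M η :=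
  supportMeasure_eq_of_volume_eq hη hη fun ε => by rw [localParallelSet_congr h]

theorem supportMeasure_compl_normalBundle (K : ConvexBody Plane) :
    supportMeasure K (normalBundle K)ᶜ = 0 := by
  have h := two_mul_supportMeasure_le K (measurableSet_normalBundle K).compl one_pos
  have h0 : localParallelSet K 1 (normalBundle K)ᶜ = ∅ := by
    ext x
    simp [mem_localParallelSet_iff_exists]
  rw [h0, measure_empty, nonpos_iff_eq_zero, mul_eq_zero] at h
  exact h.resolve_left (by norm_num)

/-- Over a single point the local parallel set lies in a disc of area `O(ε²)`, whereas the support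
measure enters with a factor `2ε`. -/
theorem supportMeasure_singleton_prod (K : ConvexBody Plane) (y : Plane) :
    supportMeasure K ({y} ×ˢ univ) = 0 := by
  have hm : MeasurableSet ({y} ×ˢ univ : Set (Plane × UnitCircle)) :=
    (measurableSet_singleton y).prod MeasurableSet.univ
  have h : ∀ ε : ℝ, 0 < ε → ENNReal.ofReal (ε * 2) * supportMeasure K ({y} ×ˢ univ) ≤
      ENNReal.ofReal (ε ^ 2) * volume (Metric.closedBall (0 : Plane) 1) := by
    intro ε hε
    refine (two_mul_supportMeasure_le K hm hε).trans ?_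
    have hsub : localParallelSet K ε ({y} ×ˢ univ) ⊆ Metric.closedBall y ε := by
      intro x hx
      obtain ⟨q, ⟨h1, -⟩, t, ht, rfl⟩ := mem_localParallelSet_iff_exists.1 hx
      have hq : q.1 = y := h1.1
      rw [Metric.mem_closedBall, dist_eq_norm, hq, add_sub_cancel_left, norm_smul, norm_unitCircle,
        mul_one, Real.norm_of_nonneg ht.1.le]
      exact ht.2
    refine (measure_mono hsub).trans ?_
    rw [Measure.addHaar_closedBall' volume y hε.le, finrank_euclideanSpace_fin]
  have hfin : volume (Metric.closedBall (0 : Plane) 1) ≠ ∞ := measure_closedBall_lt_top.ne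
  have hfin2 := measure_ne_top (supportMeasure K) ({y} ×ˢ univ)
  have h' : ∀ ε : ℝ, 0 < ε → (supportMeasure K ({y} ×ˢ univ)).toReal * 2 ≤
      ε * (volume (Metric.closedBall (0 : Plane) 1)).toReal := by
    intro ε hε
    have := ENNReal.toReal_mono (ENNReal.mul_ne_top ENNReal.ofReal_ne_top hfin) (h ε hε)
    rw [ENNReal.toReal_mul, ENNReal.toReal_mul, ENNReal.toReal_ofReal (by positivity),
      ENNReal.toReal_ofReal (by positivity)] at this
    have : ε * ((supportMeasure K ({y} ×ˢ univ)).toReal * 2) ≤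
      ε * (ε * (volume (Metric.closedBall (0 : Plane) 1)).toReal) := by nlinarith
    exact le_of_mul_le_mul_left this hε
  have h0 : (supportMeasure K ({y} ×ˢ univ)).toReal * 2 ≤ 0 := by
    have ht : Tendsto (fun ε : ℝ => ε * (volume (Metric.closedBall (0 : Plane) 1)).toReal)
        (𝓝[>] 0) (𝓝 0) := by
      have : Tendsto (fun ε : ℝ => ε * (volume (Metric.closedBall (0 : Plane) 1)).toReal)
        (𝓝 0) (𝓝 (0 * _)) := tendsto_id.mul_const _
      rw [zero_mul] at this
      exact this.mono_left nhdsWithin_le_nhds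
    refine ge_of_tendsto ht ?_
    filter_upwards [self_mem_nhdsWithin] with ε hε using h' ε hε
  have := ENNReal.toReal_nonneg (a := supportMeasure K ({y} ×ˢ univ))
  exact ((ENNReal.toReal_eq_zero_iff _).1 (by linarith)).resolve_right hfin2

/-! ### Support functions -/

theorem bddAbove_inner_image {A : Set Plane} (hA : IsCompact A) (x : Plane) :
    BddAbove ((fun y => inner ℝ x y) '' A) :=
  (hA.image (by fun_prop)).bddAbove

theorem inner_le_supportFun (K : ConvexBody Plane) (x : Plane) {y : Plane} (hy : y ∈ K) :
    inner ℝ x y ≤ supportFun K x :=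
  le_csSup (bddAbove_inner_image K.isCompact x) ⟨y, hy, rfl⟩

theorem supportFun_le {K : ConvexBody Plane} {x : Plane} {c : ℝ}
    (h : ∀ y ∈ K, inner ℝ x y ≤ c) : supportFun K x ≤ c := by
  refine csSup_le (K.nonempty.image _) ?_
  rintro _ ⟨y, hy, rfl⟩
  exact h y hy

theorem exists_norm_le (K : ConvexBody Plane) : ∃ C : ℝ, 0 ≤ C ∧ ∀ y ∈ K, ‖y‖ ≤ C := by
  obtain ⟨C, hC⟩ := K.isBounded.exists_norm_le
  obtain ⟨y, hy⟩ := K.nonempty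
  exact ⟨C, (norm_nonneg y).trans (hC y hy), fun y hy => hC y hy⟩

theorem supportFun_sub_le {K : ConvexBody Plane} {C : ℝ} (hC : ∀ y ∈ K, ‖y‖ ≤ C) (x y : Plane) :
    supportFun K x ≤ supportFun K y + C * ‖x - y‖ := by
  refine supportFun_le fun z hz => ?_
  have h1 : inner ℝ x z = inner ℝ y z + inner ℝ (x - y) z := by rw [inner_sub_left]; ring
  have h2 := real_inner_le_norm (x - y) z
  have h3 := inner_le_supportFun K y hz
  have h4 := mul_le_mul_of_nonneg_left (hC z hz) (norm_nonneg (x - y))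
  linarith

theorem lipschitzWith_supportFun {K : ConvexBody Plane} {C : NNReal} (hC : ∀ y ∈ K, ‖y‖ ≤ C) :
    LipschitzWith C (supportFun K) :=
  LipschitzWith.of_le_add_mul C fun x y => by
    rw [dist_eq_norm]
    exact supportFun_sub_le hC x y

theorem exists_lipschitzWith_supportFun (K : ConvexBody Plane) :
    ∃ C, LipschitzWith C (supportFun K) := by
  obtain ⟨C, h0, hC⟩ := exists_norm_le K
  exact ⟨⟨C, h0⟩, lipschitzWith_supportFun hC⟩

theorem supportFun_smul (K : ConvexBody Plane) {t : ℝ} (ht : 0 ≤ t) (x : Plane) :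
    supportFun K (t • x) = t * supportFun K x := by
  have h : (fun y => inner ℝ (t • x) y) '' (K : Set Plane) =
      t • ((fun y => inner ℝ x y) '' (K : Set Plane)) := by
    rw [← image_smul, image_image]
    simp only [real_inner_smul_left, smul_eq_mul]
  rw [supportFun, h, Real.sSup_smul_of_nonneg ht, smul_eq_mul]
  rfl

/-- The variational inequality at the far point `t • y`, divided by `t`: its projection almost
maximizes `⟨y, ·⟩` on `K`. -/
theorem supportFun_le_inner_metricProj {K : ConvexBody Plane} {C : ℝ} (hC : ∀ y ∈ K, ‖y‖ ≤ C)
    (y : Plane) {t : ℝ} (ht : 0 < t) :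
    supportFun K y ≤ inner ℝ y (metricProj K (t • y)) + 2 * C ^ 2 / t := by
  refine supportFun_le fun z hz => ?_
  set p := metricProj K (t • y)
  have hp : p ∈ K := metricProj_mem K _
  have h1 := inner_sub_metricProj_le K (t • y) hz
  have h2 : t * inner ℝ y z ≤ t * inner ℝ y p + inner ℝ p (z - p) := by
    have : inner ℝ (t • y - p) (z - p) = t * inner ℝ y z - t * inner ℝ y p - inner ℝ p (z - p) := by
      simp only [inner_sub_left, inner_sub_right, real_inner_smul_left]
      ring
    change inner ℝ (t • y - p) (z - p) ≤ 0 at h1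
    linarith
  have h3 : inner ℝ p (z - p) ≤ 2 * C ^ 2 := by
    have h4 := real_inner_le_norm p (z - p)
    have h5 := norm_sub_le z p
    have h6 := hC z hz
    have h7 := hC p hp
    have h8 := norm_nonneg p
    have h9 := norm_nonneg (z - p)
    nlinarith
  have h4 : t * (2 * C ^ 2 / t) = 2 * C ^ 2 := mul_div_cancel₀ _ ht.ne'
  refine le_of_mul_le_mul_left ?_ ht
  linarith

/-- The projections of `ny` are near-maximizers of `⟨y, ·⟩`, so testing the support function at `y +
tv` bounds `⟨v, p(ny)⟩` by a difference quotient up to `O(1/n)`. The lower bound is the upper bound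
for `-v`. -/
theorem tendsto_inner_metricProj_smul {K : ConvexBody Plane} {y : Plane}
    (hd : DifferentiableAt ℝ (supportFun K) y) (v : Plane) :
    Tendsto (fun n : ℕ => inner ℝ v (metricProj K ((n : ℝ) • y))) atTop
      (𝓝 (fderiv ℝ (supportFun K) y v)) := by
  obtain ⟨C, h0, hC⟩ := exists_norm_le K
  have upper : ∀ v : Plane, ∀ c, fderiv ℝ (supportFun K) y v < c →
      ∀ᶠ n : ℕ in atTop, inner ℝ v (metricProj K ((n : ℝ) • y)) < c := by
    intro v c hc
    have h1 := (hd.hasFDerivAt.hasLineDerivAt v).tendsto_slope_zero_right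
    obtain ⟨t, ht1, ht0⟩ := ((h1.eventually_lt_const hc).and self_mem_nhdsWithin).exists
    have ht0 : 0 < t := ht0
    have h2 : Tendsto (fun n : ℕ => t⁻¹ • (supportFun K (y + t • v) - supportFun K y) +
        2 * C ^ 2 / t / (n : ℝ)) atTop
        (𝓝 (t⁻¹ • (supportFun K (y + t • v) - supportFun K y) + 0)) :=
      tendsto_const_nhds.add (tendsto_const_div_atTop_nhds_zero_nat _)
    rw [add_zero] at h2
    filter_upwards [h2.eventually_lt_const ht1, eventually_gt_atTop 0] with n hn hn0
    refine lt_of_le_of_lt ?_ hn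
    have hn0' : (0 : ℝ) < n := by exact_mod_cast hn0
    have h3 := supportFun_le_inner_metricProj hC y hn0'
    have h4 := inner_le_supportFun K (y + t • v) (metricProj_mem K ((n : ℝ) • y))
    rw [inner_add_left, real_inner_smul_left] at h4
    refine le_of_mul_le_mul_left ?_ ht0
    have h5 : t * (t⁻¹ • (supportFun K (y + t • v) - supportFun K y) + 2 * C ^ 2 / t / (n : ℝ)) =
        supportFun K (y + t • v) - supportFun K y + 2 * C ^ 2 / n := by
      rw [smul_eq_mul]
      field_simp
    rw [h5]
    linarith
  refine tendsto_order.2 ⟨fun c hc => ?_, fun c hc => upper v c hc⟩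
  have := upper (-v) (-c) (by rw [map_neg]; linarith)
  filter_upwards [this] with n hn
  rw [inner_neg_left] at hn
  linarith

theorem tendsto_plane {ι : Type*} {l : Filter ι} {f : ι → Plane} {a : Plane}
    (h : ∀ i, Tendsto (fun n => f n i) l (𝓝 (a i))) : Tendsto f l (𝓝 a) := by
  have := ((PiLp.continuous_toLp 2 (fun _ : Fin 2 => ℝ)).tendsto _).comp (tendsto_pi_nhds.2 h)
  exact this

theorem tendsto_metricProj_smul {K : ConvexBody Plane} {y : Plane}
    (hd : DifferentiableAt ℝ (supportFun K) y) :
    Tendsto (fun n : ℕ => metricProj K ((n : ℝ) • y)) atTop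
      (𝓝 (gradient (supportFun K) y)) := by
  refine tendsto_plane fun i => ?_
  have h := tendsto_inner_metricProj_smul hd (EuclideanSpace.single i 1)
  have h2 : fderiv ℝ (supportFun K) y (EuclideanSpace.single i 1) =
      gradient (supportFun K) y i := by
    have : fderiv ℝ (supportFun K) y (EuclideanSpace.single i 1) =
      inner ℝ (gradient (supportFun K) y) (EuclideanSpace.single i 1) := by
      simp [gradient]
    rw [this, real_inner_comm, EuclideanSpace.inner_single_left]
    simp
  rw [h2] at h
  simpa [EuclideanSpace.inner_single_left] using h

/-! ### Steiner formula for integrals -/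

/-- The Steiner formula describes the push-forward of Lebesgue measure on the parallel set under
`normalMap`. The quadratic coefficient may stay unspecified, as only its independence of `ε` is
needed. -/
theorem exists_integral_localParallelSet (K : ConvexBody Plane) {f : Plane → ℝ}
    (hf : Continuous f) :
    ∃ a : ℝ, ∀ ε, 0 < ε → ∫ x in localParallelSet K ε univ, f (normalDirVec K x) =
      a * ε ^ 2 + (2 * ∫ q, f (q.2 : Plane) ∂(supportMeasure K)) * ε := by
  obtain ⟨Λ₀, hΛ⟩ := exists_isSupportMeasures_supportMeasure K
  have hfin : IsFiniteMeasure Λ₀ := by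
    refine ⟨?_⟩
    have h := volume_localParallelSet_lt_top K 1 univ
    rw [hΛ 1 one_pos _ MeasurableSet.univ, ballVolume_two] at h
    by_contra htop
    rw [not_lt, top_le_iff] at htop
    rw [htop] at h
    have hpi := Real.pi_pos
    simp [hpi] at h
  have hmap : ∀ ε, 0 < ε → (volume.restrict (localParallelSet K ε univ)).map (normalMap K) =
      ENNReal.ofReal (ε ^ 2 * Real.pi) • Λ₀ + ENNReal.ofReal (ε * 2) • supportMeasure K := by
    intro ε hε
    ext η hη
    rw [Measure.map_apply (measurable_normalMap K) hη,
      Measure.restrict_apply (measurable_normalMap K hη), ← localParallelSet_eq_inter,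
      hΛ ε hε η hη, ballVolume_one, ballVolume_two]
    rfl
  have hfc : Continuous fun q : Plane × UnitCircle => f (q.2 : Plane) := by fun_prop
  have hint (ν : Measure (Plane × UnitCircle)) [IsFiniteMeasure ν] :
      Integrable (fun q : Plane × UnitCircle => f (q.2 : Plane)) ν := by
    obtain ⟨C, hC⟩ := (isCompact_sphere (0 : Plane) 1).exists_bound_of_continuousOn hf.continuousOn
    exact Integrable.of_bound hfc.aestronglyMeasurable C (.of_forall fun q => hC _ q.2.2)
  refine ⟨Real.pi * ∫ q, f (q.2 : Plane) ∂Λ₀, fun ε hε => ?_⟩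
  have hpi := Real.pi_pos
  have h1 : ∫ x in localParallelSet K ε univ, f (normalDirVec K x) =
      ∫ q, f (q.2 : Plane) ∂(volume.restrict (localParallelSet K ε univ)).map (normalMap K) := by
    rw [integral_map (measurable_normalMap K).aemeasurable hfc.aestronglyMeasurable]
    rfl
  rw [h1, hmap ε hε, integral_add_measure, integral_smul_measure, integral_smul_measure,
    ENNReal.toReal_ofReal (by positivity), ENNReal.toReal_ofReal (by positivity)]
  · simp only [smul_eq_mul]
    ring
  · exact (hint _).smul_measure ENNReal.ofReal_ne_top
  · exact (hint _).smul_measure ENNReal.ofReal_ne_top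

/-- Since `w` vanishes from `R` on, `w(d) = -∫ w'` over `[d, R]`. Fubini's theorem reduces the claim
to parallel sets, where the Steiner polynomial appears, and integration by parts returns from `w'`
to `w`. -/
theorem integral_comp_infDist_eq (K : ConvexBody Plane) {f : Plane → ℝ} (hf : Continuous f)
    {a : ℝ} (ha : ∀ ε, 0 < ε → ∫ x in localParallelSet K ε univ, f (normalDirVec K x) =
      a * ε ^ 2 + (2 * ∫ q, f (q.2 : Plane) ∂(supportMeasure K)) * ε)
    {w : ℝ → ℝ} (hw : ContDiff ℝ 1 w) {R : ℝ} (hR : 0 < R) (hwR : ∀ t, R ≤ t → w t = 0) :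
    ∫ x in (K : Set Plane)ᶜ, f (normalDirVec K x) * w (Metric.infDist x (K : Set Plane)) =
      a * (2 * ∫ t in (0 : ℝ)..R, t * w t) +
        (2 * ∫ q, f (q.2 : Plane) ∂(supportMeasure K)) * ∫ t in (0 : ℝ)..R, w t := by
  set M : ℝ → Set Plane := fun ε => localParallelSet K ε univ
  set d : Plane → ℝ := fun x => Metric.infDist x (K : Set Plane)
  have hdc : Continuous d := Metric.continuous_infDist_pt _
  have hMm (ε : ℝ) : MeasurableSet (M ε) := measurableSet_localParallelSet K ε MeasurableSet.univ
  have hmemM {x : Plane} {ε : ℝ} : x ∈ M ε ↔ x ∉ K ∧ d x ≤ ε := by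
    simp [M, mem_localParallelSet_iff, d]
  have hw' : Continuous (deriv w) := hw.continuous_deriv le_rfl
  have hwd : Differentiable ℝ w := hw.differentiable one_ne_zero
  set fn : Plane → ℝ := fun x => f (normalDirVec K x)
  have hfn : Measurable fn := hf.measurable.comp (measurable_normalDirVec K)
  obtain ⟨C, hC⟩ := (isCompact_sphere (0 : Plane) 1).exists_bound_of_continuousOn hf.continuousOn
  have hfnC (x : Plane) : ‖fn x‖ ≤ C := hC _ (by simp [norm_normalDirVec])
  obtain ⟨D, hD⟩ := (isCompact_Icc (a := (0 : ℝ)) (b := R)).exists_bound_of_continuousOn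
    hw'.continuousOn
  have h1 : ∫ x in (K : Set Plane)ᶜ, fn x * w (d x) = ∫ x in M R, fn x * w (d x) := by
    refine setIntegral_eq_of_subset_of_forall_sdiff_eq_zero (f := fun x => fn x * w (d x))
      K.isClosed.measurableSet.compl ?_ ?_
    · exact fun x hx => (hmemM.1 hx).1
    · intro x hx
      have : R ≤ d x := by
        by_contra! hlt
        exact hx.2 (hmemM.2 ⟨hx.1, hlt.le⟩)
      rw [hwR _ this, mul_zero]
  have h2 : ∀ x ∈ M R, fn x * w (d x) =
      ∫ t in Ioc 0 R, -((Ici (d x)).indicator (fun _ => fn x) t * deriv w t) := by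
    intro x hx
    have hx' := hmemM.1 hx
    have hpos : 0 < d x := infDist_pos_of_notMem hx'.1
    have e1 : ∫ t in Ioc 0 R, -((Ici (d x)).indicator (fun _ => fn x) t * deriv w t) =
        ∫ t in Ioc 0 R, (Ici (d x)).indicator (fun t => -(fn x * deriv w t)) t := by
      refine integral_congr_ae (.of_forall fun t => ?_)
      by_cases ht : t ∈ Ici (d x) <;> simp [ht]
    rw [e1, setIntegral_indicator measurableSet_Ici]
    have e2 : Ioc 0 R ∩ Ici (d x) = Icc (d x) R := by
      ext t
      simp only [mem_inter_iff, mem_Ioc, mem_Ici, mem_Icc]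
      constructor
      · rintro ⟨⟨-, h1⟩, h2⟩
        exact ⟨h2, h1⟩
      · rintro ⟨h1, h2⟩
        exact ⟨⟨hpos.trans_le h1, h2⟩, h1⟩
    rw [e2, integral_Icc_eq_integral_Ioc, ← intervalIntegral.integral_of_le hx'.2,
      intervalIntegral.integral_neg, intervalIntegral.integral_const_mul,
      intervalIntegral.integral_deriv_eq_sub (fun t _ => hwd t) (hw'.intervalIntegrable _ _),
      hwR R le_rfl]
    ring
  have hfinM : IsFiniteMeasure (volume.restrict (M R)) :=
    ⟨by rw [Measure.restrict_apply_univ]; exact volume_localParallelSet_lt_top K R univ⟩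
  have hjm : Measurable fun p : Plane × ℝ =>
      -((Ici (d p.1)).indicator (fun _ => fn p.1) p.2 * deriv w p.2) := by
    have : Measurable fun p : Plane × ℝ =>
        {p : Plane × ℝ | d p.1 ≤ p.2}.indicator (fun p => fn p.1) p := by
      refine Measurable.indicator (by fun_prop) ?_
      exact measurableSet_le (by fun_prop) (by fun_prop)
    exact (this.mul (hw'.measurable.comp measurable_snd)).neg
  have h3 : ∫ x in M R, fn x * w (d x) =
      ∫ t in Ioc 0 R, ∫ x in M R, -((Ici (d x)).indicator (fun _ => fn x) t * deriv w t) := by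
    rw [setIntegral_congr_fun (hMm R) h2, integral_integral_swap]
    refine Integrable.of_bound hjm.aestronglyMeasurable (C * D) ?_
    have hae : ∀ᵐ p ∂((volume.restrict (M R)).prod (volume.restrict (Ioc 0 R))), p.2 ∈ Ioc 0 R := by
      rw [Measure.prod_restrict]
      filter_upwards [ae_restrict_mem ((hMm R).prod measurableSet_Ioc)] with p hp using hp.2
    filter_upwards [hae] with p hp
    have hC0 : 0 ≤ C := (norm_nonneg _).trans (hfnC p.1)
    simp only [Function.uncurry, norm_neg, norm_mul]
    refine mul_le_mul ?_ (hD _ ⟨hp.1.le, hp.2⟩) (norm_nonneg _) hC0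
    exact (norm_indicator_le_norm_self _ _).trans (hfnC p.1)
  have h4 : ∀ t ∈ Ioc 0 R, ∫ x in M R, -((Ici (d x)).indicator (fun _ => fn x) t * deriv w t) =
      -((a * t ^ 2 + (2 * ∫ q, f (q.2 : Plane) ∂(supportMeasure K)) * t) * deriv w t) := by
    intro t ht
    rw [← ha t ht.1, integral_neg, integral_mul_const]
    congr 2
    have e1 : ∀ x, (Ici (d x)).indicator (fun _ => fn x) t = {x | d x ≤ t}.indicator fn x := by
      intro x
      by_cases hx : d x ≤ t <;> simp [hx]
    simp only [e1]
    rw [setIntegral_indicator (measurableSet_le hdc.measurable measurable_const)]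
    congr 2
    ext x
    simp only [mem_inter_iff, hmemM, mem_ofPred_eq]
    constructor
    · rintro ⟨⟨h, -⟩, h'⟩
      exact hmemM.2 ⟨h, h'⟩
    · intro h
      have := hmemM.1 h
      exact ⟨⟨this.1, this.2.trans ht.2⟩, this.2⟩
  change ∫ x in (K : Set Plane)ᶜ, fn x * w (d x) = _
  rw [h1, h3, setIntegral_congr_fun measurableSet_Ioc h4, ← intervalIntegral.integral_of_le hR.le,
    intervalIntegral.integral_neg]
  generalize (2 * ∫ q, f (q.2 : Plane) ∂(supportMeasure K)) = b
  have hP : ∀ t ∈ uIcc 0 R, HasDerivAt (fun t => a * t ^ 2 + b * t) (a * (2 * t) + b) t := by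
    intro t _
    have := ((hasDerivAt_pow 2 t).const_mul a).add ((hasDerivAt_id t).const_mul b)
    exact this.congr_deriv (by simp)
  rw [intervalIntegral.integral_mul_deriv_eq_deriv_mul hP (fun t _ => (hwd t).hasDerivAt)
    (Continuous.intervalIntegrable (by fun_prop) _ _) (hw'.intervalIntegrable _ _), hwR R le_rfl]
  have e5 : ∫ t in (0 : ℝ)..R, (a * (2 * t) + b) * w t =
      ∫ t in (0 : ℝ)..R, (a * 2 * (t * w t) + b * w t) := by
    congr 1
    ext t
    ring
  have hwc := hw.continuous
  rw [e5, intervalIntegral.integral_add (Continuous.intervalIntegrable (by fun_prop) _ _)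
    (Continuous.intervalIntegrable (by fun_prop) _ _), intervalIntegral.integral_const_mul,
    intervalIntegral.integral_const_mul]
  ring

/-! ### The support measure in terms of the support function -/

/-- `F` is a compactly supported `C¹` function on the plane which in polar coordinates is the
product of the radial function `w` and the angular function `P`. -/
structure IsRadialProduct (F P : Plane → ℝ) (w : ℝ → ℝ) (R : ℝ) : Prop where
  contDiff_fun : ContDiff ℝ 1 F
  contDiff_angular : ContDiff ℝ 2 P
  contDiff_radial : ContDiff ℝ 1 w
  pos : 0 < R
  radial_eq_zero : ∀ t, R ≤ t → w t = 0
  radial_zero : w 0 = 0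
  eq_mul : ∀ t, 0 ≤ t → ∀ u : Plane, ‖u‖ = 1 → F (t • u) = w t * P u

namespace IsRadialProduct

variable {F P : Plane → ℝ} {w : ℝ → ℝ} {R : ℝ}

theorem map_zero (h : IsRadialProduct F P w R) : F 0 = 0 := by
  obtain ⟨u, hu⟩ := exists_unitCircle
  have := h.eq_mul 0 le_rfl u hu
  rwa [zero_smul, h.radial_zero, zero_mul] at this

theorem eq_zero_of_le_norm (h : IsRadialProduct F P w R) {z : Plane} (hz : R ≤ ‖z‖) : F z = 0 := by
  have hpos : 0 < ‖z‖ := h.pos.trans_le hz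
  have := h.eq_mul ‖z‖ (norm_nonneg z) (‖z‖⁻¹ • z)
    (by rw [norm_smul, norm_inv, norm_norm, inv_mul_cancel₀ hpos.ne'])
  rwa [smul_smul, mul_inv_cancel₀ hpos.ne', one_smul, h.radial_eq_zero _ hz, zero_mul] at this

theorem hasCompactSupport (h : IsRadialProduct F P w R) : HasCompactSupport F :=
  HasCompactSupport.intro (isCompact_closedBall (0 : Plane) R) fun z hz =>
    h.eq_zero_of_le_norm (by simpa using (lt_of_not_ge (by simpa using hz)).le)

theorem integrable (h : IsRadialProduct F P w R) : Integrable F :=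
  h.contDiff_fun.continuous.integrable_of_hasCompactSupport h.hasCompactSupport

/-- The substitution `x = cy` turns the argument of `F` into `(x - p(x))/c`, whose polar coordinates
are the outer normal and the scaled distance. Against the Jacobian `c⁻²` the quadratic Steiner term
is scale invariant and the linear one keeps a factor `1/c`. -/
theorem integral_comp_sub_metricProj (h : IsRadialProduct F P w R) (K : ConvexBody Plane)
    {a : ℝ} (ha : ∀ ε, 0 < ε → ∫ x in localParallelSet K ε univ, P (normalDirVec K x) =
      a * ε ^ 2 + (2 * ∫ q, P (q.2 : Plane) ∂(supportMeasure K)) * ε) {c : ℝ} (hc : 0 < c) :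
    ∫ y, F (y - c⁻¹ • metricProj K (c • y)) = a * (2 * ∫ t in (0 : ℝ)..R, t * w t) +
      c⁻¹ * ((2 * ∫ q, P (q.2 : Plane) ∂(supportMeasure K)) * ∫ t in (0 : ℝ)..R, w t) := by
  have h1 : ∀ y, F (y - c⁻¹ • metricProj K (c • y)) =
      (fun x => F (c⁻¹ • (x - metricProj K x))) (c • y) := by
    intro y
    simp only [smul_sub, smul_smul, inv_mul_cancel₀ hc.ne', one_smul]
  rw [integral_congr_ae (.of_forall h1),
    Measure.integral_comp_smul volume (fun x => F (c⁻¹ • (x - metricProj K x))) c, finrank_euclideanSpace_fin]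
  have h2 : ∫ x, F (c⁻¹ • (x - metricProj K x)) =
      ∫ x in (K : Set Plane)ᶜ, P (normalDirVec K x) *
        (fun t => w (t / c)) (Metric.infDist x (K : Set Plane)) := by
    rw [← setIntegral_eq_integral_of_forall_compl_eq_zero (s := (K : Set Plane)ᶜ)]
    · refine setIntegral_congr_fun K.isClosed.measurableSet.compl fun x hx => ?_
      have hx : x ∉ K := hx
      have e := metricProj_add_infDist_smul hx
      have e2 : x - metricProj K x = Metric.infDist x (K : Set Plane) •
        ((normalMap K x).2 : Plane) := by
        exact (eq_sub_of_add_eq' e).symm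
      change F (c⁻¹ • (x - metricProj K x)) = _
      rw [e2, smul_smul, h.eq_mul _ (by have := (infDist_pos_of_notMem hx).le; positivity) _
        (norm_unitCircle _), mul_comm, inv_mul_eq_div]
      rfl
    · intro x hx
      have hx : x ∈ K := by simpa using hx
      rw [metricProj_of_mem hx, sub_self, smul_zero, h.map_zero]
  have hw1 : ContDiff ℝ 1 fun t => w (t / c) :=
    h.contDiff_radial.comp (contDiff_id.div_const c)
  rw [h2, integral_comp_infDist_eq K h.contDiff_angular.continuous ha hw1 (mul_pos hc h.pos)
    (fun t ht => h.radial_eq_zero _ ((le_div_iff₀' hc).2 ht))]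
  have e1 : ∫ t in (0 : ℝ)..(c * R), w (t / c) = c * ∫ t in (0 : ℝ)..R, w t := by
    rw [intervalIntegral.integral_comp_div (fun t => w t) hc.ne', zero_div,
      mul_div_cancel_left₀ _ hc.ne', smul_eq_mul]
  have e2 : ∫ t in (0 : ℝ)..(c * R), t * w (t / c) = c ^ 2 * ∫ t in (0 : ℝ)..R, t * w t := by
    have : ∀ t, t * w (t / c) = c * ((fun s => s * w s) (t / c)) := by
      intro t
      field_simp
    simp only [this]
    rw [intervalIntegral.integral_const_mul, intervalIntegral.integral_comp_div (fun t => t * w t) hc.ne',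
      zero_div, mul_div_cancel_left₀ _ hc.ne', smul_eq_mul]
    ring
  rw [e1, e2, abs_of_nonneg (by positivity), smul_eq_mul]
  field_simp

/-- Two evaluations of `n (∫ F(y - p(ny)/n) dy - ∫ F)`: exactly it is `n (α - ∫ F) + b`, and by
dominated convergence it tends to `-∫ DF(∇h)`. Boundedness forces `α = ∫ F`, and `b` remains. -/
theorem two_mul_integral_supportMeasure_mul (h : IsRadialProduct F P w R) (K : ConvexBody Plane) :
    (2 * ∫ q, P (q.2 : Plane) ∂(supportMeasure K)) * (∫ t in (0 : ℝ)..R, w t) =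
      -∫ y, fderiv ℝ F y (gradient (supportFun K) y) := by
  obtain ⟨a, ha⟩ := exists_integral_localParallelSet K h.contDiff_angular.continuous
  set b := (2 * ∫ q, P (q.2 : Plane) ∂(supportMeasure K)) * (∫ t in (0 : ℝ)..R, w t)
  set α := a * (2 * ∫ t in (0 : ℝ)..R, t * w t)
  obtain ⟨C, hC0, hC⟩ := exists_norm_le K
  obtain ⟨L, hL⟩ := h.contDiff_fun.lipschitzWith_of_hasCompactSupport h.hasCompactSupport one_ne_zero
  set g : ℕ → Plane → ℝ := fun n y =>
    (n : ℝ) * (F (y - (n : ℝ)⁻¹ • metricProj K ((n : ℝ) • y)) - F y) with hg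
  have hFc := h.contDiff_fun.continuous
  have hpc := continuous_metricProj K
  have hgc (n : ℕ) : Continuous (g n) := by fun_prop
  -- The displacement has length at most `C/n`, which the factor `n` turns into the bound `L C`.
  -- Outside radius `R + C` both values of `F` vanish.
  have hbound (n : ℕ) (y : Plane) : ‖g n y‖ ≤
      (Metric.closedBall (0 : Plane) (R + C)).indicator (fun _ => L * C) y := by
    rcases Nat.eq_zero_or_pos n with rfl | hn
    · simp only [hg, Nat.cast_zero, zero_mul, norm_zero]
      exact indicator_nonneg (fun _ _ => by positivity) _
    have hn' : (1 : ℝ) ≤ n := by exact_mod_cast hn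
    have hp : ‖metricProj K ((n : ℝ) • y)‖ ≤ C := hC _ (metricProj_mem K _)
    by_cases hy : y ∈ Metric.closedBall (0 : Plane) (R + C)
    · rw [indicator_of_mem hy]
      have h1 := hL.dist_le_mul (y - (n : ℝ)⁻¹ • metricProj K ((n : ℝ) • y)) y
      rw [dist_eq_norm, dist_eq_norm, sub_sub_cancel_left, norm_neg, norm_smul, norm_inv,
        Real.norm_natCast] at h1
      rw [hg, norm_mul, Real.norm_natCast]
      calc (n : ℝ) * ‖F (y - (n : ℝ)⁻¹ • metricProj K ((n : ℝ) • y)) - F y‖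
          ≤ n * (L * ((n : ℝ)⁻¹ * ‖metricProj K ((n : ℝ) • y)‖)) := by gcongr
        _ = L * ‖metricProj K ((n : ℝ) • y)‖ := by field_simp
        _ ≤ L * C := by gcongr
    · rw [indicator_of_notMem hy]
      have hy' : R + C < ‖y‖ := by simpa using hy
      have h2 : ‖(n : ℝ)⁻¹ • metricProj K ((n : ℝ) • y)‖ ≤ C := by
        rw [norm_smul, norm_inv, Real.norm_natCast]
        calc (n : ℝ)⁻¹ * ‖metricProj K ((n : ℝ) • y)‖ ≤ 1 * C := by
              gcongr
              exact inv_le_one_of_one_le₀ hn'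
          _ = C := one_mul C
      have h3 := norm_sub_norm_le y ((n : ℝ)⁻¹ • metricProj K ((n : ℝ) • y))
      simp only [hg]
      rw [h.eq_zero_of_le_norm (by linarith), h.eq_zero_of_le_norm (by linarith)]
      simp
  have hbi : Integrable ((Metric.closedBall (0 : Plane) (R + C)).indicator
      (fun _ => (L : ℝ) * C)) := by
    rw [integrable_indicator_iff measurableSet_closedBall]
    exact integrableOn_const measure_closedBall_lt_top.ne
  have hlim : Tendsto (fun n => ∫ y, g n y) atTop
      (𝓝 (∫ y, -(fderiv ℝ F y (gradient (supportFun K) y)))) := by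
    refine tendsto_integral_of_dominated_convergence _ (fun n => (hgc n).aestronglyMeasurable) hbi
      (fun n => .of_forall (hbound n)) ?_
    obtain ⟨C', hC'⟩ := exists_lipschitzWith_supportFun K
    filter_upwards [hC'.ae_differentiableAt] with y hy
    have h1 := ((h.contDiff_fun.differentiable one_ne_zero y).hasFDerivAt).hasFDerivWithinAt
      (s := univ)
    have h2 := h1.lim (l := atTop) (c := fun n : ℕ => (n : ℝ))
      (d := fun n : ℕ => -((n : ℝ)⁻¹ • metricProj K ((n : ℝ) • y)))
      (v := -gradient (supportFun K) y) ?_ ?_ ?_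
    · rw [_root_.map_neg] at h2
      refine h2.congr fun n => ?_
      simp only [hg, smul_eq_mul, sub_eq_add_neg]
    · simpa using (tendsto_inv_atTop_nhds_zero_nat (𝕜 := ℝ)).smul
        (tendsto_metricProj_smul hy) |>.neg
    · simp
    · refine (tendsto_metricProj_smul hy).neg.congr' ?_
      filter_upwards [eventually_gt_atTop 0] with n hn
      have : (n : ℝ) ≠ 0 := by exact_mod_cast hn.ne'
      rw [smul_neg, smul_smul, mul_inv_cancel₀ this, one_smul]
  have hval : ∀ n : ℕ, 0 < n → ∫ y, g n y = n * (α - ∫ y, F y) + b := by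
    intro n hn
    have hn' : (0 : ℝ) < n := by exact_mod_cast hn
    have hi : Integrable fun y => F (y - (n : ℝ)⁻¹ • metricProj K ((n : ℝ) • y)) := by
      have : Integrable (g n) := hbi.mono' (hgc n).aestronglyMeasurable (.of_forall (hbound n))
      refine ((this.const_mul (n : ℝ)⁻¹).add h.integrable).congr (.of_forall fun y => ?_)
      simp only [hg, Pi.add_apply]
      field_simp
      ring
    simp only [hg]
    rw [integral_const_mul, integral_sub hi h.integrable, h.integral_comp_sub_metricProj K ha hn']
    field_simp
    ring
  -- Dividing by `n` removes the convergent integral and `b` and leaves this constant.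
  have hc : α - ∫ y, F y = 0 := by
    have h1 : Tendsto (fun n : ℕ => (n : ℝ)⁻¹ * ((∫ y, g n y) - b)) atTop
        (𝓝 (0 * ((∫ y, -(fderiv ℝ F y (gradient (supportFun K) y))) - b))) :=
      tendsto_inv_atTop_nhds_zero_nat.mul (hlim.sub_const b)
    rw [zero_mul] at h1
    refine tendsto_nhds_unique (tendsto_const_nhds.congr' ?_) h1
    filter_upwards [eventually_gt_atTop 0] with n hn
    have : (n : ℝ) ≠ 0 := by exact_mod_cast hn.ne'
    rw [hval n hn]
    field_simp
    ring
  rw [← integral_neg]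
  refine tendsto_nhds_unique (tendsto_const_nhds.congr' ?_) hlim
  filter_upwards [eventually_gt_atTop 0] with n hn
  rw [hval n hn, hc, mul_zero, zero_add]

end IsRadialProduct

/-! ### Polar coordinates -/

/-- The identification of `ℝ × ℝ` with the Euclidean plane. -/
def planeOfProd (p : ℝ × ℝ) : Plane := !₂[p.1, p.2]

theorem measurePreserving_planeOfProd : MeasurePreserving planeOfProd volume volume := by
  have h1 := (volume_preserving_finTwoArrow ℝ).symm
  have h2 := (EuclideanSpace.volume_preserving_symm_measurableEquiv_toLp (Fin 2)).symm
  exact h2.comp h1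

theorem measurableEmbedding_planeOfProd : MeasurableEmbedding planeOfProd :=
  ((MeasurableEquiv.toLp 2 (Fin 2 → ℝ)).measurableEmbedding).comp
    (MeasurableEquiv.finTwoArrow (α := ℝ)).symm.measurableEmbedding

theorem planeOfProd_polarCoord_symm (p : ℝ × ℝ) :
    planeOfProd (polarCoord.symm p) = p.1 • unitVec p.2 := by
  rw [polarCoord_symm_apply]
  ext i
  fin_cases i <;> simp [planeOfProd, unitVec]

theorem integral_polar (G : Plane → ℝ) :
    ∫ p in Ioi (0 : ℝ) ×ˢ Ioo (-Real.pi) Real.pi, p.1 * G (p.1 • unitVec p.2) = ∫ y, G y := by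
  rw [← measurePreserving_planeOfProd.integral_comp measurableEmbedding_planeOfProd,
    ← integral_comp_polarCoord_symm, polarCoord_target]
  simp only [planeOfProd_polarCoord_symm, smul_eq_mul]

/-- The polar density `r` is positive on the coordinate domain, so null sets pull back to null sets.
-/
theorem ae_polar {p : Plane → Prop} (hp : ∀ᵐ y, p y) :
    ∀ᵐ q ∂volume.restrict (Ioi (0 : ℝ) ×ˢ Ioo (-Real.pi) Real.pi), p (q.1 • unitVec q.2) := by
  obtain ⟨N, hN, hNm, hN0⟩ := exists_measurable_superset_of_null hp
  have h1 : ∫⁻ q in Ioi (0 : ℝ) ×ˢ Ioo (-Real.pi) Real.pi,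
      ENNReal.ofReal q.1 * N.indicator 1 (q.1 • unitVec q.2) = 0 := by
    have h2 : ∫⁻ y, N.indicator (1 : Plane → ℝ≥0∞) y = 0 := by
      rw [lintegral_indicator_one hNm, hN0]
    rw [← measurePreserving_planeOfProd.lintegral_comp_emb measurableEmbedding_planeOfProd,
      ← lintegral_comp_polarCoord_symm, polarCoord_target] at h2
    simpa only [planeOfProd_polarCoord_symm, smul_eq_mul] using h2
  have hm : MeasurableSet (Ioi (0 : ℝ) ×ˢ Ioo (-Real.pi) Real.pi) :=
    measurableSet_Ioi.prod measurableSet_Ioo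
  have hu : Measurable fun q : ℝ × ℝ => q.1 • unitVec q.2 := by
    have : (fun q : ℝ × ℝ => q.1 • unitVec q.2) = fun q => planeOfProd (polarCoord.symm q) := by
      ext1 q
      rw [planeOfProd_polarCoord_symm]
    rw [this]
    refine measurableEmbedding_planeOfProd.measurable.comp ?_
    exact continuous_polarCoord_symm.measurable
  rw [lintegral_eq_zero_iff] at h1
  · filter_upwards [h1, ae_restrict_mem hm] with q hq hq2
    by_contra hcon
    have hqN : q.1 • unitVec q.2 ∈ N := hN hcon
    have hq1 : (0 : ℝ) < q.1 := hq2.1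
    simp only [hqN, indicator_of_mem, Pi.one_apply, mul_one, Pi.zero_apply,
      ENNReal.ofReal_eq_zero] at hq
    exact absurd hq (not_le.2 hq1)
  · exact (ENNReal.measurable_ofReal.comp measurable_fst).mul
      ((measurable_one.indicator hNm).comp hu)

theorem norm_unitVec (φ : ℝ) : ‖unitVec φ‖ = 1 := by
  have h : ‖unitVec φ‖ ^ 2 = 1 := by
    rw [norm_sq_plane]
    simp [unitVec]
  nlinarith [norm_nonneg (unitVec φ)]

theorem hasDerivAt_plane {f : ℝ → Plane} {f' : Plane} {t : ℝ}
    (h : ∀ i, HasDerivAt (fun s => f s i) (f' i) t) : HasDerivAt f f' t := by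
  rw [← hasDerivWithinAt_univ, hasDerivWithinAt_iff_hasFDerivWithinAt, hasFDerivWithinAt_euclidean]
  intro i
  exact ((h i).hasFDerivAt.congr_fderiv (by ext; simp)).hasFDerivWithinAt

theorem hasDerivAt_unitVec (φ : ℝ) : HasDerivAt unitVec (quarterTurn (unitVec φ)) φ := by
  refine hasDerivAt_plane fun i => ?_
  fin_cases i
  · simpa [unitVec, quarterTurn] using Real.hasDerivAt_cos φ
  · simpa [unitVec, quarterTurn] using Real.hasDerivAt_sin φ

theorem contDiff_unitVec {n : WithTop ℕ∞} : ContDiff ℝ n unitVec := by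
  rw [contDiff_euclidean]
  intro i
  fin_cases i
  · simpa [unitVec] using Real.contDiff_cos
  · simpa [unitVec] using Real.contDiff_sin

theorem continuous_unitVec : Continuous unitVec := (contDiff_unitVec (n := 0)).continuous

theorem unitVec_add_two_pi (φ : ℝ) : unitVec (φ + 2 * Real.pi) = unitVec φ := by
  simp [unitVec]

theorem lipschitzWith_unitVec : LipschitzWith 1 unitVec := by
  refine lipschitzWith_of_nnnorm_deriv_le (fun φ => (hasDerivAt_unitVec φ).differentiableAt) ?_
  intro φ
  rw [(hasDerivAt_unitVec φ).deriv, ← NNReal.coe_le_coe, coe_nnnorm, norm_quarterTurn, norm_unitVec]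
  rfl

theorem eq_inner_smul_add (v : Plane) (φ : ℝ) :
    v = inner ℝ v (unitVec φ) • unitVec φ +
      inner ℝ v (quarterTurn (unitVec φ)) • quarterTurn (unitVec φ) := by
  have h := Real.sin_sq_add_cos_sq φ
  ext i
  fin_cases i
  · simp [inner_plane, unitVec, quarterTurn]
    linear_combination (-v 0) * h
  · simp [inner_plane, unitVec, quarterTurn]
    linear_combination (-v 1) * h

/-! ### The angular representation -/

namespace IsRadialProduct

variable {F P : Plane → ℝ} {w : ℝ → ℝ} {R : ℝ}

theorem fderiv_apply_unitVec (h : IsRadialProduct F P w R) {t : ℝ} (ht : 0 < t) (φ : ℝ) :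
    fderiv ℝ F (t • unitVec φ) (unitVec φ) = deriv w t * P (unitVec φ) := by
  have h1 : HasDerivAt (fun s : ℝ => F (s • unitVec φ)) (fderiv ℝ F (t • unitVec φ) (unitVec φ)) t := by
    have hl : HasDerivAt (fun s : ℝ => s • unitVec φ) (unitVec φ) t := by
      simpa using (hasDerivAt_id t).smul_const (unitVec φ)
    exact ((h.contDiff_fun.differentiable one_ne_zero _).hasFDerivAt).comp_hasDerivAt t hl
  have h2 : HasDerivAt (fun s : ℝ => w s * P (unitVec φ)) (deriv w t * P (unitVec φ)) t :=
    ((h.contDiff_radial.differentiable one_ne_zero t).hasDerivAt).mul_const _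
  refine h1.unique (h2.congr_of_eventuallyEq ?_)
  filter_upwards [lt_mem_nhds ht] with s hs
  exact h.eq_mul s hs.le _ (norm_unitVec φ)

theorem fderiv_apply_quarterTurn (h : IsRadialProduct F P w R) {t : ℝ} (ht : 0 < t) (φ : ℝ) :
    t * fderiv ℝ F (t • unitVec φ) (quarterTurn (unitVec φ)) =
      w t * deriv (fun ψ => P (unitVec ψ)) φ := by
  have h1 : HasDerivAt (fun ψ : ℝ => F (t • unitVec ψ))
      (fderiv ℝ F (t • unitVec φ) (t • quarterTurn (unitVec φ))) φ :=
    ((h.contDiff_fun.differentiable one_ne_zero _).hasFDerivAt).comp_hasDerivAt φ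
      ((hasDerivAt_unitVec φ).const_smul t)
  have hP : DifferentiableAt ℝ (fun ψ => P (unitVec ψ)) φ :=
    (h.contDiff_angular.differentiable two_ne_zero _).comp φ
      (hasDerivAt_unitVec φ).differentiableAt
  have h2 : HasDerivAt (fun ψ : ℝ => w t * P (unitVec ψ))
      (w t * deriv (fun ψ => P (unitVec ψ)) φ) φ := hP.hasDerivAt.const_mul _
  have h3 : (fun ψ : ℝ => F (t • unitVec ψ)) = fun ψ : ℝ => w t * P (unitVec ψ) :=
    funext fun ψ => h.eq_mul t ht.le _ (norm_unitVec ψ)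
  rw [h3] at h1
  have := h1.unique h2
  rwa [map_smul, smul_eq_mul] at this

end IsRadialProduct

/-- Euler's relation for a positively homogeneous function of degree one. -/
theorem fderiv_supportFun_unitVec {K : ConvexBody Plane} {t : ℝ} (ht : 0 < t) {φ : ℝ}
    (hd : DifferentiableAt ℝ (supportFun K) (t • unitVec φ)) :
    fderiv ℝ (supportFun K) (t • unitVec φ) (unitVec φ) = supportFun K (unitVec φ) := by
  have h1 : HasDerivAt (fun s : ℝ => supportFun K (s • unitVec φ))
      (fderiv ℝ (supportFun K) (t • unitVec φ) (unitVec φ)) t := by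
    have hl : HasDerivAt (fun s : ℝ => s • unitVec φ) (unitVec φ) t := by
      simpa using (hasDerivAt_id t).smul_const (unitVec φ)
    exact hd.hasFDerivAt.comp_hasDerivAt t hl
  have h2 : HasDerivAt (fun s : ℝ => s * supportFun K (unitVec φ)) (supportFun K (unitVec φ)) t := by
    simpa using (hasDerivAt_id t).mul_const (supportFun K (unitVec φ))
  refine h1.unique (h2.congr_of_eventuallyEq ?_)
  filter_upwards [lt_mem_nhds ht] with s hs
  exact supportFun_smul K hs.le _

theorem hasDerivAt_supportFun_unitVec {K : ConvexBody Plane} {t : ℝ} (ht : 0 < t) {φ : ℝ}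
    (hd : DifferentiableAt ℝ (supportFun K) (t • unitVec φ)) :
    HasDerivAt (fun ψ => supportFun K (unitVec ψ))
      (fderiv ℝ (supportFun K) (t • unitVec φ) (quarterTurn (unitVec φ))) φ := by
  have h1 : HasDerivAt (fun ψ : ℝ => supportFun K (t • unitVec ψ))
      (fderiv ℝ (supportFun K) (t • unitVec φ) (t • quarterTurn (unitVec φ))) φ :=
    HasFDerivAt.comp_hasDerivAt (f := fun ψ : ℝ => t • unitVec ψ) φ hd.hasFDerivAt
      ((hasDerivAt_unitVec φ).const_smul t)
  have h2 := h1.const_mul t⁻¹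
  have e : (fun ψ => t⁻¹ * supportFun K (t • unitVec ψ)) = fun ψ => supportFun K (unitVec ψ) := by
    ext ψ
    rw [supportFun_smul K ht.le, ← mul_assoc, inv_mul_cancel₀ ht.ne', one_mul]
  rw [e, map_smul, smul_eq_mul, ← mul_assoc, inv_mul_cancel₀ ht.ne', one_mul] at h2
  exact h2

/-- The support function as a function of the angle. -/
def angularSupport (K : ConvexBody Plane) (φ : ℝ) : ℝ := supportFun K (unitVec φ)

theorem exists_lipschitzWith_angularSupport (K : ConvexBody Plane) :
    ∃ C, LipschitzWith C (angularSupport K) := by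
  obtain ⟨C, hC⟩ := exists_lipschitzWith_supportFun K
  exact ⟨_, hC.comp lipschitzWith_unitVec⟩

theorem continuous_angularSupport (K : ConvexBody Plane) : Continuous (angularSupport K) :=
  (exists_lipschitzWith_angularSupport K).choose_spec.continuous

theorem periodic_angularSupport (K : ConvexBody Plane) :
    Function.Periodic (angularSupport K) (2 * Real.pi) := fun φ => by
  rw [angularSupport, unitVec_add_two_pi]
  rfl

namespace IsRadialProduct

variable {F P : Plane → ℝ} {w : ℝ → ℝ} {R : ℝ}

theorem integral_Ioi_eq (h : IsRadialProduct F P w R) :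
    ∫ t in Ioi (0 : ℝ), w t = ∫ t in (0 : ℝ)..R, w t := by
  rw [intervalIntegral.integral_of_le h.pos.le]
  refine setIntegral_eq_of_subset_of_forall_sdiff_eq_zero measurableSet_Ioi
    (fun t ht => ht.1) fun t ht => h.radial_eq_zero t ?_
  by_contra! hlt
  exact ht.2 ⟨ht.1, hlt.le⟩

theorem deriv_eq_zero (h : IsRadialProduct F P w R) {t : ℝ} (ht : R < t) : deriv w t = 0 := by
  have : w =ᶠ[𝓝 t] fun _ => 0 := by
    filter_upwards [lt_mem_nhds ht] with s hs using h.radial_eq_zero s hs.le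
  rw [this.deriv_eq]
  simp

theorem integrableOn_Ioi (h : IsRadialProduct F P w R) {v : ℝ → ℝ} (hv : Continuous v)
    (hv0 : ∀ t, R < t → v t = 0) : IntegrableOn v (Ioi 0) := by
  have h1 : IntegrableOn v (Ioc 0 R) :=
    (hv.integrableOn_Icc (a := 0) (b := R)).mono_set Ioc_subset_Icc_self
  have h2 : IntegrableOn v (Ioi R) :=
    (integrableOn_zero (μ := volume)).congr_fun (fun t ht => (hv0 t ht).symm) measurableSet_Ioi
  rw [← Ioc_union_Ioi_eq_Ioi h.pos.le]
  exact h1.union h2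

theorem integral_mul_deriv_eq (h : IsRadialProduct F P w R) :
    ∫ t in Ioi (0 : ℝ), t * deriv w t = -∫ t in (0 : ℝ)..R, w t := by
  have hw' : Continuous (deriv w) := h.contDiff_radial.continuous_deriv le_rfl
  have h1 : ∫ t in Ioi (0 : ℝ), t * deriv w t = ∫ t in (0 : ℝ)..R, t * deriv w t := by
    rw [intervalIntegral.integral_of_le h.pos.le]
    refine setIntegral_eq_of_subset_of_forall_sdiff_eq_zero measurableSet_Ioi
      (fun t ht => ht.1) fun t ht => ?_
    rw [h.deriv_eq_zero, mul_zero]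
    by_contra! hlt
    exact ht.2 ⟨ht.1, hlt⟩
  rw [h1, intervalIntegral.integral_mul_deriv_eq_deriv_mul (fun t _ => hasDerivAt_id' t)
    (fun t _ => (h.contDiff_radial.differentiable one_ne_zero t).hasDerivAt)
    (by simp) (hw'.intervalIntegrable _ _), h.radial_eq_zero R le_rfl]
  simp

/-- In the frame `u`, `quarterTurn u` the gradient of the support function has components `H` and
`H'`, and `DF` has components `w' P` and `(w/t) P'`. With the Jacobian `t` the integrand splits into
products, and `∫ t w' = -∫ w` makes the radial factor common to both. -/
theorem integral_fderiv_gradient (h : IsRadialProduct F P w R) (K : ConvexBody Plane) :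
    ∫ y, fderiv ℝ F y (gradient (supportFun K) y) =
      (∫ t in (0 : ℝ)..R, w t) * (-(∫ φ in (-Real.pi)..Real.pi, P (unitVec φ) * angularSupport K φ) +
        ∫ φ in (-Real.pi)..Real.pi,
          deriv (fun ψ => P (unitVec ψ)) φ * deriv (angularSupport K) φ) := by
  have hπ : -Real.pi ≤ Real.pi := by linarith [Real.pi_pos]
  have hw := h.contDiff_radial.continuous
  have hw' : Continuous (deriv w) := h.contDiff_radial.continuous_deriv le_rfl
  have hPu : ContDiff ℝ 2 fun ψ => P (unitVec ψ) := h.contDiff_angular.comp contDiff_unitVec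
  have hPu' : Continuous (deriv fun ψ => P (unitVec ψ)) := hPu.continuous_deriv one_le_two
  have hH := continuous_angularSupport K
  obtain ⟨C, hC⟩ := exists_lipschitzWith_angularSupport K
  rw [← integral_polar]
  have h1 : ∀ᵐ q ∂volume.restrict (Ioi (0 : ℝ) ×ˢ Ioo (-Real.pi) Real.pi),
      q.1 * fderiv ℝ F (q.1 • unitVec q.2) (gradient (supportFun K) (q.1 • unitVec q.2)) =
      (q.1 * deriv w q.1) * (P (unitVec q.2) * angularSupport K q.2) +
        w q.1 * (deriv (fun ψ => P (unitVec ψ)) q.2 * deriv (angularSupport K) q.2) := by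
    obtain ⟨C', hC'⟩ := exists_lipschitzWith_supportFun K
    filter_upwards [ae_polar hC'.ae_differentiableAt,
      ae_restrict_mem (measurableSet_Ioi.prod measurableSet_Ioo)] with q hd hq
    have hq1 : (0 : ℝ) < q.1 := hq.1
    have hin : ∀ v, inner ℝ (gradient (supportFun K) (q.1 • unitVec q.2)) v =
        fderiv ℝ (supportFun K) (q.1 • unitVec q.2) v := fun v => by simp [gradient]
    rw [eq_inner_smul_add (gradient (supportFun K) (q.1 • unitVec q.2)) q.2, map_add, map_smul,
      map_smul, hin, hin, fderiv_supportFun_unitVec hq1 hd,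
      ← (hasDerivAt_supportFun_unitVec hq1 hd).deriv, h.fderiv_apply_unitVec hq1]
    have h2 := h.fderiv_apply_quarterTurn hq1 q.2
    simp only [smul_eq_mul]
    change q.1 * (angularSupport K q.2 * (deriv w q.1 * P (unitVec q.2)) +
      deriv (angularSupport K) q.2 * _) = _
    linear_combination deriv (angularSupport K) q.2 * h2
  rw [integral_congr_ae h1, Measure.volume_eq_prod]
  have hi1 : IntegrableOn (fun t => t * deriv w t) (Ioi 0) :=
    h.integrableOn_Ioi (by fun_prop) fun t ht => by rw [h.deriv_eq_zero ht, mul_zero]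
  have hi2 : IntegrableOn w (Ioi 0) := h.integrableOn_Ioi hw fun t ht => h.radial_eq_zero t ht.le
  have hi3 : IntegrableOn (fun φ => P (unitVec φ) * angularSupport K φ)
      (Ioo (-Real.pi) Real.pi) :=
    (Continuous.integrableOn_Icc (hPu.continuous.mul hH)).mono_set Ioo_subset_Icc_self
  have hi4 : IntegrableOn (fun φ => deriv (fun ψ => P (unitVec ψ)) φ * deriv (angularSupport K) φ)
      (Ioo (-Real.pi) Real.pi) := by
    refine Integrable.mul_bdd (c := C) ?_ ?_ ?_
    · exact hPu'.integrableOn_Icc.mono_set Ioo_subset_Icc_self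
    · exact (measurable_deriv _).aestronglyMeasurable
    · exact .of_forall fun φ => norm_deriv_le_of_lipschitz hC
  have hj1 : Integrable (fun q : ℝ × ℝ => (q.1 * deriv w q.1) *
      (P (unitVec q.2) * angularSupport K q.2))
      ((volume.prod volume).restrict (Ioi (0 : ℝ) ×ˢ Ioo (-Real.pi) Real.pi)) := by
    rw [← Measure.prod_restrict]
    exact hi1.mul_prod hi3
  have hj2 : Integrable (fun q : ℝ × ℝ => w q.1 *
      (deriv (fun ψ => P (unitVec ψ)) q.2 * deriv (angularSupport K) q.2))
      ((volume.prod volume).restrict (Ioi (0 : ℝ) ×ˢ Ioo (-Real.pi) Real.pi)) := by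
    rw [← Measure.prod_restrict]
    exact hi2.mul_prod hi4
  rw [integral_add hj1 hj2,
    setIntegral_prod_mul (fun t => t * deriv w t) (fun φ => P (unitVec φ) * angularSupport K φ),
    setIntegral_prod_mul w
      (fun φ => deriv (fun ψ => P (unitVec ψ)) φ * deriv (angularSupport K) φ),
    h.integral_mul_deriv_eq, h.integral_Ioi_eq, ← integral_Ioc_eq_integral_Ioo,
    ← integral_Ioc_eq_integral_Ioo, ← intervalIntegral.integral_of_le hπ,
    ← intervalIntegral.integral_of_le hπ]
  ring

/-- Cancel the radial integral and integrate `P' H'` by parts over a period. The function `H` is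
Lipschitz, hence absolutely continuous, so the body need not be smooth. -/
theorem two_mul_integral_supportMeasure (h : IsRadialProduct F P w R)
    (hw : ∫ t in (0 : ℝ)..R, w t ≠ 0) (K : ConvexBody Plane) :
    2 * ∫ q, P (q.2 : Plane) ∂(supportMeasure K) =
      ∫ φ in (0 : ℝ)..(2 * Real.pi), angularSupport K φ *
        (P (unitVec φ) + deriv (deriv fun ψ => P (unitVec ψ)) φ) := by
  have hPu : ContDiff ℝ 2 fun ψ => P (unitVec ψ) := h.contDiff_angular.comp contDiff_unitVec
  have hPu1 : ContDiff ℝ 1 (deriv fun ψ => P (unitVec ψ)) := by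
    refine ((contDiff_succ_iff_deriv (n := 1)).1 ?_).2.2
    rw [one_add_one_eq_two]
    exact hPu
  have hPu2 : Continuous (deriv (deriv fun ψ => P (unitVec ψ))) := hPu1.continuous_deriv le_rfl
  have hper : Function.Periodic (fun ψ => P (unitVec ψ)) (2 * Real.pi) := fun φ => by
    simp only [unitVec_add_two_pi]
  have hper1 : Function.Periodic (deriv fun ψ => P (unitVec ψ)) (2 * Real.pi) := fun φ => by
    rw [← deriv_comp_add_const]
    congr 1
    exact funext hper
  have hper2 : Function.Periodic (deriv (deriv fun ψ => P (unitVec ψ))) (2 * Real.pi) := fun φ => by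
    rw [← deriv_comp_add_const]
    congr 1
    exact funext hper1
  have hH := continuous_angularSupport K
  obtain ⟨C, hC⟩ := exists_lipschitzWith_angularSupport K
  have h1 := h.two_mul_integral_supportMeasure_mul K
  rw [h.integral_fderiv_gradient K, mul_comm, ← mul_neg] at h1
  have h2 := mul_left_cancel₀ hw h1
  have hac1 : AbsolutelyContinuousOnInterval (deriv fun ψ => P (unitVec ψ)) (-Real.pi) Real.pi :=
    hPu1.contDiffOn.absolutelyContinuousOnInterval
  have hac2 : AbsolutelyContinuousOnInterval (angularSupport K) (-Real.pi) Real.pi :=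
    (hC.lipschitzOnWith).absolutelyContinuousOnInterval
  have hp1 : deriv (fun ψ => P (unitVec ψ)) Real.pi = deriv (fun ψ => P (unitVec ψ)) (-Real.pi) := by
    rw [← hper1 (-Real.pi)]
    ring_nf
  have hp2 : angularSupport K Real.pi = angularSupport K (-Real.pi) := by
    rw [← periodic_angularSupport K (-Real.pi)]
    ring_nf
  rw [h2, hac1.integral_mul_deriv_eq_deriv_mul hac2, hp1, hp2]
  have hper3 : Function.Periodic (fun φ => angularSupport K φ *
      (P (unitVec φ) + deriv (deriv fun ψ => P (unitVec ψ)) φ)) (2 * Real.pi) := fun φ => by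
    simp only [periodic_angularSupport K φ, hper2 φ, unitVec_add_two_pi]
  have h3 := hper3.intervalIntegral_add_eq 0 (-Real.pi)
  rw [zero_add, show -Real.pi + 2 * Real.pi = Real.pi by ring] at h3
  rw [h3, sub_self, zero_sub, neg_add, neg_neg, neg_neg, ← intervalIntegral.integral_add]
  · congr 1
    ext φ
    ring
  · exact (hPu.continuous.mul hH).intervalIntegrable _ _
  · exact (hPu2.mul hH).intervalIntegrable _ _

end IsRadialProduct

/-! ### Surface tensors in terms of the support function -/

theorem tensorPower_apply (s : ℕ) (u : Plane) (m : Fin s → Plane) :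
    tensorPower s u m = ∏ i, inner ℝ u (m i) := by
  simp [tensorPower, List.prod_ofFn]

/-- The polynomial `z ↦ z^s(m)` is homogeneous of degree `s`; cut it off by a bump in `‖z‖²` around
one. The squared norm keeps the product smooth, and the radial part `t^s χ(t²)` is nonnegative and
positive at `t = 1`. -/
theorem exists_isRadialProduct (s : ℕ) (m : Fin s → Plane) :
    ∃ F w R, IsRadialProduct F (fun z => tensorPower s z m) w R ∧ ∫ t in (0 : ℝ)..R, w t ≠ 0 := by
  let χ : ContDiffBump (1 : ℝ) := ⟨1 / 4, 1 / 2, by norm_num, by norm_num⟩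
  have hχ : ∀ x : ℝ, 1 / 2 ≤ |x - 1| → χ x = 0 := fun x hx =>
    χ.zero_of_le_dist (by rwa [Real.dist_eq])
  have hP : ContDiff ℝ 2 fun z : Plane => tensorPower s z m := by
    simp only [tensorPower_apply]
    exact contDiff_prod fun i _ => contDiff_id.inner ℝ contDiff_const
  have hw : ContDiff ℝ 1 fun t : ℝ => t ^ s * χ (t ^ 2) :=
    (contDiff_id.pow s).mul (χ.contDiff.comp (contDiff_id.pow 2))
  refine ⟨fun z => χ (‖z‖ ^ 2) * tensorPower s z m, fun t => t ^ s * χ (t ^ 2), 2, ⟨?_, hP, hw,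
    two_pos, ?_, ?_, ?_⟩, ?_⟩
  · exact (χ.contDiff.comp (contDiff_norm_sq ℝ)).mul (hP.of_le one_le_two)
  · intro t ht
    rw [hχ, mul_zero]
    rw [abs_of_nonneg (by nlinarith)]
    nlinarith
  · rw [hχ, mul_zero]
    norm_num
  · intro t ht u hu
    simp only [norm_smul, hu, mul_one, Real.norm_of_nonneg ht, tensorPower_apply,
      real_inner_smul_left, Finset.prod_mul_distrib, Finset.prod_const, Finset.card_univ,
      Fintype.card_fin]
    ring
  · refine (intervalIntegral.integral_pos two_pos hw.continuous.continuousOn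
      (fun t ht => mul_nonneg (pow_nonneg ht.1.le _) χ.nonneg) ⟨1, by norm_num, ?_⟩).ne'
    rw [one_pow, one_pow, one_mul]
    exact χ.pos_of_mem_ball (Metric.mem_ball_self χ.rOut_pos)

theorem norm_tensorPower_le (s : ℕ) {u : Plane} (hu : ‖u‖ = 1) : ‖tensorPower s u‖ ≤ 1 := by
  refine ContinuousMultilinearMap.opNorm_le_bound zero_le_one fun m => ?_
  rw [tensorPower_apply, one_mul, norm_prod]
  refine Finset.prod_le_prod (fun _ _ => norm_nonneg _) fun i _ => ?_
  simpa [hu] using norm_inner_le_norm (𝕜 := ℝ) u (m i)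

theorem contDiff_tensorPower (s : ℕ) {n : WithTop ℕ∞} : ContDiff ℝ n (tensorPower s) := by
  have h1 : ContDiff ℝ n (ContinuousMultilinearMap.compContinuousLinearMapContinuousMultilinear ℝ
      (fun _ : Fin s => Plane) (fun _ : Fin s => ℝ) ℝ) :=
    ContinuousMultilinearMap.contDiff _
  have h2 : ContDiff ℝ n fun u : Plane => fun _ : Fin s => innerSL ℝ u :=
    contDiff_pi.2 fun _ => (innerSL ℝ).contDiff
  exact (h1.comp h2).clm_apply contDiff_const

theorem continuous_tensorPower (s : ℕ) : Continuous (tensorPower s) :=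
  (contDiff_tensorPower s (n := 0)).continuous

/-- The tensor `u(φ)^s` as a function of the angle. -/
def angularTensor (s : ℕ) (φ : ℝ) : Tensor s := tensorPower s (unitVec φ)

theorem contDiff_angularTensor (s : ℕ) {n : WithTop ℕ∞} : ContDiff ℝ n (angularTensor s) :=
  (contDiff_tensorPower s).comp contDiff_unitVec

theorem periodic_angularTensor (s : ℕ) : Function.Periodic (angularTensor s) (2 * Real.pi) :=
  fun φ => by rw [angularTensor, unitVec_add_two_pi]; rfl

theorem contDiff_deriv_angularTensor (s : ℕ) {n : ℕ∞} :
    ContDiff ℝ n (deriv (angularTensor s)) := by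
  have h := contDiff_angularTensor s (n := ((n + 1 : ℕ∞) : WithTop ℕ∞))
  push_cast at h
  exact (contDiff_succ_iff_deriv.1 h).2.2

theorem continuous_deriv_deriv_angularTensor (s : ℕ) :
    Continuous (deriv (deriv (angularTensor s))) :=
  (contDiff_deriv_angularTensor s (n := 1)).continuous_deriv le_rfl

/-- The tensor-valued kernel `u^s + (u^s)''` which represents the surface tensor. -/
def surfaceKernel (s : ℕ) (φ : ℝ) : Tensor s :=
  angularTensor s φ + deriv (deriv (angularTensor s)) φ

theorem continuous_surfaceKernel (s : ℕ) : Continuous (surfaceKernel s) :=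
  (contDiff_angularTensor s (n := 0)).continuous.add (continuous_deriv_deriv_angularTensor s)

theorem deriv_tensor_apply {s : ℕ} {T : ℝ → Tensor s} (hT : Differentiable ℝ T)
    (m : Fin s → Plane) (φ : ℝ) : deriv T φ m = deriv (fun ψ => T ψ m) φ := by
  have h := ((ContinuousMultilinearMap.apply ℝ (fun _ : Fin s => Plane) ℝ m).hasFDerivAt.comp_hasDerivAt φ
    (hT φ).hasDerivAt).deriv
  exact h.symm

theorem surfaceKernel_apply (s : ℕ) (φ : ℝ) (m : Fin s → Plane) :
    surfaceKernel s φ m = tensorPower s (unitVec φ) m +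
      deriv (deriv fun ψ => tensorPower s (unitVec ψ) m) φ := by
  have h1 : Differentiable ℝ (angularTensor s) :=
    (contDiff_angularTensor s (n := 1)).differentiable one_ne_zero
  have h2 : Differentiable ℝ (deriv (angularTensor s)) :=
    (contDiff_deriv_angularTensor s (n := 1)).differentiable one_ne_zero
  have h3 : (fun ψ => deriv (angularTensor s) ψ m) = deriv fun ψ => tensorPower s (unitVec ψ) m :=
    funext fun ψ => deriv_tensor_apply h1 m ψ
  rw [surfaceKernel, add_apply, deriv_tensor_apply h2 m φ, h3]
  rfl

theorem integrable_tensorPower_snd (s : ℕ) (ν : Measure (Plane × UnitCircle)) [IsFiniteMeasure ν] :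
    Integrable (fun q : Plane × UnitCircle => tensorPower s (q.2 : Plane)) ν :=
  Integrable.of_bound (((continuous_tensorPower s).comp (by fun_prop)).aestronglyMeasurable) 1
    (.of_forall fun q => norm_tensorPower_le s (norm_unitCircle q.2))

theorem two_smul_integral_tensorPower (s : ℕ) (K : ConvexBody Plane) :
    (2 : ℝ) • ∫ q, tensorPower s (q.2 : Plane) ∂(supportMeasure K) =
      ∫ φ in (0 : ℝ)..(2 * Real.pi), angularSupport K φ • surfaceKernel s φ := by
  ext m
  let A := ContinuousMultilinearMap.apply ℝ (fun _ : Fin s => Plane) ℝ m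
  have hH := continuous_angularSupport K
  have hk := continuous_surfaceKernel s
  have h1 : (∫ q, tensorPower s (q.2 : Plane) ∂(supportMeasure K)) m =
      ∫ q, tensorPower s (q.2 : Plane) m ∂(supportMeasure K) :=
    (A.integral_comp_comm (integrable_tensorPower_snd s _)).symm
  have h2 : (∫ φ in (0 : ℝ)..(2 * Real.pi), angularSupport K φ • surfaceKernel s φ) m =
      ∫ φ in (0 : ℝ)..(2 * Real.pi), angularSupport K φ * surfaceKernel s φ m :=
    (A.intervalIntegral_comp_comm ((hH.smul hk).intervalIntegrable _ _)).symm
  obtain ⟨F, w, R, h, hw⟩ := exists_isRadialProduct s m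
  rw [smul_apply, h1, h2, smul_eq_mul,
    h.two_mul_integral_supportMeasure hw K]
  simp only [surfaceKernel_apply]

theorem sphereArea_one : sphereArea 1 = 2 := by rw [sphereArea, ballVolume_one]; simp

theorem sphereArea_pos (s : ℕ) : 0 < sphereArea (1 + s) := by
  have h2 : 0 < Real.Gamma (1 + ((1 + s : ℕ) : ℝ) / 2) := Real.Gamma_pos_of_pos (by positivity)
  have := Real.pi_pos
  rw [sphereArea, ballVolume]
  positivity

/-- The normalizing constant `1 / (s! ω_{1+s})` of the surface tensors. -/
def surfaceConst (s : ℕ) : ℝ := 1 / ((s.factorial : ℝ) * sphereArea (1 + s))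

theorem surfaceTensor_eq_two_smul (s : ℕ) (K : ConvexBody Plane) :
    surfaceTensor s K = surfaceConst s •
      (2 : ℝ) • ∫ q, tensorPower s (q.2 : Plane) ∂(supportMeasure K) := by
  rw [surfaceTensor, smul_smul, sphereArea_one, surfaceConst]
  congr 1
  have := (sphereArea_pos s).ne'
  field_simp

theorem surfaceTensor_eq_integral (s : ℕ) (K : ConvexBody Plane) :
    surfaceTensor s K = surfaceConst s •
      ∫ φ in (0 : ℝ)..(2 * Real.pi), angularSupport K φ • surfaceKernel s φ := by
  rw [surfaceTensor_eq_two_smul, two_smul_integral_tensorPower]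

/-- Half the perimeter, as total mass of the support measure, is given by the mean width. -/
theorem two_mul_supportMeasure_univ (K : ConvexBody Plane) :
    2 * (supportMeasure K univ).toReal =
      ∫ φ in (0 : ℝ)..(2 * Real.pi), angularSupport K φ := by
  obtain ⟨F, w, R, h, hw⟩ := exists_isRadialProduct 0 (fun i => i.elim0)
  have := h.two_mul_integral_supportMeasure hw K
  simpa [tensorPower_apply, measureReal_def] using this

theorem norm_surfaceTensor_le (s : ℕ) (K : ConvexBody Plane) :
    ‖surfaceTensor s K‖ ≤ 2 * surfaceConst s * (supportMeasure K univ).toReal := by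
  have hc : 0 < surfaceConst s := by
    have := sphereArea_pos s
    unfold surfaceConst
    positivity
  have h : ‖∫ q, tensorPower s (q.2 : Plane) ∂(supportMeasure K)‖ ≤
      1 * (supportMeasure K).real univ :=
    norm_integral_le_of_norm_le_const (.of_forall fun q =>
      norm_tensorPower_le s (norm_unitCircle q.2))
  rw [one_mul] at h
  rw [surfaceTensor_eq_two_smul, norm_smul, norm_smul, Real.norm_of_nonneg hc.le, Real.norm_two]
  rw [measureReal_def] at h
  nlinarith

/-! ### Smooth convex bodies -/

theorem unitVec_ne_zero (φ : ℝ) : unitVec φ ≠ 0 := by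
  intro h
  have := norm_unitVec φ
  simp [h] at this

theorem IsC2Plus.contDiffAt {K : ConvexBody Plane} (hK : IsC2Plus K) (φ : ℝ) :
    ContDiffAt ℝ 2 (supportFun K) (unitVec φ) :=
  hK.1.contDiffAt (isOpen_compl_singleton.mem_nhds (unitVec_ne_zero φ))

theorem IsC2Plus.contDiff_angularSupport {K : ConvexBody Plane} (hK : IsC2Plus K) :
    ContDiff ℝ 2 (angularSupport K) :=
  contDiff_iff_contDiffAt.2 fun φ => (hK.contDiffAt φ).comp φ contDiff_unitVec.contDiffAt

theorem IsC2Plus.hasDerivAt_angularSupport {K : ConvexBody Plane} (hK : IsC2Plus K) (φ : ℝ) :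
    HasDerivAt (angularSupport K)
      (fderiv ℝ (supportFun K) (unitVec φ) (quarterTurn (unitVec φ))) φ := by
  have hd := (hK.contDiffAt φ).differentiableAt two_ne_zero
  rw [← one_smul ℝ (unitVec φ)] at hd
  have := hasDerivAt_supportFun_unitVec one_pos hd
  rw [one_smul] at this
  exact this

theorem hasDerivAt_quarterTurn_unitVec (φ : ℝ) :
    HasDerivAt (fun ψ => quarterTurn (unitVec ψ)) (-unitVec φ) φ := by
  refine hasDerivAt_plane fun i => ?_
  fin_cases i
  · have h : HasDerivAt (fun ψ => -Real.sin ψ) (-Real.cos φ) φ := (Real.hasDerivAt_sin φ).neg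
    simpa [unitVec, quarterTurn] using h
  · simpa [unitVec, quarterTurn] using Real.hasDerivAt_cos φ

/-- Differentiate `H' = Dh(u)(u⊥)` once more. Since `(u⊥)' = -u`, the product rule yields the second
differential minus `Dh(u)(u)`, which equals `h(u)` by Euler's relation. -/
theorem IsC2Plus.curvatureRadius_eq {K : ConvexBody Plane} (hK : IsC2Plus K) (φ : ℝ) :
    curvatureRadius K (unitVec φ) = angularSupport K φ + deriv (deriv (angularSupport K)) φ := by
  have h1 : deriv (angularSupport K) =
      fun ψ => fderiv ℝ (supportFun K) (unitVec ψ) (quarterTurn (unitVec ψ)) :=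
    funext fun ψ => (hK.hasDerivAt_angularSupport ψ).deriv
  have hd2 : DifferentiableAt ℝ (fderiv ℝ (supportFun K)) (unitVec φ) :=
    ((hK.contDiffAt φ).fderiv_right (m := 1) (by norm_num)).differentiableAt one_ne_zero
  have h2 : HasDerivAt (fun ψ => fderiv ℝ (supportFun K) (unitVec ψ))
      (fderiv ℝ (fderiv ℝ (supportFun K)) (unitVec φ) (quarterTurn (unitVec φ))) φ :=
    hd2.hasFDerivAt.comp_hasDerivAt φ (hasDerivAt_unitVec φ)
  have h3 := (h2.clm_apply (hasDerivAt_quarterTurn_unitVec φ)).deriv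
  have hd := (hK.contDiffAt φ).differentiableAt two_ne_zero
  rw [← one_smul ℝ (unitVec φ)] at hd
  have h4 := fderiv_supportFun_unitVec one_pos hd
  rw [one_smul] at h4
  rw [h1, h3, map_neg, h4, curvatureRadius, angularSupport]
  ring

theorem IsC2Plus.continuous_deriv_deriv {K : ConvexBody Plane} (hK : IsC2Plus K) :
    Continuous (deriv (deriv (angularSupport K))) := by
  have h := hK.contDiff_angularSupport
  rw [← one_add_one_eq_two] at h
  exact (contDiff_succ_iff_deriv.1 h).2.2.continuous_deriv le_rfl

theorem IsC2Plus.continuous_curvatureRadius {K : ConvexBody Plane} (hK : IsC2Plus K) :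
    Continuous fun φ => curvatureRadius K (unitVec φ) := by
  simp only [hK.curvatureRadius_eq]
  exact (continuous_angularSupport K).add hK.continuous_deriv_deriv

theorem periodic_deriv {E : Type*} [NormedAddCommGroup E] [NormedSpace ℝ E] {f : ℝ → E} {T : ℝ}
    (hf : Function.Periodic f T) : Function.Periodic (deriv f) T := fun φ => by
  rw [← deriv_comp_add_const]
  congr 1
  exact funext hf

/-- Two integrations by parts over a full period; the boundary terms cancel by periodicity. -/
theorem IsC2Plus.integral_curvatureRadius_smul {K : ConvexBody Plane} (hK : IsC2Plus K) (s : ℕ) :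
    ∫ φ in (0 : ℝ)..(2 * Real.pi), curvatureRadius K (unitVec φ) • tensorPower s (unitVec φ) =
      ∫ φ in (0 : ℝ)..(2 * Real.pi), angularSupport K φ • surfaceKernel s φ := by
  set H := angularSupport K
  set τ := angularTensor s
  have hH : ContDiff ℝ 2 H := hK.contDiff_angularSupport
  have hH1 : ContDiff ℝ 1 (deriv H) := by
    rw [← one_add_one_eq_two] at hH
    exact (contDiff_succ_iff_deriv.1 hH).2.2
  have hτ : ContDiff ℝ 1 τ := contDiff_angularTensor s
  have hτ1 : ContDiff ℝ 1 (deriv τ) := contDiff_deriv_angularTensor s (n := 1)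
  have hτ2 : Continuous (deriv (deriv τ)) := continuous_deriv_deriv_angularTensor s
  have hH2 : Continuous (deriv (deriv H)) := hK.continuous_deriv_deriv
  have e1 := intervalIntegral.integral_smul_deriv_eq_deriv_smul (a := 0) (b := 2 * Real.pi)
    (fun φ _ => ((hH.differentiable two_ne_zero) φ).hasDerivAt)
    (fun φ _ => ((hτ1.differentiable one_ne_zero) φ).hasDerivAt)
    (hH1.continuous.intervalIntegrable _ _) (hτ2.intervalIntegrable _ _)
  have e2 := intervalIntegral.integral_smul_deriv_eq_deriv_smul (a := 0) (b := 2 * Real.pi)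
    (fun φ _ => ((hH1.differentiable one_ne_zero) φ).hasDerivAt)
    (fun φ _ => ((hτ.differentiable one_ne_zero) φ).hasDerivAt)
    (hH2.intervalIntegrable _ _) (hτ1.continuous.intervalIntegrable _ _)
  have p1 : H (2 * Real.pi) = H 0 := by simpa using periodic_angularSupport K 0
  have p2 : deriv H (2 * Real.pi) = deriv H 0 := by
    simpa using periodic_deriv (periodic_angularSupport K) 0
  have p3 : τ (2 * Real.pi) = τ 0 := by simpa using periodic_angularTensor s 0
  have p4 : deriv τ (2 * Real.pi) = deriv τ 0 := by
    simpa using periodic_deriv (periodic_angularTensor s) 0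
  rw [p1, p4, sub_self, zero_sub] at e1
  rw [p2, p3, sub_self, zero_sub] at e2
  have l1 : ∀ φ, curvatureRadius K (unitVec φ) • tensorPower s (unitVec φ) =
      H φ • τ φ + deriv (deriv H) φ • τ φ := fun φ => by
    rw [hK.curvatureRadius_eq, add_smul]
    rfl
  have l2 : ∀ φ, H φ • surfaceKernel s φ = H φ • τ φ + H φ • deriv (deriv τ) φ :=
    fun φ => smul_add _ _ _
  simp only [l1, l2]
  rw [intervalIntegral.integral_add, intervalIntegral.integral_add, e1, e2, neg_neg]
  all_goals
    have := hH.continuous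
    have := hτ.continuous
    exact Continuous.intervalIntegrable (by fun_prop) _ _

theorem IsC2Plus.surfaceTensor_eq {K : ConvexBody Plane} (hK : IsC2Plus K) (s : ℕ) :
    surfaceTensor s K = surfaceConst s •
      ∫ φ in (0 : ℝ)..(2 * Real.pi),
        curvatureRadius K (unitVec φ) • tensorPower s (unitVec φ) := by
  rw [surfaceTensor_eq_integral, hK.integral_curvatureRadius_smul]

/-- Rank zero, evaluated at the empty tuple. Together with positivity this controls the `L¹` norm of
the radius of curvature. -/
theorem IsC2Plus.integral_curvatureRadius {K : ConvexBody Plane} (hK : IsC2Plus K) :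
    ∫ φ in (0 : ℝ)..(2 * Real.pi), curvatureRadius K (unitVec φ) =
      2 * (supportMeasure K univ).toReal := by
  have h := hK.integral_curvatureRadius_smul 0
  rw [← two_smul_integral_tensorPower] at h
  have h2 := congrArg (ContinuousMultilinearMap.apply ℝ (fun _ : Fin 0 => Plane) ℝ 0) h
  rw [← ContinuousLinearMap.intervalIntegral_comp_comm, map_smul,
    ← ContinuousLinearMap.integral_comp_comm _ (integrable_tensorPower_snd 0 _)] at h2
  · simpa [tensorPower_apply, measureReal_def] using h2
  · refine Continuous.intervalIntegrable ?_ _ _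
    exact hK.continuous_curvatureRadius.smul ((continuous_tensorPower 0).comp continuous_unitVec)

/-! ### Additivity of the surface tensors -/

/-- The difference between the value at `b` and the limit from the right detects exactly the right
endpoint of a compact interval. -/
theorem IsCompact.indicator_sub_eventually {J : Set ℝ} (hJ : IsCompact J) (hc : Convex ℝ J) (b : ℝ) :
    ∀ᶠ t in 𝓝[>] b, J.indicator (1 : ℝ → ℝ) b - J.indicator 1 t =
      {b' : ℝ | J.Nonempty ∧ sSup J = b'}.indicator 1 b := by
  by_cases hb : b ∈ J
  · have hne : J.Nonempty := ⟨b, hb⟩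
    have hle : b ≤ sSup J := le_csSup hJ.bddAbove hb
    rcases hle.eq_or_lt with h | h
    · filter_upwards [self_mem_nhdsWithin] with t (ht : b < t)
      have htJ : t ∉ J := fun htJ => absurd (le_csSup hJ.bddAbove htJ) (by rw [← h]; exact not_le.2 ht)
      simp [hb, htJ, hne, h.symm]
    · filter_upwards [Ioo_mem_nhdsGT h] with t ht
      have htJ : t ∈ J := hc.ordConnected.out hb (hJ.sSup_mem hne) ⟨ht.1.le, ht.2.le⟩
      simp [hb, htJ, hne, h.ne']
  · have : ∀ᶠ t in 𝓝[>] b, t ∉ J := nhdsWithin_le_nhds (hJ.isClosed.isOpen_compl.mem_nhds hb)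
    filter_upwards [this] with t ht
    have : ¬ (J.Nonempty ∧ sSup J = b) := fun h => hb (h.2 ▸ hJ.sSup_mem h.1)
    simp [hb, ht, this]

/-- Taking right jumps in the relation shows that, for each `b`, the coefficients of the intervals
with maximum `b` add up to zero; then weight by `g b`. The case `g = 1` is the Euler characteristic,
the case `g = id` the support function on the line. -/
theorem sum_sSup_eq_zero {ι : Type*} {s : Finset ι} {a : ι → ℝ} {J : ι → Set ℝ}
    (hJ : ∀ i ∈ s, IsCompact (J i)) (hc : ∀ i ∈ s, Convex ℝ (J i))
    (h : ∀ t, ∑ i ∈ s, a i * (J i).indicator (1 : ℝ → ℝ) t = 0) (g : ℝ → ℝ) :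
    ∑ i ∈ s, a i * {_b : ℝ | (J i).Nonempty}.indicator g (sSup (J i)) = 0 := by
  classical
  have key : ∀ b, ∑ i ∈ s, a i * {b' : ℝ | (J i).Nonempty ∧ sSup (J i) = b'}.indicator 1 b = 0 := by
    intro b
    have h1 : ∀ᶠ t in 𝓝[>] b, ∀ i ∈ s, (J i).indicator (1 : ℝ → ℝ) b - (J i).indicator 1 t =
        {b' : ℝ | (J i).Nonempty ∧ sSup (J i) = b'}.indicator 1 b :=
      (Filter.eventually_all_finset s).2 fun i hi => (hJ i hi).indicator_sub_eventually (hc i hi) b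
    obtain ⟨t, ht⟩ := h1.exists
    rw [Finset.sum_congr rfl fun i hi => by rw [← ht i hi, mul_sub], Finset.sum_sub_distrib, h, h,
      sub_zero]
  have h2 : ∀ i ∈ s, a i * {_b : ℝ | (J i).Nonempty}.indicator g (sSup (J i)) =
      ∑ b ∈ s.image fun i => sSup (J i),
        g b * (a i * {b' : ℝ | (J i).Nonempty ∧ sSup (J i) = b'}.indicator 1 b) := by
    intro i hi
    rw [Finset.sum_eq_single (sSup (J i))]
    · by_cases hne : (J i).Nonempty
      · simp [hne, mul_comm]
      · simp [hne]
    · intro b _ hb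
      have : ¬ ((J i).Nonempty ∧ sSup (J i) = b) := fun h => hb h.2.symm
      simp [this]
    · intro hn
      exact absurd (Finset.mem_image_of_mem (fun i => sSup (J i)) hi) hn
  rw [Finset.sum_congr rfl h2, Finset.sum_comm]
  refine Finset.sum_eq_zero fun b _ => ?_
  rw [← Finset.mul_sum, key, mul_zero]

/-- The support function of a set, equal to zero for the empty set. -/
def supportSet (A : Set Plane) (x : Plane) : ℝ := sSup ((fun y => inner ℝ x y) '' A)

/-- Slice by lines orthogonal to `x`. The Euler characteristic on each line converts the relation
into one between the indicators of the images under `⟨x, ·⟩`, and the one-dimensional support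
function of these intervals then gives the claim. -/
theorem sum_supportSet_eq_zero {ι : Type*} {s : Finset ι} {a : ι → ℝ} {A : ι → Set Plane}
    (hA : ∀ i ∈ s, IsCompact (A i)) (hc : ∀ i ∈ s, Convex ℝ (A i))
    (h : ∀ y, ∑ i ∈ s, a i * (A i).indicator (1 : Plane → ℝ) y = 0) (x : Plane) :
    ∑ i ∈ s, a i * supportSet (A i) x = 0 := by
  rcases eq_or_ne x 0 with rfl | hx
  · refine Finset.sum_eq_zero fun i _ => ?_
    have : supportSet (A i) 0 = 0 := by
      rcases (A i).eq_empty_or_nonempty with h | h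
      · simp [supportSet, h]
      · simp [supportSet, h]
    rw [this, mul_zero]
  have hJ : ∀ i ∈ s, IsCompact ((fun y => inner ℝ x y) '' A i) := fun i hi =>
    (hA i hi).image (by fun_prop)
  have hJc : ∀ i ∈ s, Convex ℝ ((fun y => inner ℝ x y) '' A i) := fun i hi =>
    (hc i hi).linear_image (innerSL ℝ x).toLinearMap
  have hJ0 : ∀ t, ∑ i ∈ s, a i * ((fun y => inner ℝ x y) '' A i).indicator (1 : ℝ → ℝ) t = 0 := by
    intro t
    have hq : quarterTurn x ≠ 0 := by
      rw [← norm_ne_zero_iff, norm_quarterTurn, norm_ne_zero_iff]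
      exact hx
    have hxx : x 0 ^ 2 + x 1 ^ 2 ≠ 0 := by
      rw [← norm_sq_plane]
      exact pow_ne_zero 2 (norm_ne_zero_iff.2 hx)
    -- Parametrizes the line `⟨x, ·⟩ = t`.
    set l : ℝ → Plane := fun r => (t / ‖x‖ ^ 2) • x + r • quarterTurn x with hl
    have hle : IsClosedEmbedding l :=
      (Homeomorph.addLeft ((t / ‖x‖ ^ 2) • x)).isClosedEmbedding.comp
        (isClosedEmbedding_smul_left hq)
    have hin : ∀ r, inner ℝ x (l r) = t := by
      intro r
      rw [inner_plane]
      simp [hl, quarterTurn, norm_sq_plane]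
      field_simp
      ring
    have hex : ∀ y, inner ℝ x y = t → ∃ r, l r = y := by
      intro y hy
      refine ⟨inner ℝ (quarterTurn x) y / ‖x‖ ^ 2, ?_⟩
      simp only [hl, ← hy]
      ext i
      fin_cases i
      · simp [quarterTurn, norm_sq_plane, inner_plane]
        field_simp
        ring
      · simp [quarterTurn, norm_sq_plane, inner_plane]
        field_simp
        ring
    have h1 := sum_sSup_eq_zero (s := s) (a := a) (J := fun i => l ⁻¹' A i)
      (fun i hi => hle.isCompact_preimage (hA i hi))
      (fun i hi => by
        intro r hr r' hr' p q hp hq hpq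
        have := hc i hi hr hr' hp hq hpq
        have e : p • l r + q • l r' = l (p • r + q • r') := by
          simp only [hl, smul_eq_mul]
          have : q = 1 - p := by linarith
          subst this
          module
        rw [mem_preimage, ← e]
        exact this)
      (fun r => h (l r)) 1
    rw [← h1]
    refine Finset.sum_congr rfl fun i _ => ?_
    congr 1
    by_cases hne : (l ⁻¹' A i).Nonempty
    · have : t ∈ (fun y => inner ℝ x y) '' A i := by
        obtain ⟨r, hr⟩ := hne
        exact ⟨l r, hr, hin r⟩
      simp only [indicator_of_mem this, hne, Pi.one_apply]
      simp
    · have : t ∉ (fun y => inner ℝ x y) '' A i := by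
        rintro ⟨y, hy, hyt⟩
        obtain ⟨r, rfl⟩ := hex y hyt
        exact hne ⟨r, hy⟩
      simp only [indicator_of_notMem this, hne]
      simp
  have h2 := sum_sSup_eq_zero hJ hJc hJ0 id
  rw [← h2]
  refine Finset.sum_congr rfl fun i _ => ?_
  congr 1
  by_cases hne : (A i).Nonempty
  · simp [supportSet, hne]
  · rw [not_nonempty_iff_eq_empty] at hne
    simp [supportSet, hne]

theorem surfaceTensorSet_coe (s : ℕ) (K : ConvexBody Plane) :
    surfaceTensorSet s (K : Set Plane) = surfaceTensor s K := by
  have h : ∃ L : ConvexBody Plane, (L : Set Plane) = K := ⟨K, rfl⟩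
  rw [surfaceTensorSet, dif_pos h]
  congr 1
  exact SetLike.coe_injective h.choose_spec

theorem surfaceTensorSet_empty (s : ℕ) : surfaceTensorSet s (∅ : Set Plane) = 0 := by
  rw [surfaceTensorSet, dif_neg]
  rintro ⟨K, hK⟩
  exact K.nonempty.ne_empty hK

theorem exists_convexBody_coe {A : Set Plane} (hA : IsCompact A) (hc : Convex ℝ A)
    (hne : A.Nonempty) : ∃ K : ConvexBody Plane, (K : Set Plane) = A :=
  ⟨⟨A, hc, hA, hne⟩, rfl⟩

theorem continuous_supportSet_unitVec {A : Set Plane} (hA : IsCompact A) (hc : Convex ℝ A) :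
    Continuous fun φ => supportSet A (unitVec φ) := by
  rcases A.eq_empty_or_nonempty with rfl | hne
  · simp only [supportSet, image_empty, Real.sSup_empty]
    exact continuous_const
  · obtain ⟨K, rfl⟩ := exists_convexBody_coe hA hc hne
    exact continuous_angularSupport K

theorem surfaceTensorSet_eq_integral (s : ℕ) {A : Set Plane} (hA : IsCompact A)
    (hc : Convex ℝ A) : surfaceTensorSet s A = surfaceConst s •
      ∫ φ in (0 : ℝ)..(2 * Real.pi), supportSet A (unitVec φ) • surfaceKernel s φ := by
  rcases A.eq_empty_or_nonempty with rfl | hne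
  · simp [supportSet, surfaceTensorSet_empty]
  · obtain ⟨K, rfl⟩ := exists_convexBody_coe hA hc hne
    rw [surfaceTensorSet_coe, surfaceTensor_eq_integral]
    rfl

/-- The tensor is a linear functional of the support function. Empty sets fit in because both
conventions give zero. -/
theorem sum_smul_surfaceTensorSet_eq_zero (s : ℕ) {ι : Type*} {t : Finset ι} {a : ι → ℝ}
    {A : ι → Set Plane} (hA : ∀ i ∈ t, IsCompact (A i)) (hc : ∀ i ∈ t, Convex ℝ (A i))
    (h : ∀ y, ∑ i ∈ t, a i * (A i).indicator (1 : Plane → ℝ) y = 0) :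
    ∑ i ∈ t, a i • surfaceTensorSet s (A i) = 0 := by
  have h1 : ∀ i ∈ t, a i • surfaceTensorSet s (A i) = surfaceConst s •
      ∫ φ in (0 : ℝ)..(2 * Real.pi), (a i * supportSet (A i) (unitVec φ)) • surfaceKernel s φ := by
    intro i hi
    rw [surfaceTensorSet_eq_integral s (hA i hi) (hc i hi), smul_comm,
      ← intervalIntegral.integral_smul]
    simp only [smul_smul]
  rw [Finset.sum_congr rfl h1, ← Finset.smul_sum, ← intervalIntegral.integral_finsetSum]
  · simp only [← Finset.sum_smul, sum_supportSet_eq_zero hA hc h]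
    simp
  · intro i hi
    exact (((continuous_supportSet_unitVec (hA i hi) (hc i hi)).const_mul _ |>.smul
      (continuous_surfaceKernel s))).intervalIntegrable _ _

theorem sum_smul_surfaceTensorSet_congr (s : ℕ) {ι κ : Type*} {t : Finset ι} {t' : Finset κ}
    {a : ι → ℝ} {a' : κ → ℝ} {A : ι → Set Plane} {A' : κ → Set Plane}
    (hA : ∀ i ∈ t, IsCompact (A i)) (hc : ∀ i ∈ t, Convex ℝ (A i))
    (hA' : ∀ i ∈ t', IsCompact (A' i)) (hc' : ∀ i ∈ t', Convex ℝ (A' i))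
    (h : ∀ y, ∑ i ∈ t, a i * (A i).indicator (1 : Plane → ℝ) y =
      ∑ i ∈ t', a' i * (A' i).indicator (1 : Plane → ℝ) y) :
    ∑ i ∈ t, a i • surfaceTensorSet s (A i) = ∑ i ∈ t', a' i • surfaceTensorSet s (A' i) := by
  have h1 := sum_smul_surfaceTensorSet_eq_zero s (t := t.disjSum t')
    (a := Sum.elim a fun i => -a' i) (A := Sum.elim A A') ?_ ?_ ?_
  · rw [Finset.sum_disjSum] at h1
    simp only [Sum.elim_inl, Sum.elim_inr] at h1
    rw [eq_neg_of_add_eq_zero_left h1, ← Finset.sum_neg_distrib]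
    exact Finset.sum_congr rfl fun i _ => by ext m; simp
  · simp only [Finset.mem_disjSum]
    rintro _ (⟨i, hi, rfl⟩ | ⟨i, hi, rfl⟩)
    exacts [hA i hi, hA' i hi]
  · simp only [Finset.mem_disjSum]
    rintro _ (⟨i, hi, rfl⟩ | ⟨i, hi, rfl⟩)
    exacts [hc i hi, hc' i hi]
  · intro y
    rw [Finset.sum_disjSum]
    simp [h y]

theorem isCompact_biInter {ι : Type*} {A : ι → Set Plane} (hA : ∀ i, IsCompact (A i))
    {I : Finset ι} (hI : I.Nonempty) : IsCompact (⋂ i ∈ I, A i) := by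
  obtain ⟨i, hi⟩ := hI
  exact (hA i).of_isClosed_subset (isClosed_biInter fun j _ => (hA j).isClosed)
    (biInter_subset_of_mem hi)

theorem indicator_biUnion_eq_sum {ι : Type*} (F : Finset ι) (A : ι → Set Plane) (y : Plane) :
    (⋃ i ∈ F, A i).indicator (1 : Plane → ℝ) y = ∑ I ∈ F.powerset with I.Nonempty,
      (-1 : ℝ) ^ (I.card + 1) * (⋂ i ∈ I, A i).indicator (1 : Plane → ℝ) y := by
  rw [Finset.indicator_biUnion_eq_sum_powerset]
  simp

/-- Both inclusion-exclusion sums belong to the indicator of the same union. Hence the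
representation chosen in the definition is irrelevant, and repeated or empty members are harmless.
-/
theorem surfaceTensorPoly_biUnion (s : ℕ) {ι : Type*} (F : Finset ι) {A : ι → Set Plane}
    (hA : ∀ i, IsCompact (A i)) (hc : ∀ i, Convex ℝ (A i)) :
    surfaceTensorPoly s (⋃ i ∈ F, A i) = ∑ I ∈ F.powerset with I.Nonempty,
      (-1 : ℝ) ^ (I.card + 1) • surfaceTensorSet s (⋂ i ∈ I, A i) := by
  classical
  have hex : ∃ G : Finset (ConvexBody Plane), (⋃ i ∈ F, A i) = ⋃ K ∈ G, (K : Set Plane) := by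
    -- Empty members must be discarded, since convex bodies are nonempty.
    refine ⟨(F.filter fun i => (A i).Nonempty).attach.image
      fun i : {i // i ∈ F.filter fun i => (A i).Nonempty} =>
        (⟨A i, hc i, hA i, (Finset.mem_filter.1 i.2).2⟩ : ConvexBody Plane), ?_⟩
    ext y
    simp only [mem_iUnion, Finset.mem_image, Finset.mem_attach, true_and, Subtype.exists,
      Finset.mem_filter, exists_prop]
    constructor
    · rintro ⟨i, hi, hy⟩
      exact ⟨_, ⟨i, ⟨hi, ⟨y, hy⟩⟩, rfl⟩, hy⟩
    · rintro ⟨_, ⟨i, ⟨hi, hne⟩, rfl⟩, hy⟩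
      exact ⟨i, hi, hy⟩
  rw [surfaceTensorPoly, dif_pos hex]
  have hspec := hex.choose_spec
  refine sum_smul_surfaceTensorSet_congr s
    (fun I hI => isCompact_biInter (fun K : ConvexBody Plane => K.isCompact) (Finset.mem_filter.1 hI).2)
    (fun I _ => convex_iInter₂ fun K _ => K.convex)
    (fun I hI => isCompact_biInter hA (Finset.mem_filter.1 hI).2)
    (fun I _ => convex_iInter₂ fun i _ => hc i) fun y => ?_
  rw [← indicator_biUnion_eq_sum F A y,
    ← indicator_biUnion_eq_sum _ (fun K : ConvexBody Plane => (K : Set Plane)) y, ← hspec]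

/-! ### Translations and intersections of convex bodies -/

theorem mem_translateBody {K : ConvexBody Plane} {x y : Plane} :
    y ∈ translateBody K x ↔ y - x ∈ K := by
  change y ∈ (fun y => x + y) '' (K : Set Plane) ↔ _
  constructor
  · rintro ⟨z, hz, rfl⟩
    simpa using hz
  · intro h
    exact ⟨y - x, h, by simp⟩

theorem coe_translateBody (K : ConvexBody Plane) (x : Plane) :
    (translateBody K x : Set Plane) = (fun y => y - x) ⁻¹' (K : Set Plane) := by
  ext y
  exact mem_translateBody

theorem mem_normalBundle_translateBody {K : ConvexBody Plane} {x : Plane} {q : Plane × UnitCircle} :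
    q ∈ normalBundle (translateBody K x) ↔ (q.1 - x, q.2) ∈ normalBundle K := by
  constructor
  · rintro ⟨h1, h2⟩
    refine ⟨mem_translateBody.1 h1, fun z hz => ?_⟩
    have := h2 (z + x) (mem_translateBody.2 (by simpa using hz))
    rwa [show z - (q.1 - x, q.2).1 = z + x - q.1 by simp; abel]
  · rintro ⟨h1, h2⟩
    refine ⟨mem_translateBody.2 h1, fun z hz => ?_⟩
    have := h2 (z - x) (mem_translateBody.1 hz)
    rwa [show z - x - (q.1 - x, q.2).1 = z - q.1 by simp] at this

theorem supportMeasure_translateBody (K : ConvexBody Plane) (x : Plane) :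
    supportMeasure (translateBody K x) =
      (supportMeasure K).map fun q => (x + q.1, q.2) := by
  have hm : Measurable fun q : Plane × UnitCircle => (x + q.1, q.2) := by fun_prop
  ext η hη
  rw [Measure.map_apply hm hη]
  refine supportMeasure_eq_of_volume_eq hη (hm hη) fun ε => ?_
  have : localParallelSet (translateBody K x) ε η = (fun z => -x + z) ⁻¹'
      localParallelSet K ε ((fun q : Plane × UnitCircle => (x + q.1, q.2)) ⁻¹' η) := by
    ext z
    simp only [mem_preimage, mem_localParallelSet_iff_exists]
    constructor
    · rintro ⟨q, ⟨h1, h2⟩, t, ht, rfl⟩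
      refine ⟨(q.1 - x, q.2), ⟨?_, mem_normalBundle_translateBody.1 h2⟩, t, ht, by simp; abel⟩
      simpa using h1
    · rintro ⟨q, ⟨h1, h2⟩, t, ht, h⟩
      refine ⟨(x + q.1, q.2), ⟨h1, mem_normalBundle_translateBody.2 (by simpa using h2)⟩, t, ht, ?_⟩
      simp only
      rw [add_assoc, h]
      simp
  rw [this, measure_preimage_add]

/-! ### Corners and the support measure of an intersection. -/

/-- The normal cone of a convex body at a point. -/
def normalCone (M : ConvexBody Plane) (y : Plane) : Set Plane :=
  {u | ∀ z ∈ M, inner ℝ u (z - y) ≤ 0}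

/-- A vector normal at both points is orthogonal to `y - y'`, and no nonempty open set consists of
such vectors. -/
theorem disjoint_interior_normalCone {M : ConvexBody Plane} {y y' : Plane} (hy : y ∈ M)
    (hy' : y' ∈ M) (hne : y ≠ y') :
    Disjoint (interior (normalCone M y)) (interior (normalCone M y')) := by
  rw [Set.disjoint_left]
  intro v h1 h2
  set e := y - y' with he
  have h3 : ∀ w ∈ normalCone M y ∩ normalCone M y', inner ℝ w e = 0 := by
    rintro w ⟨hw1, hw2⟩
    have a1 := hw1 y' hy'
    have a2 := hw2 y hy
    rw [← neg_sub y y', inner_neg_right] at a1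
    linarith
  have hc : Tendsto (fun t : ℝ => v + t • e) (𝓝[>] 0) (𝓝 v) := by
    have : Continuous fun t : ℝ => v + t • e := by fun_prop
    have h := this.tendsto 0
    simp only [zero_smul, add_zero] at h
    exact h.mono_left nhdsWithin_le_nhds
  have h4 : ∀ᶠ t in 𝓝[>] (0 : ℝ), v + t • e ∈ normalCone M y ∩ normalCone M y' :=
    hc (inter_mem (mem_interior_iff_mem_nhds.1 h1) (mem_interior_iff_mem_nhds.1 h2))
  obtain ⟨t, ht, ht0⟩ := (h4.and self_mem_nhdsWithin).exists
  have h5 := h3 _ ht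
  have h6 := h3 v ⟨interior_subset h1, interior_subset h2⟩
  rw [inner_add_left, h6, zero_add, real_inner_smul_left, real_inner_self_eq_norm_sq] at h5
  have ht0 : 0 < t := ht0
  have : 0 < ‖e‖ := norm_pos_iff.2 (sub_ne_zero.2 hne)
  exact absurd h5 (by positivity)

/-- Disjoint nonempty open subsets of the plane are countably many. As single points carry no
support measure, corners are negligible. -/
theorem countable_corners (M : ConvexBody Plane) :
    {y | y ∈ M ∧ (interior (normalCone M y)).Nonempty}.Countable := by
  refine Set.PairwiseDisjoint.countable_of_isOpen (s := fun y => interior (normalCone M y)) ?_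
    (fun _ _ => isOpen_interior) fun y hy => hy.2
  intro y hy y' hy' hne
  exact disjoint_interior_normalCone hy.1 hy'.1 hne

/-- Write `w = αu + βv` by Cramer's rule: the conditions `α, β > 0` are open, hold at `u + v` and
keep `w` in the cone. -/
theorem interior_normalCone_nonempty {M : ConvexBody Plane} {y u v : Plane}
    (hu : u ∈ normalCone M y) (hv : v ∈ normalCone M y) (hD : u 0 * v 1 - u 1 * v 0 ≠ 0) :
    (interior (normalCone M y)).Nonempty := by
  set D := u 0 * v 1 - u 1 * v 0 with hDdef
  refine ⟨u + v, mem_interior.2 ⟨{w | 0 < (w 0 * v 1 - w 1 * v 0) / D ∧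
    0 < (u 0 * w 1 - u 1 * w 0) / D}, ?_, ?_, ?_⟩⟩
  · rintro w ⟨h1, h2⟩ z hz
    have e : w = ((w 0 * v 1 - w 1 * v 0) / D) • u + ((u 0 * w 1 - u 1 * w 0) / D) • v := by
      ext i
      fin_cases i
      · simp
        field_simp
        rw [hDdef]
        ring
      · simp
        field_simp
        rw [hDdef]
        ring
    rw [e, inner_add_left, real_inner_smul_left, real_inner_smul_left]
    have := hu z hz
    have := hv z hz
    nlinarith
  · have c1 : Continuous fun w : Plane => (w 0 * v 1 - w 1 * v 0) / D := by fun_prop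
    have c2 : Continuous fun w : Plane => (u 0 * w 1 - u 1 * w 0) / D := by fun_prop
    exact (isOpen_lt continuous_const c1).inter (isOpen_lt continuous_const c2)
  · constructor
    · have : ((u + v) 0 * v 1 - (u + v) 1 * v 0) / D = 1 := by
        rw [div_eq_one_iff_eq hD]
        simp [hDdef]
        ring
      rw [this]
      exact one_pos
    · have : (u 0 * (u + v) 1 - u 1 * (u + v) 0) / D = 1 := by
        rw [div_eq_one_iff_eq hD]
        simp [hDdef]
        ring
      rw [this]
      exact one_pos

theorem eq_or_eq_neg_of_det_eq_zero {u v : Plane} (hu : ‖u‖ = 1) (hv : ‖v‖ = 1)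
    (hD : u 0 * v 1 - u 1 * v 0 = 0) : u = v ∨ u = -v := by
  have h1 := norm_sq_plane u
  have h2 := norm_sq_plane v
  rw [hu] at h1
  rw [hv] at h2
  have hc : (u 0 * v 0 + u 1 * v 1) ^ 2 = 1 := by
    linear_combination (-(u 0 * v 1 - u 1 * v 0)) * hD - (v 0 ^ 2 + v 1 ^ 2) * h1 - h2
  rcases sq_eq_one_iff.1 hc with h | h
  · left
    have : ‖u - v‖ ^ 2 = 0 := by
      rw [norm_sq_plane]
      simp
      linear_combination (-h1 - h2) - 2 * h
    exact sub_eq_zero.1 (norm_eq_zero.1 (pow_eq_zero_iff two_ne_zero |>.1 this))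
  · right
    have : ‖u + v‖ ^ 2 = 0 := by
      rw [norm_sq_plane]
      simp
      linear_combination (-h1 - h2) + 2 * h
    exact eq_neg_of_add_eq_zero_left (norm_eq_zero.1 (pow_eq_zero_iff two_ne_zero |>.1 this))

/-- Approach the boundary point from outside; the normal pairs accumulate by compactness of the
circle, and the normal bundle is closed. -/
theorem exists_mem_normalBundle {K : ConvexBody Plane} {y : Plane} (hy : y ∈ K)
    (hy' : y ∉ interior (K : Set Plane)) : ∃ u, (y, u) ∈ normalBundle K := by
  have h1 : y ∈ closure (K : Set Plane)ᶜ := by rwa [closure_compl]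
  obtain ⟨x, hx, hlim⟩ := mem_closure_iff_seq_limit.1 h1
  obtain ⟨u, -, φ, hφ, hu⟩ := isCompact_univ.tendsto_subseq
    (x := fun n => (normalMap K (x n)).2) fun n => mem_univ _
  refine ⟨u, ?_⟩
  have h2 : Tendsto (fun n => metricProj K (x (φ n))) atTop (𝓝 y) := by
    have := ((continuous_metricProj K).tendsto y).comp (hlim.comp hφ.tendsto_atTop)
    rwa [metricProj_of_mem hy] at this
  exact (isClosed_normalBundle K).mem_of_tendsto (h2.prodMk_nhds hu)
    (.of_forall fun n => normalMap_mem_normalBundle (hx (φ n)))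

theorem notMem_interior_of_mem_normalBundle {M : ConvexBody Plane} {q : Plane × UnitCircle}
    (hq : q ∈ normalBundle M) : q.1 ∉ interior (M : Set Plane) := by
  intro h
  have hc : Tendsto (fun t : ℝ => q.1 + t • (q.2 : Plane)) (𝓝[>] 0) (𝓝 q.1) := by
    have : Continuous fun t : ℝ => q.1 + t • (q.2 : Plane) := by fun_prop
    have h := this.tendsto 0
    simp only [zero_smul, add_zero] at h
    exact h.mono_left nhdsWithin_le_nhds
  have hev : ∀ᶠ t in 𝓝[>] (0 : ℝ), q.1 + t • (q.2 : Plane) ∈ (M : Set Plane) :=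
    hc (mem_interior_iff_mem_nhds.1 h)
  obtain ⟨t, ht, ht0⟩ := (hev.and self_mem_nhdsWithin).exists
  exact add_smul_notMem hq ht0 ht

/-- Normality is a local condition: a segment from an interior point of `L` towards a point of `K`
begins inside `K ∩ L`, and the inequality is homogeneous along it. -/
theorem inter_normalBundle_eq {K L M : ConvexBody Plane} (hM : (M : Set Plane) = (K : Set Plane) ∩ (L : Set Plane))
    {η : Set (Plane × UnitCircle)} (hη : η ⊆ interior (L : Set Plane) ×ˢ univ) :
    η ∩ normalBundle M = η ∩ normalBundle K := by
  have hmem : ∀ z, z ∈ M ↔ z ∈ K ∧ z ∈ L := fun z => by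
    rw [← SetLike.mem_coe, hM]
    rfl
  ext q
  refine and_congr_right fun hq => ?_
  have hqL := (hη hq).1
  constructor
  · rintro ⟨h1, h2⟩
    refine ⟨((hmem _).1 h1).1, fun z hz => ?_⟩
    have hc : Tendsto (fun t : ℝ => q.1 + t • (z - q.1)) (𝓝[>] 0) (𝓝 q.1) := by
      have : Continuous fun t : ℝ => q.1 + t • (z - q.1) := by fun_prop
      have h := this.tendsto 0
      simp only [zero_smul, add_zero] at h
      exact h.mono_left nhdsWithin_le_nhds
    have hev : ∀ᶠ t in 𝓝[>] (0 : ℝ), q.1 + t • (z - q.1) ∈ (L : Set Plane) :=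
      hc (mem_interior_iff_mem_nhds.1 hqL)
    obtain ⟨t, ⟨ht, ht0⟩, ht1⟩ := ((hev.and
      self_mem_nhdsWithin).and (nhdsWithin_le_nhds (gt_mem_nhds (one_pos (α := ℝ))))).exists
    have ht0 : 0 < t := ht0
    have ht1 : t < 1 := ht1
    have hzK : q.1 + t • (z - q.1) ∈ K := by
      have := K.convex ((hmem _).1 h1).1 hz (sub_nonneg.2 ht1.le) ht0.le (by ring)
      have e : q.1 + t • (z - q.1) = (1 - t) • q.1 + t • z := by module
      rw [e]
      exact this
    have h3 := h2 _ ((hmem _).2 ⟨hzK, ht⟩)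
    rw [add_sub_cancel_left, real_inner_smul_right] at h3
    exact nonpos_of_mul_nonpos_right h3 ht0
  · rintro ⟨h1, h2⟩
    exact ⟨(hmem _).2 ⟨h1, interior_subset hqL⟩, fun z hz => h2 z ((hmem z).1 hz).1⟩

/-- Bodies `K` and `L` which have no common supporting half-plane with boundary line containing
their intersection. -/
def MeetsProperly (K L : ConvexBody Plane) : Prop :=
  ∀ (v : Plane) (c : ℝ), v ≠ 0 → (∀ z ∈ K, inner ℝ v z ≤ c) → (∀ z ∈ L, inner ℝ v z ≤ c) →
    ∃ z, z ∈ K ∧ z ∈ L ∧ inner ℝ v z < c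

/-- Both `x + tv` and `x - tv` are differences of points of `K` and `L` for small `t > 0`. The
midpoint of the two points of `K` lies in both bodies and strictly below the supporting line. -/
theorem meetsProperly_translateBody {K L : ConvexBody Plane} {x : Plane}
    (hx : x ∈ interior ((K : Set Plane) - (L : Set Plane))) :
    MeetsProperly K (translateBody L x) := by
  intro v c hv hK hL
  have hn : 0 < ‖v‖ ^ 2 := pow_pos (norm_pos_iff.2 hv) 2
  have hev : ∀ e : Plane, ∀ᶠ t in 𝓝[>] (0 : ℝ), x + t • e ∈ (K : Set Plane) - (L : Set Plane) := by
    intro e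
    have hc : Tendsto (fun t : ℝ => x + t • e) (𝓝[>] 0) (𝓝 x) := by
      have : Continuous fun t : ℝ => x + t • e := by fun_prop
      have h := this.tendsto 0
      simp only [zero_smul, add_zero] at h
      exact h.mono_left nhdsWithin_le_nhds
    exact hc (mem_interior_iff_mem_nhds.1 hx)
  obtain ⟨t, ⟨h1, h2⟩, ht⟩ := (((hev v).and (hev (-v))).and self_mem_nhdsWithin).exists
  have ht : 0 < t := ht
  obtain ⟨k₁, hk₁, l₁, hl₁, e₁⟩ := h1
  obtain ⟨k₂, hk₂, l₂, hl₂, e₂⟩ := h2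
  have e₁ : k₁ - l₁ = x + t • v := e₁
  have e₂ : k₂ - l₂ = x + t • -v := e₂
  have hz : (1 / 2 : ℝ) • k₁ + (1 / 2 : ℝ) • k₂ - x = (1 / 2 : ℝ) • l₁ + (1 / 2 : ℝ) • l₂ := by
    have e₁' : k₁ = x + t • v + l₁ := sub_eq_iff_eq_add.1 e₁
    have e₂' : k₂ = x + t • -v + l₂ := sub_eq_iff_eq_add.1 e₂
    rw [e₁', e₂']
    module
  refine ⟨(1 / 2 : ℝ) • k₁ + (1 / 2 : ℝ) • k₂,
    K.convex hk₁ hk₂ (by norm_num) (by norm_num) (by norm_num), ?_, ?_⟩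
  · rw [mem_translateBody, hz]
    exact L.convex hl₁ hl₂ (by norm_num) (by norm_num) (by norm_num)
  · have a1 := hK k₁ hk₁
    have a2 := hL (l₂ + x) (mem_translateBody.2 (by simpa using hl₂))
    have a3 : k₂ = l₂ + x - t • v := by
      rw [sub_eq_iff_eq_add.1 e₂]
      module
    rw [inner_add_right, real_inner_smul_right, real_inner_smul_right, a3, inner_sub_right,
      real_inner_smul_right, real_inner_self_eq_norm_sq]
    have := mul_pos ht hn
    linarith

/-- By locality only points on both boundaries matter. Pairs that are normal to `K` or to `L` there
are null by hypothesis, and corners of `M` are null. At any other such point the normal of `M` is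
opposite to boundary normals of both bodies; these then coincide, and `M` lies in a common
supporting line, which `MeetsProperly` excludes. -/
theorem supportMeasure_inter {K L M : ConvexBody Plane} (hM : (M : Set Plane) = (K : Set Plane) ∩ (L : Set Plane))
    (hK : supportMeasure K (frontier (L : Set Plane) ×ˢ univ) = 0)
    (hL : supportMeasure L (frontier (K : Set Plane) ×ˢ univ) = 0) (hKL : MeetsProperly K L) :
    supportMeasure M = (supportMeasure K).restrict (interior (L : Set Plane) ×ˢ univ) +
      (supportMeasure L).restrict (interior (K : Set Plane) ×ˢ univ) := by
  have hmem : ∀ z, z ∈ M ↔ z ∈ K ∧ z ∈ L := fun z => by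
    rw [← SetLike.mem_coe, hM]
    rfl
  set D₁ : Set (Plane × UnitCircle) := interior (L : Set Plane) ×ˢ univ
  set D₂ : Set (Plane × UnitCircle) := interior (K : Set Plane) ×ˢ univ
  have hD₁ : MeasurableSet D₁ := isOpen_interior.measurableSet.prod MeasurableSet.univ
  have hD₂ : MeasurableSet D₂ := isOpen_interior.measurableSet.prod MeasurableSet.univ
  have hMc := supportMeasure_compl_normalBundle M
  have hcorner : supportMeasure M
      ({y | y ∈ M ∧ (interior (normalCone M y)).Nonempty} ×ˢ univ) = 0 := by
    have : ({y | y ∈ M ∧ (interior (normalCone M y)).Nonempty} ×ˢ univ :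
        Set (Plane × UnitCircle)) =
        ⋃ y ∈ {y | y ∈ M ∧ (interior (normalCone M y)).Nonempty}, {y} ×ˢ univ := by
      ext q
      simp
    rw [this]
    exact (measure_biUnion_null_iff (countable_corners M)).2 fun y _ =>
      supportMeasure_singleton_prod M y
  have hR : supportMeasure M (D₁ ∪ D₂)ᶜ = 0 := by
    have hRm : MeasurableSet (D₁ ∪ D₂)ᶜ := (hD₁.union hD₂).compl
    have z1 : supportMeasure M ((D₁ ∪ D₂)ᶜ ∩ normalBundle M ∩ normalBundle K) = 0 := by
      rw [supportMeasure_congr (M := K) ((hRm.inter (measurableSet_normalBundle M)).inter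
        (measurableSet_normalBundle K)) (by ext q; simp; tauto)]
      refine measure_mono_null ?_ hK
      rintro q ⟨⟨h1, h2⟩, h3⟩
      have hq := ((hmem _).1 h2.1).2
      refine ⟨?_, mem_univ _⟩
      rw [L.isClosed.frontier_eq]
      exact ⟨hq, fun h => h1 (Or.inl ⟨h, mem_univ _⟩)⟩
    have z2 : supportMeasure M ((D₁ ∪ D₂)ᶜ ∩ normalBundle M ∩ normalBundle L) = 0 := by
      rw [supportMeasure_congr (M := L) ((hRm.inter (measurableSet_normalBundle M)).inter
        (measurableSet_normalBundle L)) (by ext q; simp; tauto)]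
      refine measure_mono_null ?_ hL
      rintro q ⟨⟨h1, h2⟩, h3⟩
      have hq := ((hmem _).1 h2.1).1
      refine ⟨?_, mem_univ _⟩
      rw [K.isClosed.frontier_eq]
      exact ⟨hq, fun h => h1 (Or.inr ⟨h, mem_univ _⟩)⟩
    refine measure_mono_null ?_ (measure_union_null (measure_union_null z1 z2)
      (measure_union_null hcorner hMc))
    intro q hq
    by_cases hqM : q ∈ normalBundle M
    swap
    · exact Or.inr (Or.inr hqM)
    by_cases hqK : q ∈ normalBundle K
    · exact Or.inl (Or.inl ⟨⟨hq, hqM⟩, hqK⟩)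
    by_cases hqL : q ∈ normalBundle L
    · exact Or.inl (Or.inr ⟨⟨hq, hqM⟩, hqL⟩)
    refine Or.inr (Or.inl ⟨⟨hqM.1, ?_⟩, mem_univ _⟩)
    have hyK := ((hmem _).1 hqM.1).1
    have hyL := ((hmem _).1 hqM.1).2
    obtain ⟨v₁, hv₁⟩ := exists_mem_normalBundle hyK fun h => hq (Or.inr ⟨h, mem_univ _⟩)
    obtain ⟨v₂, hv₂⟩ := exists_mem_normalBundle hyL fun h => hq (Or.inl ⟨h, mem_univ _⟩)
    have hu : (q.2 : Plane) ∈ normalCone M q.1 := hqM.2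
    have hc₁ : (v₁ : Plane) ∈ normalCone M q.1 := fun z hz => hv₁.2 z ((hmem z).1 hz).1
    have hc₂ : (v₂ : Plane) ∈ normalCone M q.1 := fun z hz => hv₂.2 z ((hmem z).1 hz).2
    by_contra hcon
    have hd₁ : (q.2 : Plane) = -(v₁ : Plane) := by
      refine (eq_or_eq_neg_of_det_eq_zero (norm_unitCircle _) (norm_unitCircle v₁) ?_).resolve_left ?_
      · by_contra hD
        exact hcon (interior_normalCone_nonempty hu hc₁ hD)
      · intro h
        exact hqK (by rwa [show q = (q.1, v₁) from Prod.ext rfl (Subtype.ext h)])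
    have hd₂ : (q.2 : Plane) = -(v₂ : Plane) := by
      refine (eq_or_eq_neg_of_det_eq_zero (norm_unitCircle _) (norm_unitCircle v₂) ?_).resolve_left ?_
      · by_contra hD
        exact hcon (interior_normalCone_nonempty hu hc₂ hD)
      · intro h
        exact hqL (by rwa [show q = (q.1, v₂) from Prod.ext rfl (Subtype.ext h)])
    have hv : (v₁ : Plane) = v₂ := neg_injective (hd₁.symm.trans hd₂)
    obtain ⟨z, hzK, hzL, hz⟩ := hKL v₁ (inner ℝ (v₁ : Plane) q.1) (unitCircle_ne_zero v₁)
      (fun z hz => by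
        have := hv₁.2 z hz
        rw [inner_sub_right] at this
        linarith)
      (fun z hz => by
        have := hv₂.2 z hz
        rw [← hv, inner_sub_right] at this
        linarith)
    have := hqM.2 z ((hmem z).2 ⟨hzK, hzL⟩)
    rw [hd₁, inner_neg_left, inner_sub_right] at this
    linarith
  -- The two pieces overlap only over interior points of `M`, which have no normal pairs.
  have hI : supportMeasure M (D₁ ∩ D₂) = 0 := by
    refine measure_mono_null ?_ hMc
    rintro q ⟨h1, h2⟩ hq
    refine notMem_interior_of_mem_normalBundle hq ?_
    rw [hM, interior_inter]
    exact ⟨h2.1, h1.1⟩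
  ext η hη
  rw [Measure.add_apply, Measure.restrict_apply hη, Measure.restrict_apply hη,
    ← measure_inter_add_sdiff η hD₁]
  congr 1
  · exact supportMeasure_congr (hη.inter hD₁) (inter_normalBundle_eq hM inter_subset_right)
  · have h1 : supportMeasure M (η \ D₁) = supportMeasure M (η ∩ D₂) := by
      apply le_antisymm
      · have hs : η \ D₁ ⊆ (η ∩ D₂) ∪ (D₁ ∪ D₂)ᶜ := by
          rintro q ⟨h1, h2⟩
          by_cases h3 : q ∈ D₂
          · exact Or.inl ⟨h1, h3⟩
          · exact Or.inr fun h => h.elim h2 h3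
        refine (measure_mono hs).trans ((measure_union_le _ _).trans ?_)
        rw [hR, add_zero]
      · have hs : η ∩ D₂ ⊆ (η \ D₁) ∪ (D₁ ∩ D₂) := by
          rintro q ⟨h1, h2⟩
          by_cases h3 : q ∈ D₁
          · exact Or.inr ⟨h3, h2⟩
          · exact Or.inl ⟨h1, h3⟩
        refine (measure_mono hs).trans ((measure_union_le _ _).trans ?_)
        rw [hI, add_zero]
    rw [h1]
    exact supportMeasure_congr (hη.inter hD₂)
      (inter_normalBundle_eq (hM.trans (inter_comm _ _)) inter_subset_right)

/-! ### The translative integral formula -/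

theorem integrable_indicator_snd {Q E : Type*} [MeasurableSpace Q] [NormedAddCommGroup E]
    {ν : Measure Q} [SFinite ν] {S : Set (Plane × Q)} {c : ℝ≥0∞} {f : Q → E}
    (hS : MeasurableSet S) (hc : c ≠ ∞)
    (hSc : ∀ q, volume {x | (x, q) ∈ S} = c) (hf : Integrable f ν) :
    Integrable (S.indicator fun p => f p.2) ((volume : Measure Plane).prod ν) := by
  have hsec : ∀ q, MeasurableSet {x | (x, q) ∈ S} := fun q => measurable_prodMk_right hS
  have hind : ∀ q, (fun x : Plane => S.indicator (fun p => f p.2) (x, q)) =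
      {x | (x, q) ∈ S}.indicator fun _ => f q := fun q => by
    ext x
    by_cases h : (x, q) ∈ S <;> simp [h]
  refine (integrable_prod_iff' (hf.1.comp_snd.indicator hS)).2 ⟨.of_forall fun q => ?_, ?_⟩
  · rw [hind]
    exact (integrable_indicator_iff (hsec q)).2
      (integrableOn_const (by rw [hSc]; exact hc))
  · have : (fun q => ∫ x, ‖S.indicator (fun p => f p.2) (x, q)‖) = fun q => c.toReal * ‖f q‖ := by
      ext q
      have h1 : ∀ x, ‖S.indicator (fun p => f p.2) (x, q)‖ =
          {x | (x, q) ∈ S}.indicator (fun _ => ‖f q‖) x := fun x => by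
        by_cases h : (x, q) ∈ S <;> simp [h]
      simp_rw [h1]
      rw [integral_indicator (hsec q), setIntegral_const, Measure.real, hSc, smul_eq_mul]
    rw [this]
    exact hf.norm.const_mul _

/-- Fubini's theorem: each `q` is counted on a set of translations of the same measure `c`. -/
theorem integral_section {Q E : Type*} [MeasurableSpace Q] [NormedAddCommGroup E]
    [NormedSpace ℝ E] [CompleteSpace E] {ν : Measure Q} [SFinite ν] {S : Set (Plane × Q)}
    {c : ℝ≥0∞} {f : Q → E} (hS : MeasurableSet S) (hc : c ≠ ∞)
    (hSc : ∀ q, volume {x | (x, q) ∈ S} = c) (hf : Integrable f ν) :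
    Integrable (fun x : Plane => ∫ q in {q | (x, q) ∈ S}, f q ∂ν) ∧
      ∫ x : Plane, ∫ q in {q | (x, q) ∈ S}, f q ∂ν = c.toReal • ∫ q, f q ∂ν := by
  have hI := integrable_indicator_snd hS hc hSc hf
  have hsec : ∀ x, MeasurableSet {q | (x, q) ∈ S} := fun x => measurable_prodMk_left hS
  have hsec' : ∀ q, MeasurableSet {x | (x, q) ∈ S} := fun q => measurable_prodMk_right hS
  have h1 : ∀ x : Plane, ∫ q in {q | (x, q) ∈ S}, f q ∂ν =
      ∫ q, S.indicator (fun p => f p.2) (x, q) ∂ν := fun x => by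
    rw [← integral_indicator (hsec x)]
    rfl
  simp_rw [h1]
  refine ⟨hI.integral_prod_left, ?_⟩
  rw [integral_integral_swap (f := fun x q => S.indicator (fun p => f p.2) (x, q)) hI,
    ← integral_smul]
  congr 1
  ext q
  have h2 : ∀ x, S.indicator (fun p => f p.2) (x, q) =
      {x | (x, q) ∈ S}.indicator (fun _ => f q) x := fun x => rfl
  simp_rw [h2]
  rw [integral_indicator (hsec' q), setIntegral_const, Measure.real, hSc]

theorem ae_measure_section_eq_zero {Q : Type*} [MeasurableSpace Q]
    {ν : Measure Q} [SFinite ν] {S : Set (Plane × Q)}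
    (hS : MeasurableSet S) (h : ∀ q, volume {x | (x, q) ∈ S} = 0) :
    ∀ᵐ x : Plane, ν {q | (x, q) ∈ S} = 0 := by
  refine Measure.measure_ae_null_of_prod_null (μ := volume) (ν := ν) (s := S) ?_
  rw [Measure.prod_apply_symm hS]
  simp only [preimage]
  simp [h]

theorem volume_sub_mem (y : Plane) {B : Set Plane} (hB : MeasurableSet B) :
    volume {x | y - x ∈ B} = volume B :=
  (volume : Measure Plane).measurePreserving_sub_left y |>.measure_preimage hB.nullMeasurableSet

theorem volume_add_mem (y : Plane) (B : Set Plane) : volume {x | x + y ∈ B} = volume B :=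
  measure_preimage_add_right volume y B

theorem ConvexBody.volume_frontier (K : ConvexBody Plane) : volume (frontier (K : Set Plane)) = 0 :=
  K.convex.addHaar_frontier volume

theorem ConvexBody.volume_interior (K : ConvexBody Plane) :
    volume (interior (K : Set Plane)) = volume (K : Set Plane) := by
  refine le_antisymm (measure_mono interior_subset) ?_
  have h : (K : Set Plane) ⊆ interior (K : Set Plane) ∪ frontier (K : Set Plane) := by
    rw [← closure_eq_interior_union_frontier]
    exact subset_closure
  refine (measure_mono h).trans ((measure_union_le _ _).trans ?_)
  rw [K.volume_frontier, add_zero]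

theorem ConvexBody.volume_lt_top (K : ConvexBody Plane) : volume (K : Set Plane) < ∞ :=
  K.isCompact.measure_lt_top

theorem interior_translateBody (K : ConvexBody Plane) (x : Plane) :
    interior (translateBody K x : Set Plane) = (fun y => y - x) ⁻¹' interior (K : Set Plane) := by
  rw [coe_translateBody]
  exact ((Homeomorph.subRight x).preimage_interior _).symm

theorem frontier_translateBody (K : ConvexBody Plane) (x : Plane) :
    frontier (translateBody K x : Set Plane) = (fun y => y - x) ⁻¹' frontier (K : Set Plane) := by
  rw [coe_translateBody]
  exact ((Homeomorph.subRight x).preimage_frontier _).symm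

theorem inter_translateBody_nonempty {K L : ConvexBody Plane} {x : Plane} :
    ((K : Set Plane) ∩ translateBody L x).Nonempty ↔ x ∈ (K : Set Plane) - (L : Set Plane) := by
  constructor
  · rintro ⟨y, hK, hL⟩
    exact ⟨y, hK, y - x, mem_translateBody.1 hL, by simp⟩
  · rintro ⟨y, hK, z, hL, rfl⟩
    exact ⟨y, hK, mem_translateBody.2 (by simpa using hL)⟩

/-- Boundaries of convex sets are Lebesgue null; Fubini's theorem transfers this to the translations
for which the intersection formula could fail. -/
theorem ae_supportMeasure_inter_translateBody (K L : ConvexBody Plane) :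
    ∀ᵐ x : Plane, supportMeasure K (frontier (translateBody L x : Set Plane) ×ˢ univ) = 0 ∧
      supportMeasure (translateBody L x) (frontier (K : Set Plane) ×ˢ univ) = 0 ∧
      x ∉ frontier ((K : Set Plane) - (L : Set Plane)) := by
  have hfr : ∀ M : ConvexBody Plane, MeasurableSet (frontier (M : Set Plane)) := fun M =>
    isClosed_frontier.measurableSet
  have h1 : ∀ᵐ x : Plane, supportMeasure K
      {q | (x, q) ∈ {p : Plane × Plane × UnitCircle | p.2.1 - p.1 ∈ frontier (L : Set Plane)}} = 0 :=
    ae_measure_section_eq_zero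
      ((by fun_prop : Measurable fun p : Plane × Plane × UnitCircle => p.2.1 - p.1) (hfr L))
      fun q => (volume_sub_mem q.1 (hfr L)).trans L.volume_frontier
  have h2 : ∀ᵐ x : Plane, supportMeasure L
      {q | (x, q) ∈ {p : Plane × Plane × UnitCircle | p.1 + p.2.1 ∈ frontier (K : Set Plane)}} = 0 :=
    ae_measure_section_eq_zero
      ((by fun_prop : Measurable fun p : Plane × Plane × UnitCircle => p.1 + p.2.1) (hfr K))
      fun q => (volume_add_mem q.1 _).trans K.volume_frontier
  have h3 : ∀ᵐ x : Plane, x ∉ frontier ((K : Set Plane) - (L : Set Plane)) :=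
    measure_eq_zero_iff_ae_notMem.1 ((K.convex.sub L.convex).addHaar_frontier volume)
  filter_upwards [h1, h2, h3] with x hx1 hx2 hx3
  refine ⟨?_, ?_, hx3⟩
  · rw [← hx1, frontier_translateBody]
    congr 1
    ext q
    simp
  · rw [supportMeasure_translateBody, Measure.map_apply (by fun_prop)
      ((hfr K).prod MeasurableSet.univ), ← hx2]
    congr 1
    ext q
    simp

theorem ae_surfaceTensorSet_inter_translateBody (s : ℕ) (K L : ConvexBody Plane) :
    ∀ᵐ x : Plane, surfaceTensorSet s ((K : Set Plane) ∩ translateBody L x) =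
      surfaceConst s • (2 : ℝ) •
        ((∫ q in {q | q.1 - x ∈ interior (L : Set Plane)}, tensorPower s (q.2 : Plane)
            ∂supportMeasure K) +
          ∫ q in {q | x + q.1 ∈ interior (K : Set Plane)}, tensorPower s (q.2 : Plane)
            ∂supportMeasure L) := by
  have hL : ∀ x, {q : Plane × UnitCircle | q.1 - x ∈ interior (L : Set Plane)} =
      interior (translateBody L x : Set Plane) ×ˢ univ := fun x => by
    rw [interior_translateBody]
    ext q
    simp
  have hm : ∀ x : Plane, Measurable fun q : Plane × UnitCircle => (x + q.1, q.2) := fun x => by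
    fun_prop
  have hK : ∀ x, ∫ q in {q | x + q.1 ∈ interior (K : Set Plane)}, tensorPower s (q.2 : Plane)
      ∂supportMeasure L = ∫ q in interior (K : Set Plane) ×ˢ univ, tensorPower s (q.2 : Plane)
        ∂supportMeasure (translateBody L x) := fun x => by
    have hms : MeasurableSet (interior (K : Set Plane) ×ˢ (univ : Set UnitCircle)) :=
      isOpen_interior.measurableSet.prod .univ
    rw [supportMeasure_translateBody, setIntegral_map hms _ (hm x).aemeasurable]
    · congr 2
      ext q
      simp
    · exact (continuous_tensorPower s |>.comp
        (continuous_subtype_val.comp continuous_snd)).aestronglyMeasurable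
  filter_upwards [ae_supportMeasure_inter_translateBody K L] with x ⟨h1, h2, h3⟩
  rw [hL, hK]
  by_cases hx : x ∈ (K : Set Plane) - (L : Set Plane)
  · have hxi : x ∈ interior ((K : Set Plane) - (L : Set Plane)) := by
      by_contra hn
      exact h3 ⟨subset_closure hx, hn⟩
    obtain ⟨M, hM⟩ := exists_convexBody_coe (K.isCompact.inter (translateBody L x).isCompact)
      (K.convex.inter (translateBody L x).convex) (inter_translateBody_nonempty.2 hx)
    rw [← hM, surfaceTensorSet_coe, surfaceTensor_eq_two_smul,
      supportMeasure_inter hM h1 h2 (meetsProperly_translateBody hxi),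
      integral_add_measure (integrable_tensorPower_snd s _) (integrable_tensorPower_snd s _)]
  -- For disjoint bodies both terms vanish, because support measures live on the normal bundles.
  · have hne : (K : Set Plane) ∩ translateBody L x = ∅ :=
      not_nonempty_iff_eq_empty.1 fun h => hx (inter_translateBody_nonempty.1 h)
    have z1 : supportMeasure K (interior (translateBody L x : Set Plane) ×ˢ univ) = 0 := by
      refine measure_mono_null ?_ (supportMeasure_compl_normalBundle K)
      intro q hq hqK
      exact (hne ▸ (⟨hqK.1, interior_subset hq.1⟩ : q.1 ∈ (K : Set Plane) ∩ translateBody L x) :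
        q.1 ∈ (∅ : Set Plane))
    have z2 : supportMeasure (translateBody L x) (interior (K : Set Plane) ×ˢ univ) = 0 := by
      refine measure_mono_null ?_ (supportMeasure_compl_normalBundle _)
      intro q hq hqK
      exact (hne ▸ (⟨interior_subset hq.1, hqK.1⟩ : q.1 ∈ (K : Set Plane) ∩ translateBody L x) :
        q.1 ∈ (∅ : Set Plane))
    rw [hne, surfaceTensorSet_empty, Measure.restrict_zero_set z1, Measure.restrict_zero_set z2]
    simp

/-- The translative integral formula for surface tensors. -/
theorem integral_surfaceTensorSet_inter_translateBody (s : ℕ) {A : Set Plane} (hA : IsCompact A)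
    (hc : Convex ℝ A) (L : ConvexBody Plane) :
    Integrable (fun x => surfaceTensorSet s (A ∩ translateBody L x)) ∧
      ∫ x, surfaceTensorSet s (A ∩ translateBody L x) =
        volume.real (L : Set Plane) • surfaceTensorSet s A +
          volume.real A • surfaceTensor s L := by
  rcases A.eq_empty_or_nonempty with rfl | hne
  · simp only [empty_inter, surfaceTensorSet_empty]
    exact ⟨(integrable_zero Plane (Tensor s) volume).congr (.of_forall fun _ => rfl), by simp⟩
  obtain ⟨K, rfl⟩ := exists_convexBody_coe hA hc hne
  have hio : ∀ M : ConvexBody Plane, MeasurableSet (interior (M : Set Plane)) := fun M =>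
    isOpen_interior.measurableSet
  obtain ⟨i1, e1⟩ := integral_section (ν := supportMeasure K)
    (S := {p : Plane × Plane × UnitCircle | p.2.1 - p.1 ∈ interior (L : Set Plane)})
    ((by fun_prop : Measurable fun p : Plane × Plane × UnitCircle => p.2.1 - p.1) (hio L))
    L.volume_lt_top.ne (fun q => (volume_sub_mem q.1 (hio L)).trans L.volume_interior)
    (integrable_tensorPower_snd s (supportMeasure K))
  obtain ⟨i2, e2⟩ := integral_section (ν := supportMeasure L)
    (S := {p : Plane × Plane × UnitCircle | p.1 + p.2.1 ∈ interior (K : Set Plane)})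
    ((by fun_prop : Measurable fun p : Plane × Plane × UnitCircle => p.1 + p.2.1) (hio K))
    K.volume_lt_top.ne (fun q => (volume_add_mem q.1 _).trans K.volume_interior)
    (integrable_tensorPower_snd s (supportMeasure L))
  have hae := ae_surfaceTensorSet_inter_translateBody s K L
  refine ⟨((i1.add i2).smul (2 : ℝ)).smul (surfaceConst s) |>.congr (hae.mono fun x hx => hx.symm),
    ?_⟩
  rw [integral_congr_ae hae, integral_smul, integral_smul]
  refine (congrArg (fun T => surfaceConst s • (2 : ℝ) • T) ((integral_add i1 i2).trans
    (congrArg₂ (· + ·) e1 e2))).trans ?_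
  rw [surfaceTensorSet_coe, surfaceTensor_eq_two_smul s K, surfaceTensor_eq_two_smul s L]
  simp only [Measure.real]
  module

theorem lintegral_volume_inter_translateBody {A : Set Plane} (hA : MeasurableSet A)
    (L : ConvexBody Plane) :
    ∫⁻ x, volume (A ∩ translateBody L x) = volume A * volume (L : Set Plane) := by
  have hm : MeasurableSet {p : Plane × Plane | p.2 ∈ A ∧ p.2 - p.1 ∈ (L : Set Plane)} :=
    (measurable_snd hA).inter
      ((by fun_prop : Measurable fun p : Plane × Plane => p.2 - p.1) L.isClosed.measurableSet)
  have h := Measure.prod_apply (μ := (volume : Measure Plane)) (ν := (volume : Measure Plane)) hm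
  rw [Measure.prod_apply_symm hm] at h
  have e1 : ∀ x : Plane, Prod.mk x ⁻¹' {p : Plane × Plane | p.2 ∈ A ∧ p.2 - p.1 ∈ (L : Set Plane)} =
      A ∩ translateBody L x := fun x => by
    rw [coe_translateBody]
    rfl
  have e2 : ∀ y : Plane, volume ((fun x => (x, y)) ⁻¹'
      {p : Plane × Plane | p.2 ∈ A ∧ p.2 - p.1 ∈ (L : Set Plane)}) =
      A.indicator (fun _ => volume (L : Set Plane)) y := fun y => by
    by_cases hy : y ∈ A
    · simp only [preimage_ofPred_eq, hy, true_and, indicator_of_mem]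
      exact volume_sub_mem y L.isClosed.measurableSet
    · simp [hy]
  simp_rw [e1, e2] at h
  rw [← h, lintegral_indicator_const hA, mul_comm]

/-! ### Measurability on the space of convex bodies -/

/-- Needed for Borel measurability on finite powers of the space and for countable covers by
rectangles. -/
instance secondCountableTopology_convexBody : SecondCountableTopology (ConvexBody Plane) := by
  let f : ConvexBody Plane → TopologicalSpace.NonemptyCompacts Plane := fun K =>
    ⟨⟨K, K.isCompact⟩, K.nonempty⟩
  have hf : Isometry f := Isometry.of_dist_eq fun K L => rfl
  exact hf.isEmbedding.secondCountableTopology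

theorem ConvexBody.exists_dist_le (K L : ConvexBody Plane) {x : Plane} (hx : x ∈ K) :
    ∃ y ∈ L, dist x y ≤ dist K L := by
  obtain ⟨y, hy, h⟩ := L.isCompact.exists_infDist_eq_dist L.nonempty x
  refine ⟨y, hy, ?_⟩
  rw [← h]
  exact Metric.infDist_le_hausdorffDist_of_mem hx ConvexBody.hausdorffEDist_ne_top

theorem dist_translateBody_le (K L : ConvexBody Plane) (x y : Plane) :
    dist (translateBody K x) (translateBody L y) ≤ dist K L + dist x y := by
  have key : ∀ (K L : ConvexBody Plane) (x y : Plane), ∀ z ∈ translateBody K x,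
      ∃ w ∈ translateBody L y, dist z w ≤ dist K L + dist x y := by
    intro K L x y z hz
    obtain ⟨w, hw, h⟩ := K.exists_dist_le L (mem_translateBody.1 hz)
    refine ⟨w + y, mem_translateBody.2 (by simpa using hw), ?_⟩
    calc dist z (w + y) = dist ((z - x) + x) (w + y) := by simp
      _ ≤ dist (z - x) w + dist x y := dist_add_add_le _ _ _ _
      _ ≤ _ := by gcongr
  refine Metric.hausdorffDist_le_of_mem_dist (by positivity) (key K L x y) fun z hz => ?_
  rw [dist_comm K L, dist_comm x y]
  exact key L K y x z hz

theorem continuous_translateBody :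
    Continuous fun p : ConvexBody Plane × Plane => translateBody p.1 p.2 := by
  rw [continuous_iff_continuousAt]
  intro p
  rw [ContinuousAt, tendsto_iff_dist_tendsto_zero]
  have h : Tendsto (fun q : ConvexBody Plane × Plane => dist q.1 p.1 + dist q.2 p.2) (𝓝 p)
      (𝓝 0) := by
    have : Continuous fun q : ConvexBody Plane × Plane => dist q.1 p.1 + dist q.2 p.2 := by fun_prop
    simpa using this.tendsto p
  exact squeeze_zero (fun _ => dist_nonneg) (fun q => dist_translateBody_le _ _ _ _) h

theorem isClosed_mem_convexBody : IsClosed {p : ConvexBody Plane × Plane | p.2 ∈ p.1} := by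
  refine IsSeqClosed.isClosed fun u p hu hp => ?_
  choose z hz hd using fun n => (u n).1.exists_dist_le p.1 (hu n)
  have h1 : Tendsto (fun n => (u n).2) atTop (𝓝 p.2) := (continuous_snd.tendsto p).comp hp
  have h2 : Tendsto (fun n => dist (u n).1 p.1) atTop (𝓝 0) :=
    tendsto_iff_dist_tendsto_zero.1 ((continuous_fst.tendsto p).comp hp)
  have h3 : Tendsto (fun n => dist (u n).2 (z n)) atTop (𝓝 0) :=
    squeeze_zero (fun _ => dist_nonneg) hd h2
  have h4 : Tendsto z atTop (𝓝 p.2) := (tendsto_iff_of_dist h3).1 h1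
  exact p.1.isClosed.mem_of_tendsto h4 (.of_forall hz)

/-- The part of `A` in the intersection of a finite sequence of convex bodies. -/
def interBodies (A : Set Plane) {k : ℕ} (K : Fin k → ConvexBody Plane) : Set Plane :=
  A ∩ ⋂ i, (K i : Set Plane)

section InterBodies

variable {A : Set Plane} {k : ℕ}

theorem isCompact_interBodies (hA : IsCompact A) (K : Fin k → ConvexBody Plane) :
    IsCompact (interBodies A K) :=
  hA.inter_right (isClosed_iInter fun i => (K i).isClosed)

theorem convex_interBodies (hA : Convex ℝ A) (K : Fin k → ConvexBody Plane) :
    Convex ℝ (interBodies A K) :=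
  hA.inter (convex_iInter fun i => (K i).convex)

theorem isClosed_mem_iInter :
    IsClosed {p : (Fin k → ConvexBody Plane) × Plane | p.2 ∈ ⋂ i, (p.1 i : Set Plane)} := by
  have : {p : (Fin k → ConvexBody Plane) × Plane | p.2 ∈ ⋂ i, (p.1 i : Set Plane)} =
      ⋂ i, (fun p => (p.1 i, p.2)) ⁻¹' {p : ConvexBody Plane × Plane | p.2 ∈ p.1} := by
    ext p
    simp
  rw [this]
  exact isClosed_iInter fun i => isClosed_mem_convexBody.preimage (by fun_prop)

/-- The projection along the compact factor `A` is a closed map. -/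
theorem isClosed_exists_mem_interBodies (hA : IsCompact A) (t : ℝ) :
    IsClosed {p : (Fin k → ConvexBody Plane) × ℝ |
      ∃ y ∈ interBodies A p.1, t ≤ inner ℝ (unitVec p.2) y} := by
  have := isCompact_iff_compactSpace.1 hA
  have h : IsClosed {p : A × ((Fin k → ConvexBody Plane) × ℝ) |
      (p.1 : Plane) ∈ (⋂ i, (p.2.1 i : Set Plane)) ∧ t ≤ inner ℝ (unitVec p.2.2) (p.1 : Plane)} := by
    refine IsClosed.inter ?_ ?_
    · have hc : Continuous fun p : A × ((Fin k → ConvexBody Plane) × ℝ) =>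
        (p.2.1, (p.1 : Plane)) := by fun_prop
      exact isClosed_mem_iInter.preimage hc
    · have h1 : Continuous fun p : A × ((Fin k → ConvexBody Plane) × ℝ) => p.2.2 := by fun_prop
      have h2 : Continuous fun p : A × ((Fin k → ConvexBody Plane) × ℝ) => (p.1 : Plane) := by
        fun_prop
      exact isClosed_le continuous_const ((continuous_unitVec.comp h1).inner (𝕜 := ℝ) h2)
  convert isClosedMap_snd_of_compactSpace _ h using 1
  ext p
  constructor
  · rintro ⟨y, ⟨hyA, hy⟩, ht⟩
    exact ⟨(⟨y, hyA⟩, p), ⟨hy, ht⟩, rfl⟩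
  · rintro ⟨⟨y, p⟩, ⟨hy, ht⟩, rfl⟩
    exact ⟨y, ⟨y.2, hy⟩, ht⟩

theorem isClosed_interBodies_nonempty (hA : IsCompact A) :
    IsClosed {K : Fin k → ConvexBody Plane | (interBodies A K).Nonempty} := by
  have := isCompact_iff_compactSpace.1 hA
  have h : IsClosed {p : A × (Fin k → ConvexBody Plane) |
      (p.1 : Plane) ∈ (⋂ i, (p.2 i : Set Plane))} :=
    isClosed_mem_iInter.preimage (f := fun p : A × (Fin k → ConvexBody Plane) =>
        (p.2, (p.1 : Plane))) (by fun_prop)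
  convert isClosedMap_snd_of_compactSpace _ h using 1
  ext K
  constructor
  · rintro ⟨y, hyA, hy⟩
    exact ⟨(⟨y, hyA⟩, K), hy, rfl⟩
  · rintro ⟨⟨y, K⟩, hy, rfl⟩
    exact ⟨y, y.2, hy⟩

/-- The maximum over a compact set is attained, so upper level sets are closed, apart from the empty
intersections, where `sSup` has the value zero. -/
theorem measurable_supportSet_interBodies (hA : IsCompact A) :
    Measurable fun p : (Fin k → ConvexBody Plane) × ℝ =>
      supportSet (interBodies A p.1) (unitVec p.2) := by
  refine measurable_of_Ici fun t => ?_
  have hN : MeasurableSet {p : (Fin k → ConvexBody Plane) × ℝ | (interBodies A p.1).Nonempty} :=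
    measurable_fst (isClosed_interBodies_nonempty hA).measurableSet
  have : (fun p : (Fin k → ConvexBody Plane) × ℝ =>
      supportSet (interBodies A p.1) (unitVec p.2)) ⁻¹' Ici t =
      {p | ∃ y ∈ interBodies A p.1, t ≤ inner ℝ (unitVec p.2) y} ∪
        ({p | (interBodies A p.1).Nonempty}ᶜ ∩ {_p | t ≤ 0}) := by
    ext p
    have hc := isCompact_interBodies hA p.1
    by_cases hne : (interBodies A p.1).Nonempty
    · have him : IsCompact ((fun y => inner ℝ (unitVec p.2) y) '' interBodies A p.1) :=
        hc.image (by fun_prop)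
      simp only [mem_preimage, mem_Ici, supportSet, mem_union, mem_ofPred_eq, mem_inter_iff,
        mem_compl_iff, hne, not_true_eq_false, false_and, or_false]
      constructor
      · intro h
        obtain ⟨y, hy, e⟩ := him.sSup_mem (hne.image _)
        exact ⟨y, hy, h.trans e.ge⟩
      · rintro ⟨y, hy, h⟩
        exact h.trans (le_csSup him.bddAbove ⟨y, hy, rfl⟩)
    · rw [not_nonempty_iff_eq_empty] at hne
      simp [supportSet, hne]
  rw [this]
  exact (isClosed_exists_mem_interBodies hA t).measurableSet.union (hN.compl.inter (.const _))

theorem stronglyMeasurable_surfaceTensorSet_interBodies (s : ℕ) (hA : IsCompact A)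
    (hc : Convex ℝ A) :
    StronglyMeasurable fun K : Fin k → ConvexBody Plane => surfaceTensorSet s (interBodies A K) := by
  have h : ∀ K : Fin k → ConvexBody Plane, surfaceTensorSet s (interBodies A K) =
      surfaceConst s • ∫ φ in Ioc 0 (2 * Real.pi),
        supportSet (interBodies A K) (unitVec φ) • surfaceKernel s φ := fun K => by
    rw [surfaceTensorSet_eq_integral s (isCompact_interBodies hA K) (convex_interBodies hc K),
      intervalIntegral.integral_of_le Real.two_pi_pos.le]
  simp_rw [h]
  have hm : StronglyMeasurable (Function.uncurry fun (K : Fin k → ConvexBody Plane) φ =>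
      supportSet (interBodies A K) (unitVec φ) • surfaceKernel s φ) :=
    (measurable_supportSet_interBodies hA).stronglyMeasurable.smul
      ((continuous_surfaceKernel s).comp continuous_snd).stronglyMeasurable
  exact hm.integral_prod_right.const_smul (surfaceConst s)

theorem measurable_volume_interBodies (hA : IsCompact A) :
    Measurable fun K : Fin k → ConvexBody Plane => volume (interBodies A K) := by
  refine measurable_measure_prodMk_left (s := {p : (Fin k → ConvexBody Plane) × Plane |
    p.2 ∈ A ∧ p.2 ∈ ⋂ i, (p.1 i : Set Plane)}) ?_
  exact (measurable_snd hA.isClosed.measurableSet).inter isClosed_mem_iInter.measurableSet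

end InterBodies

theorem isClosed_inter_nonempty {A : Set Plane} (hA : IsCompact A) :
    IsClosed {K : ConvexBody Plane | (A ∩ (K : Set Plane)).Nonempty} := by
  have h := (isClosed_interBodies_nonempty (k := 1) hA).preimage
    (f := fun K : ConvexBody Plane => fun _ : Fin 1 => K) (by fun_prop)
  convert h using 1
  ext K
  simp only [interBodies, mem_preimage, mem_ofPred_eq, iInter_const]

/-! ### Measurability of surface tensor, perimeter and radius of curvature in the body. -/

theorem supportFun_le_add_dist (K L : ConvexBody Plane) (x : Plane) :
    supportFun K x ≤ supportFun L x + ‖x‖ * dist K L := by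
  refine supportFun_le fun z hz => ?_
  obtain ⟨y, hy, h⟩ := K.exists_dist_le L hz
  have h1 := inner_le_supportFun L x hy
  have h2 := real_inner_le_norm x (z - y)
  rw [inner_sub_right, ← dist_eq_norm] at h2
  have := mul_le_mul_of_nonneg_left h (norm_nonneg x)
  linarith

theorem continuous_angularSupport_uncurry : Continuous (Function.uncurry angularSupport) := by
  have hL : ∀ φ, LipschitzWith 1 fun K => angularSupport K φ := fun φ => by
    refine LipschitzWith.of_le_add fun K L => ?_
    have := supportFun_le_add_dist K L (unitVec φ)
    rwa [norm_unitVec, one_mul] at this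
  exact continuous_prod_of_continuous_lipschitzWith _ 1 continuous_angularSupport hL

theorem stronglyMeasurable_surfaceTensor (s : ℕ) : StronglyMeasurable (surfaceTensor s) := by
  have h : surfaceTensor s = fun K => surfaceConst s • ∫ φ in Ioc 0 (2 * Real.pi),
      angularSupport K φ • surfaceKernel s φ := funext fun K => by
    rw [surfaceTensor_eq_integral, intervalIntegral.integral_of_le Real.two_pi_pos.le]
  rw [h]
  have hm : StronglyMeasurable (Function.uncurry fun (K : ConvexBody Plane) φ =>
      angularSupport K φ • surfaceKernel s φ) :=
    (continuous_angularSupport_uncurry.smul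
      ((continuous_surfaceKernel s).comp continuous_snd)).stronglyMeasurable
  exact hm.integral_prod_right.const_smul (surfaceConst s)

theorem measurable_supportMeasure_univ :
    Measurable fun K : ConvexBody Plane => (supportMeasure K univ).toReal := by
  have h : (fun K : ConvexBody Plane => (supportMeasure K univ).toReal) = fun K =>
      (∫ φ in Ioc 0 (2 * Real.pi), angularSupport K φ) / 2 := funext fun K => by
    rw [← intervalIntegral.integral_of_le Real.two_pi_pos.le, ← two_mul_supportMeasure_univ]
    ring
  rw [h]
  exact (StronglyMeasurable.integral_prod_right (f := angularSupport)
    continuous_angularSupport_uncurry.stronglyMeasurable).measurable.div_const _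

theorem measurable_volume_convexBody :
    Measurable fun K : ConvexBody Plane => volume (K : Set Plane) :=
  measurable_measure_prodMk_left isClosed_mem_convexBody.measurableSet

/-- For almost every body `r = H + H''` is a pointwise limit of difference quotients of `H'`, and
`H'` is jointly measurable because `H` is jointly continuous. -/
theorem aestronglyMeasurable_curvatureRadius {Q : Measure (ConvexBody Plane)} [SFinite Q]
    (hQ : ∀ᵐ K ∂Q, IsC2Plus K) (μ : Measure ℝ) [SFinite μ] :
    AEStronglyMeasurable (fun p : ConvexBody Plane × ℝ => curvatureRadius p.1 (unitVec p.2))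
      (Q.prod μ) := by
  have hD : Measurable fun p : ConvexBody Plane × ℝ => deriv (angularSupport p.1) p.2 :=
    measurable_deriv_with_param continuous_angularSupport_uncurry
  have hpos : ∀ n : ℕ, (0 : ℝ) < 1 / ((n : ℝ) + 1) := fun n => Nat.one_div_pos_of_nat
  refine aestronglyMeasurable_of_tendsto_ae atTop
    (f := fun (n : ℕ) (p : ConvexBody Plane × ℝ) => angularSupport p.1 p.2 +
      (1 / ((n : ℝ) + 1))⁻¹ • (deriv (angularSupport p.1) (p.2 + 1 / ((n : ℝ) + 1)) -
        deriv (angularSupport p.1) p.2)) (fun n => ?_) ?_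
  · have h1 : Measurable fun p : ConvexBody Plane × ℝ =>
        deriv (angularSupport p.1) (p.2 + 1 / ((n : ℝ) + 1)) :=
      hD.comp (measurable_fst.prodMk (measurable_snd.add_const _))
    exact (continuous_angularSupport_uncurry.measurable.add
      ((h1.sub hD).const_smul (1 / ((n : ℝ) + 1))⁻¹)).aestronglyMeasurable
  · have h := Measure.quasiMeasurePreserving_fst (μ := Q) (ν := μ) |>.ae hQ
    filter_upwards [h] with p hp
    rw [hp.curvatureRadius_eq]
    refine tendsto_const_nhds.add ?_
    have hd : DifferentiableAt ℝ (deriv (angularSupport p.1)) p.2 := by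
      have h2 : ContDiff ℝ (1 + 1) (angularSupport p.1) := by
        rw [one_add_one_eq_two]
        exact hp.contDiff_angularSupport
      exact (contDiff_succ_iff_deriv.1 h2).2.2.differentiable one_ne_zero _
    have := hasDerivAt_iff_tendsto_slope_zero.1 hd.hasDerivAt
    exact this.comp (tendsto_nhdsWithin_iff.2 ⟨tendsto_one_div_add_atTop_nhds_zero_nat,
      .of_forall fun n => (hpos n).ne'⟩)

/-! ### Factorial moment measures of point processes with independent counts -/

section Factorial

variable {S : Type*} [MeasurableSpace S] {k : ℕ}

open Classical in
/-- The `k`-th factorial measure of a finite set: the counting measure of the sequences of `k`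
distinct points of `F`. -/
def factorialMeasure (k : ℕ) (F : Set S) : Measure (Fin k → S) :=
  if F.Finite then Measure.sum fun e : Fin k ↪ F => Measure.dirac fun i => (e i : S) else 0

theorem factorialMeasure_of_finite {F : Set S} [Fintype F] [DecidableEq F] :
    factorialMeasure k F = ∑ e : Fin k ↪ F, Measure.dirac fun i => (e i : S) := by
  rw [factorialMeasure, if_pos (toFinite F), Measure.sum_fintype]

instance isFiniteMeasure_factorialMeasure (F : Set S) : IsFiniteMeasure (factorialMeasure k F) := by
  classical
  by_cases hF : F.Finite
  · have := hF.fintype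
    rw [factorialMeasure_of_finite]
    infer_instance
  · rw [factorialMeasure, if_neg hF]
    infer_instance

theorem factorialMeasure_apply {F : Set S} (hF : F.Finite) {B : Set (Fin k → S)}
    (hB : MeasurableSet B) :
    factorialMeasure k F B = (Nat.card {e : Fin k ↪ F // (fun i => (e i : S)) ∈ B} : ℝ≥0∞) := by
  classical
  have := hF.fintype
  rw [factorialMeasure_of_finite, Measure.coe_finsetSum, Finset.sum_apply]
  simp_rw [Measure.dirac_apply' _ hB]
  rw [Nat.card_eq_fintype_card, Fintype.card_subtype, Finset.card_filter]
  push_cast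
  refine Finset.sum_congr rfl fun e _ => ?_
  by_cases h : (fun i => (e i : S)) ∈ B <;> simp [h]

/-- Points chosen from disjoint factors are automatically distinct, so the number of embeddings is a
product of counts. -/
theorem factorialMeasure_pi {F : Set S} (hF : F.Finite) {B : Fin k → Set S}
    (hB : ∀ i, MeasurableSet (B i)) (hd : Pairwise fun i j => Disjoint (B i) (B j)) :
    factorialMeasure k F (univ.pi B) = ∏ i, ((F ∩ B i).encard : ℝ≥0∞) := by
  rw [factorialMeasure_apply hF (.univ_pi hB)]
  let f : {e : Fin k ↪ F // (fun i => (e i : S)) ∈ univ.pi B} ≃ ((i : Fin k) → ↥(F ∩ B i)) :=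
    { toFun := fun e i => ⟨e.1 i, (e.1 i).2, e.2 i (mem_univ i)⟩
      invFun := fun x => ⟨⟨fun i => ⟨x i, (x i).2.1⟩, fun i j h => by
        by_contra hij
        have h' : (x i : S) = x j := congrArg Subtype.val h
        exact Set.disjoint_left.1 (hd hij) (x i).2.2 (h' ▸ (x j).2.2)⟩, fun i _ => (x i).2.2⟩
      left_inv := fun e => rfl
      right_inv := fun x => rfl }
  rw [Nat.card_congr f, Nat.card_pi]
  push_cast
  refine Finset.prod_congr rfl fun i _ => ?_
  rw [← (hF.subset inter_subset_left).cast_ncard_eq]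
  rfl

theorem factorialMeasure_not_injective {F : Set S}
    (hm : MeasurableSet {x : Fin k → S | ¬ Function.Injective x}) :
    factorialMeasure k F {x | ¬ Function.Injective x} = 0 := by
  by_cases hF : F.Finite
  · rw [factorialMeasure_apply hF hm]
    have : IsEmpty {e : Fin k ↪ F // (fun i => (e i : S)) ∈
        {x : Fin k → S | ¬ Function.Injective x}} :=
      ⟨fun e => e.2 (Subtype.val_injective.comp e.1.injective)⟩
    rw [Nat.card_of_isEmpty, Nat.cast_zero]
  · simp [factorialMeasure, hF]

theorem integral_factorialMeasure {E : Type*} [NormedAddCommGroup E] [NormedSpace ℝ E]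
    [CompleteSpace E] {F : Set S} [Fintype F] [DecidableEq F] {f : (Fin k → S) → E}
    (hf : StronglyMeasurable f) :
    ∫ x, f x ∂factorialMeasure k F = ∑ e : Fin k ↪ F, f fun i => (e i : S) := by
  rw [factorialMeasure_of_finite, integral_finsetSum_measure]
  · exact Finset.sum_congr rfl fun e _ => integral_dirac' _ _ hf
  · intro e _
    exact integrable_dirac' hf (by simp)

theorem measurableSet_not_injective [TopologicalSpace S] [SecondCountableTopology S] [T2Space S]
    [BorelSpace S] : MeasurableSet {x : Fin k → S | ¬ Function.Injective x} := by
  have : {x : Fin k → S | ¬ Function.Injective x} =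
      ⋃ i, ⋃ j, ⋃ _ : i ≠ j, {x | x i = x j} := by
    ext x
    simp [Function.Injective, and_comm]
  rw [this]
  refine .iUnion fun i => .iUnion fun j => .iUnion fun _ => ?_
  exact (isClosed_eq (continuous_apply i) (continuous_apply j)).measurableSet

/-- Distinct points have disjoint neighbourhoods in a countable basis, which leaves countably many
rectangles. -/
theorem exists_disjoint_rectangles (S : Type*) [MeasurableSpace S] [TopologicalSpace S]
    [SecondCountableTopology S] [T2Space S] [BorelSpace S] (k : ℕ) :
    ∃ B : ℕ → Fin k → Set S, (∀ n i, MeasurableSet (B n i)) ∧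
      (∀ n, Pairwise fun i j => Disjoint (B n i) (B n j)) ∧
      {x | Function.Injective x} ⊆ ⋃ n, univ.pi (B n) := by
  classical
  let b := TopologicalSpace.countableBasis S
  have hb := TopologicalSpace.isBasis_countableBasis S
  have : Countable b := (TopologicalSpace.countable_countableBasis S).to_subtype
  -- The extra element `none` makes the index type nonempty, so that `ℕ` maps onto it.
  let ι := Option {c : Fin k → b // Pairwise fun i j => Disjoint (c i : Set S) (c j)}
  obtain ⟨f, hf⟩ := exists_surjective_nat ι
  let B : ι → Fin k → Set S := fun o i => o.elim ∅ fun c => (c.1 i : Set S)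
  refine ⟨fun n => B (f n), fun n i => ?_, fun n => ?_, fun x hx => ?_⟩
  · change MeasurableSet (B (f n) i)
    rcases f n with _ | c
    · exact MeasurableSet.empty
    · exact (TopologicalSpace.isOpen_of_mem_countableBasis (c.1 i).2).measurableSet
  · change Pairwise fun i j => Disjoint (B (f n) i) (B (f n) j)
    rcases f n with _ | c
    · intro i j _
      exact disjoint_bot_left
    · exact c.2
  · obtain ⟨U, hU, hd⟩ := (finite_range x).t2_separation
    have h1 : ∀ i, ∃ v : b, x i ∈ (v : Set S) ∧ (v : Set S) ⊆ U (x i) := fun i => by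
      obtain ⟨v, hv, h⟩ := hb.exists_subset_of_mem_open (hU (x i)).1 (hU (x i)).2
      exact ⟨⟨v, hv⟩, h⟩
    choose v hv using h1
    have hvd : Pairwise fun i j => Disjoint (v i : Set S) (v j) := fun i j hij =>
      (hd (mem_range_self i) (mem_range_self j) (fun h => hij (hx h))).mono (hv i).2 (hv j).2
    obtain ⟨n, hn⟩ := hf (some ⟨v, hvd⟩)
    refine mem_iUnion.2 ⟨n, fun i _ => ?_⟩
    simp only [B, hn]
    exact (hv i).1

/-- The point process `F` has counts which are independent on disjoint sets, and intensity
measure `θ`. -/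
structure HasIndepCounts {Ω : Type*} [MeasurableSpace Ω] (P : Measure Ω) (F : Ω → Set S)
    (θ : Measure S) : Prop where
  measurable_encard : ∀ B, MeasurableSet B → Measurable fun ω => (F ω ∩ B).encard
  lintegral_encard : ∀ B, MeasurableSet B → ∫⁻ ω, ((F ω ∩ B).encard : ℝ≥0∞) ∂P = θ B
  indep : ∀ (m : ℕ) (B : Fin m → Set S), (∀ i, MeasurableSet (B i)) →
    Pairwise (fun i j => Disjoint (B i) (B j)) → iIndepFun (fun i ω => (F ω ∩ B i).encard) P

namespace HasIndepCounts

variable {Ω : Type*} [MeasurableSpace Ω] {P : Measure Ω} {F : Ω → Set S} {θ : Measure S}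

theorem measurableSet_finite (h : HasIndepCounts P F θ) : MeasurableSet {ω | (F ω).Finite} := by
  have h1 := h.measurable_encard univ .univ
  have : {ω | (F ω).Finite} = (fun ω => (F ω ∩ univ).encard) ⁻¹' {⊤}ᶜ := by
    ext ω
    simp [Set.encard_eq_top_iff]
  rw [this]
  exact h1 (measurableSet_singleton _).compl

theorem ae_finite [IsFiniteMeasure θ] (h : HasIndepCounts P F θ) : ∀ᵐ ω ∂P, (F ω).Finite := by
  have h1 := h.measurable_encard univ .univ
  have h2 := ae_lt_top ((measurable_of_countable ENat.toENNReal).comp h1)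
    (by
      have := h.lintegral_encard univ .univ
      simp only [Function.comp_def]
      rw [this]
      exact measure_ne_top θ univ)
  filter_upwards [h2] with ω hω
  simp only [Function.comp_def, inter_univ] at hω
  rw [← Set.encard_ne_top_iff]
  intro h'
  rw [h'] at hω
  simp at hω

theorem measurable_factorialMeasure_pi (h : HasIndepCounts P F θ) {B : Fin k → Set S}
    (hB : ∀ i, MeasurableSet (B i)) (hd : Pairwise fun i j => Disjoint (B i) (B j)) :
    Measurable fun ω => factorialMeasure k (F ω) (univ.pi B) := by
  classical
  -- For infinite configurations the factorial measure is zero by definition, while the product of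
  -- counts need not vanish.
  have : (fun ω => factorialMeasure k (F ω) (univ.pi B)) = fun ω => {ω | (F ω).Finite}.indicator
      (fun ω => ∏ i, ((F ω ∩ B i).encard : ℝ≥0∞)) ω := by
    ext ω
    by_cases hF : (F ω).Finite
    · rw [factorialMeasure_pi hF hB hd, indicator_of_mem (show ω ∈ {ω | (F ω).Finite} from hF)]
    · rw [indicator_of_notMem (show ω ∉ {ω | (F ω).Finite} from hF)]
      simp [factorialMeasure, hF]
  rw [this]
  refine Measurable.indicator (Finset.measurable_prod _ fun i _ => ?_) h.measurableSet_finite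
  exact (measurable_of_countable ENat.toENNReal).comp (h.measurable_encard _ (hB i))

variable [TopologicalSpace S] [SecondCountableTopology S] [T2Space S] [BorelSpace S]

/-- On a rectangle with disjoint factors, a π-system argument reduces the claim to products of
counts. Countably many such rectangles cover the injective tuples, which carry the whole mass. -/
theorem measurable_factorialMeasure (h : HasIndepCounts P F θ) (k : ℕ) :
    Measurable fun ω => factorialMeasure k (F ω) := by
  obtain ⟨B, hB, hd, hcov⟩ := exists_disjoint_rectangles S k
  have hBm : ∀ n, MeasurableSet (univ.pi (B n)) := fun n => .univ_pi (hB n)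
  have h1 : ∀ n, Measurable fun ω => (factorialMeasure k (F ω)).restrict (univ.pi (B n)) := by
    intro n
    refine Measurable.measure_of_isPiSystem generateFrom_pi.symm isPiSystem_pi ?_ ?_
    · rintro _ ⟨C, hC, rfl⟩
      have hC : ∀ i, MeasurableSet (C i) := fun i => hC i (mem_univ i)
      simp_rw [Measure.restrict_apply (MeasurableSet.univ_pi hC), ← pi_inter_distrib]
      exact h.measurable_factorialMeasure_pi (fun i => (hC i).inter (hB n i)) fun i j hij =>
        (hd n hij).mono inter_subset_right inter_subset_right
    · simp_rw [Measure.restrict_apply_univ]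
      exact h.measurable_factorialMeasure_pi (hB n) (hd n)
  refine Measure.measurable_of_measurable_coe _ fun A hA => ?_
  have h2 : ∀ ω, factorialMeasure k (F ω) A = ∑' n, (factorialMeasure k (F ω)).restrict
      (univ.pi (B n)) (A ∩ disjointed (fun n => univ.pi (B n)) n) := by
    intro ω
    have hm : ∀ n, MeasurableSet (A ∩ disjointed (fun n => univ.pi (B n)) n) := fun n =>
      hA.inter (MeasurableSet.disjointed hBm n)
    have e : ∀ n, (factorialMeasure k (F ω)).restrict (univ.pi (B n))
        (A ∩ disjointed (fun n => univ.pi (B n)) n) =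
        factorialMeasure k (F ω) (A ∩ disjointed (fun n => univ.pi (B n)) n) := fun n =>
      Measure.restrict_eq_self _ (inter_subset_right.trans (disjointed_le _ n))
    simp_rw [e]
    rw [← measure_iUnion (fun i j hij => ((disjoint_disjointed _) hij).mono inter_subset_right
      inter_subset_right) hm, ← inter_iUnion, iUnion_disjointed]
    refine le_antisymm ?_ (measure_mono inter_subset_left)
    have hs : A ⊆ (A ∩ ⋃ n, univ.pi (B n)) ∪ {x | ¬ Function.Injective x} := by
      intro x hx
      by_cases hi : Function.Injective x
      · exact Or.inl ⟨hx, hcov hi⟩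
      · exact Or.inr hi
    refine (measure_mono hs).trans ((measure_union_le _ _).trans ?_)
    rw [factorialMeasure_not_injective measurableSet_not_injective, add_zero]
  simp_rw [h2]
  exact Measurable.tsum fun n =>
    (Measure.measurable_coe (hA.inter (MeasurableSet.disjointed hBm n))).comp (h1 n)

/-- Diagonals are null by Fubini's theorem, since `θ` has no atoms. -/
theorem pi_not_injective [IsFiniteMeasure θ] [NullSingletonClass θ] :
    Measure.pi (fun _ : Fin k => θ) {x | ¬ Function.Injective x} = 0 := by
  have h1 : ∀ i j : Fin k, i ≠ j → Measure.pi (fun _ : Fin k => θ) {x | x i = x j} = 0 := by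
    intro i j hij
    obtain _ | k := k
    · exact i.elim0
    obtain ⟨j', rfl⟩ := Fin.exists_succAbove_eq hij.symm
    have hmp := measurePreserving_piFinSuccAbove (fun _ : Fin (k + 1) => θ) i
    have hm : MeasurableSet {p : S × (Fin k → S) | p.1 = p.2 j'} :=
      measurableSet_eq_fun measurable_fst ((measurable_pi_apply j').comp measurable_snd)
    have h2 := hmp.measure_preimage hm.nullMeasurableSet
    rw [Measure.prod_apply_symm hm] at h2
    have h3 : ∀ y : Fin k → S, (fun x => (x, y)) ⁻¹' {p : S × (Fin k → S) | p.1 = p.2 j'} =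
        {y j'} := fun y => rfl
    simp_rw [h3] at h2
    simp only [measure_singleton, lintegral_zero] at h2
    exact h2
  refine measure_mono_null (t := ⋃ i, ⋃ j, ⋃ _ : i ≠ j, {x | x i = x j}) ?_ ?_
  · intro x hx
    have hx : ¬ Function.Injective x := hx
    simp only [Function.Injective, not_forall] at hx
    obtain ⟨i, j, e, hij⟩ := hx
    exact mem_iUnion.2 ⟨i, mem_iUnion.2 ⟨j, mem_iUnion.2 ⟨hij, e⟩⟩⟩
  · exact measure_iUnion_null fun i => measure_iUnion_null fun j => measure_iUnion_null fun hij =>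
      h1 i j hij

/-- The expectation of a product of independent counts factorizes. -/
theorem bind_factorialMeasure_pi [IsFiniteMeasure θ] (h : HasIndepCounts P F θ)
    {B : Fin k → Set S} (hB : ∀ i, MeasurableSet (B i))
    (hd : Pairwise fun i j => Disjoint (B i) (B j)) :
    P.bind (fun ω => factorialMeasure k (F ω)) (univ.pi B) =
      Measure.pi (fun _ => θ) (univ.pi B) := by
  rw [Measure.bind_apply (.univ_pi hB) (h.measurable_factorialMeasure k).aemeasurable,
    Measure.pi_pi]
  have h1 : ∀ᵐ ω ∂P, factorialMeasure k (F ω) (univ.pi B) =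
      ∏ i, ((F ω ∩ B i).encard : ℝ≥0∞) := by
    filter_upwards [h.ae_finite] with ω hω
    exact factorialMeasure_pi hω hB hd
  rw [lintegral_congr_ae h1]
  have h2 := (h.indep k B hB hd).comp (fun _ => ENat.toENNReal) fun _ => measurable_of_countable _
  have h3 := lintegral_prod_eq_prod_lintegral_of_indepFun Finset.univ _ h2 fun i =>
    (measurable_of_countable ENat.toENNReal).comp (h.measurable_encard _ (hB i))
  simp only [Function.comp_def] at h3
  rw [h3]
  exact Finset.prod_congr rfl fun i _ => h.lintegral_encard _ (hB i)

/-- The factorial moment measures are the powers of the intensity measure. -/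
theorem bind_factorialMeasure [IsFiniteMeasure θ] [NullSingletonClass θ] (h : HasIndepCounts P F θ) (k : ℕ) :
    P.bind (fun ω => factorialMeasure k (F ω)) = Measure.pi fun _ => θ := by
  obtain ⟨B, hB, hd, hcov⟩ := exists_disjoint_rectangles S k
  have hD := measurableSet_not_injective (S := S) (k := k)
  have z1 : P.bind (fun ω => factorialMeasure k (F ω)) {x | ¬ Function.Injective x} = 0 := by
    rw [Measure.bind_apply hD (h.measurable_factorialMeasure k).aemeasurable]
    simp [factorialMeasure_not_injective hD]
  have z2 : Measure.pi (fun _ : Fin k => θ) {x | ¬ Function.Injective x} = 0 := pi_not_injective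
  symm
  -- The measures agree inside rectangles with disjoint factors, and both vanish on the set of
  -- tuples with a repetition; these countably many sets cover the space.
  refine Measure.ext_of_generateFrom_of_cover generateFrom_pi.symm
    (T := insert {x | ¬ Function.Injective x} (range fun n => univ.pi (B n)))
    ((countable_range _).insert _) isPiSystem_pi ?_ (fun t _ => measure_ne_top _ _) ?_ ?_
  · rw [sUnion_insert, sUnion_range, eq_univ_iff_forall]
    intro x
    by_cases hi : Function.Injective x
    · exact Or.inr (hcov hi)
    · exact Or.inl hi
  · rintro t (rfl | ⟨n, rfl⟩) _ ⟨C, hC, rfl⟩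
    · rw [measure_mono_null inter_subset_right z1, measure_mono_null inter_subset_right z2]
    · have hC : ∀ i, MeasurableSet (C i) := fun i => hC i (mem_univ i)
      rw [← pi_inter_distrib, h.bind_factorialMeasure_pi (fun i => (hC i).inter (hB n i))
        fun i j hij => (hd n hij).mono inter_subset_right inter_subset_right]
  · rintro t (rfl | ⟨n, rfl⟩)
    · rw [z1, z2]
    · rw [h.bind_factorialMeasure_pi (hB n) (hd n)]

variable {E : Type*} [NormedAddCommGroup E] [NormedSpace ℝ E]

/-- Campbell's theorem for the factorial measures. -/
theorem integral_factorialMeasure [IsFiniteMeasure θ] [NullSingletonClass θ] (h : HasIndepCounts P F θ)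
    {k : ℕ} {f : (Fin k → S) → E} (hf : Integrable f (Measure.pi fun _ => θ)) :
    Integrable (fun ω => ∫ x, f x ∂factorialMeasure k (F ω)) P ∧
      ∫ ω, ∫ x, f x ∂factorialMeasure k (F ω) ∂P = ∫ x, f x ∂Measure.pi fun _ => θ := by
  let η : Kernel Ω (Fin k → S) := ⟨fun ω => factorialMeasure k (F ω),
    h.measurable_factorialMeasure k⟩
  have he : (η ∘ₖ Kernel.const Unit P) () = Measure.pi fun _ => θ := by
    rw [← h.bind_factorialMeasure k, Kernel.comp_apply]
    rfl
  rw [← he] at hf ⊢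
  exact ⟨hf.integral_comp, (Kernel.integral_comp hf).symm⟩

theorem integral_norm_factorialMeasure [IsFiniteMeasure θ] [NullSingletonClass θ] (h : HasIndepCounts P F θ)
    {k : ℕ} {f : (Fin k → S) → E} (hf : Integrable f (Measure.pi fun _ => θ)) :
    ∫ ω, ‖∫ x, f x ∂factorialMeasure k (F ω)‖ ∂P ≤ ∫ x, ‖f x‖ ∂Measure.pi fun _ => θ := by
  obtain ⟨h1, h2⟩ := h.integral_factorialMeasure hf.norm
  rw [← h2]
  exact integral_mono (h.integral_factorialMeasure hf).1.norm h1 fun ω =>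
    norm_integral_le_integral_norm _

end HasIndepCounts

end Factorial

/-! ### The intensity measure of the particle process -/

/-- The intensity measure of the particle process. -/
def intensityMeasure (γ : ℝ) (Q : Measure (ConvexBody Plane)) : Measure (ConvexBody Plane) :=
  ENNReal.ofReal γ • (Q.prod (volume : Measure Plane)).map fun p => translateBody p.1 p.2

theorem measurable_translateBody :
    Measurable fun p : ConvexBody Plane × Plane => translateBody p.1 p.2 :=
  continuous_translateBody.measurable

theorem intensityMeasure_apply (γ : ℝ) (Q : Measure (ConvexBody Plane)) [SFinite Q]
    {A : Set (ConvexBody Plane)} (hA : MeasurableSet A) :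
    intensityMeasure γ Q A = intensity γ Q A := by
  rw [intensityMeasure, Measure.smul_apply, Measure.map_apply measurable_translateBody hA,
    Measure.prod_apply_symm (measurable_translateBody hA), intensity, smul_eq_mul]
  rfl

theorem intensityMeasure_apply_eq (γ : ℝ) (Q : Measure (ConvexBody Plane)) [SFinite Q]
    {A : Set (ConvexBody Plane)} (hA : MeasurableSet A) :
    intensityMeasure γ Q A =
      ENNReal.ofReal γ * ∫⁻ K, volume {x : Plane | translateBody K x ∈ A} ∂Q := by
  rw [intensityMeasure, Measure.smul_apply, Measure.map_apply measurable_translateBody hA,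
    Measure.prod_apply (measurable_translateBody hA), smul_eq_mul]
  rfl

theorem supportFun_translateBody (K : ConvexBody Plane) (x v : Plane) :
    supportFun (translateBody K x) v = inner ℝ v x + supportFun K v := by
  apply le_antisymm
  · refine supportFun_le fun y hy => ?_
    have := inner_le_supportFun K v (mem_translateBody.1 hy)
    rw [inner_sub_right] at this
    linarith
  · have : supportFun K v ≤ supportFun (translateBody K x) v - inner ℝ v x := by
      refine supportFun_le fun y hy => ?_
      have := inner_le_supportFun (translateBody K x) v
        (mem_translateBody.2 (by simpa using hy) : y + x ∈ _)
      rw [inner_add_right] at this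
      linarith
    linarith

theorem translateBody_injective (K : ConvexBody Plane) : Function.Injective (translateBody K) := by
  intro x y h
  have h1 := congrArg (fun L => supportFun L (x - y)) h
  simp only [supportFun_translateBody] at h1
  have h2 : inner ℝ (x - y) (x - y) = 0 := by
    rw [inner_sub_right]
    linarith
  exact sub_eq_zero.1 (inner_self_eq_zero.1 h2)

/-- At most one translation takes a given grain to a given body. -/
instance nullSingletonClass_intensityMeasure (γ : ℝ) (Q : Measure (ConvexBody Plane)) [SFinite Q] :
    NullSingletonClass (intensityMeasure γ Q) where
  measure_singleton L := by
    rw [intensityMeasure_apply_eq γ Q (measurableSet_singleton L)]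
    have : ∀ K, volume {x : Plane | translateBody K x ∈ ({L} : Set (ConvexBody Plane))} = 0 :=
      fun K => Set.Subsingleton.measure_zero (fun x (hx : translateBody K x = L) y
        (hy : translateBody K y = L) => translateBody_injective K (hx.trans hy.symm)) _
    simp_rw [this]
    simp

/-- The convex bodies which meet `W`. -/
def hitting (W : Set Plane) : Set (ConvexBody Plane) := {K | (W ∩ (K : Set Plane)).Nonempty}

theorem measurableSet_hitting {W : Set Plane} (hW : IsCompact W) : MeasurableSet (hitting W) :=
  (isClosed_inter_nonempty hW).measurableSet

/-- Cover `W` by finitely many unit discs. If `K + x` meets the disc around `c`, then `c - x` lies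
in the unit parallel body of `K`. -/
theorem exists_volume_hitting_le {W : Set Plane} (hW : IsCompact W) :
    ∃ m : ℕ, ∀ K : ConvexBody Plane, volume {x : Plane | translateBody K x ∈ hitting W} ≤
      m * volume ((K : Set Plane) + Metric.closedBall (0 : Plane) 1) := by
  obtain ⟨t, -, htf, ht⟩ := hW.finite_cover_balls (e := 1) one_pos
  refine ⟨htf.toFinset.card, fun K => ?_⟩
  have hm : MeasurableSet ((K : Set Plane) + Metric.closedBall (0 : Plane) 1) :=
    (K.isCompact.add (isCompact_closedBall _ _)).isClosed.measurableSet
  have hs : {x : Plane | translateBody K x ∈ hitting W} ⊆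
      ⋃ c ∈ htf.toFinset, {x | c - x ∈ (K : Set Plane) + Metric.closedBall (0 : Plane) 1} := by
    rintro x ⟨w, hw, hwK⟩
    obtain ⟨c, hc, hwc⟩ := mem_iUnion₂.1 (ht hw)
    refine mem_iUnion₂.2 ⟨c, htf.mem_toFinset.2 hc, w - x, mem_translateBody.1 hwK, c - w, ?_, ?_⟩
    · rw [mem_closedBall_zero_iff, ← dist_eq_norm, dist_comm]
      exact (Metric.mem_ball.1 hwc).le
    · simp only
      abel
  refine (measure_mono hs).trans ((measure_biUnion_finset_le _ _).trans ?_)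
  refine (Finset.sum_le_card_nsmul _ _ (volume ((K : Set Plane) + Metric.closedBall (0 : Plane) 1))
    fun c _ => (volume_sub_mem c hm).le).trans ?_
  rw [nsmul_eq_mul]

section Grains

variable {γ : ℝ} {Q : Measure (ConvexBody Plane)}

theorem IsSmoothGrainDistribution.intensityMeasure_hitting_lt_top (γ : ℝ)
    (hQ : IsSmoothGrainDistribution Q) {W : Set Plane} (hW : IsCompact W) :
    intensityMeasure γ Q (hitting W) < ∞ := by
  have := hQ.isProbability
  rw [intensityMeasure_apply_eq γ Q (measurableSet_hitting hW)]
  obtain ⟨m, hm⟩ := exists_volume_hitting_le hW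
  refine ENNReal.mul_lt_top ENNReal.ofReal_lt_top ((lintegral_mono hm).trans_lt ?_)
  rw [lintegral_const_mul' _ _ (ENNReal.natCast_ne_top m)]
  exact ENNReal.mul_lt_top (ENNReal.natCast_lt_top m) hQ.integrability

theorem volume_le_volume_add_closedBall (K : ConvexBody Plane) :
    volume (K : Set Plane) ≤ volume ((K : Set Plane) + Metric.closedBall (0 : Plane) 1) :=
  measure_mono fun x hx => ⟨x, hx, 0, by simp, by simp⟩

theorem IsSmoothGrainDistribution.lintegral_volume_lt_top (hQ : IsSmoothGrainDistribution Q) :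
    ∫⁻ K, volume (K : Set Plane) ∂Q < ∞ :=
  (lintegral_mono volume_le_volume_add_closedBall).trans_lt hQ.integrability

theorem IsSmoothGrainDistribution.integrable_volume (hQ : IsSmoothGrainDistribution Q) :
    Integrable (fun K : ConvexBody Plane => (volume (K : Set Plane)).toReal) Q :=
  integrable_toReal_of_lintegral_ne_top measurable_volume_convexBody.aemeasurable
    hQ.lintegral_volume_lt_top.ne

theorem two_mul_supportMeasure_univ_le (K : ConvexBody Plane) :
    2 * supportMeasure K univ ≤
      volume ((K : Set Plane) + Metric.closedBall (0 : Plane) 1) := by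
  have h := two_mul_supportMeasure_le K (η := univ) .univ (ε := 1) one_pos
  have h2 : ENNReal.ofReal (1 * 2) = 2 := by simp
  rw [h2] at h
  exact h.trans (measure_mono fun x hx => hx.1.1)

theorem volume_add_closedBall_lt_top {A : Set Plane} (hA : IsCompact A) :
    volume (A + Metric.closedBall (0 : Plane) 1) < ∞ :=
  (hA.add (isCompact_closedBall _ _)).measure_lt_top

theorem surfaceConst_pos (s : ℕ) : 0 < surfaceConst s := by
  have := sphereArea_pos s
  unfold surfaceConst
  positivity

/-- The perimeter is dominated by the area of the unit parallel body, which is what the moment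
assumption on the grains controls. -/
theorem norm_surfaceTensor_le_volume (s : ℕ) (K : ConvexBody Plane) :
    ‖surfaceTensor s K‖ ≤ surfaceConst s *
      (volume ((K : Set Plane) + Metric.closedBall (0 : Plane) 1)).toReal := by
  have h1 := norm_surfaceTensor_le s K
  have h2 := ENNReal.toReal_mono (volume_add_closedBall_lt_top K.isCompact).ne
    (two_mul_supportMeasure_univ_le K)
  rw [ENNReal.toReal_mul, ENNReal.toReal_ofNat] at h2
  have := mul_le_mul_of_nonneg_left h2 (surfaceConst_pos s).le
  linarith

/-- A bound uniform over all compact convex parts of a window, which later makes the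
inclusion-exclusion series summable in `L¹`. -/
theorem norm_surfaceTensorSet_le (s : ℕ) {A W : Set Plane} (hA : IsCompact A) (hc : Convex ℝ A)
    (hW : IsCompact W) (hAW : A ⊆ W) :
    ‖surfaceTensorSet s A‖ ≤ surfaceConst s *
      (volume (W + Metric.closedBall (0 : Plane) 1)).toReal := by
  rcases A.eq_empty_or_nonempty with rfl | hne
  · rw [surfaceTensorSet_empty, norm_zero]
    exact mul_nonneg (surfaceConst_pos s).le ENNReal.toReal_nonneg
  obtain ⟨K, rfl⟩ := exists_convexBody_coe hA hc hne
  rw [surfaceTensorSet_coe]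
  refine (norm_surfaceTensor_le_volume s K).trans ?_
  refine mul_le_mul_of_nonneg_left ?_ (surfaceConst_pos s).le
  exact ENNReal.toReal_mono (volume_add_closedBall_lt_top hW).ne
    (measure_mono (add_subset_add_right hAW))

theorem IsSmoothGrainDistribution.integrable_surfaceTensor (hQ : IsSmoothGrainDistribution Q)
    (s : ℕ) : Integrable (surfaceTensor s) Q := by
  have hm : AEStronglyMeasurable (surfaceTensor s) Q :=
    (stronglyMeasurable_surfaceTensor s).aestronglyMeasurable
  refine ⟨hm, ?_⟩
  rw [HasFiniteIntegral]
  refine lt_of_le_of_lt (lintegral_mono (g := fun K : ConvexBody Plane => ENNReal.ofReal (surfaceConst s) *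
    volume ((K : Set Plane) + Metric.closedBall (0 : Plane) 1)) fun K => ?_) ?_
  · rw [← ofReal_norm]
    refine (ENNReal.ofReal_le_ofReal (norm_surfaceTensor_le_volume s K)).trans ?_
    rw [ENNReal.ofReal_mul (surfaceConst_pos s).le,
      ENNReal.ofReal_toReal (volume_add_closedBall_lt_top K.isCompact).ne]
  · rw [lintegral_const_mul' _ _ ENNReal.ofReal_ne_top]
    exact ENNReal.mul_lt_top ENNReal.ofReal_lt_top hQ.integrability

end Grains

/-! ### The particles that meet a window -/

theorem stronglyMeasurable_surfaceTensorSet_inter (s : ℕ) {A : Set Plane} (hA : IsCompact A)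
    (hc : Convex ℝ A) :
    StronglyMeasurable fun K : ConvexBody Plane => surfaceTensorSet s (A ∩ (K : Set Plane)) := by
  have h := (stronglyMeasurable_surfaceTensorSet_interBodies (k := 1) s hA hc).comp_measurable
    (g := fun K : ConvexBody Plane => fun _ : Fin 1 => K) (by fun_prop)
  have e : (fun K : ConvexBody Plane => surfaceTensorSet s (A ∩ (K : Set Plane))) =
      (fun K : Fin 1 → ConvexBody Plane => surfaceTensorSet s (interBodies A K)) ∘
        fun K _ => K := by
    ext1 K
    simp only [Function.comp_def, interBodies, iInter_const]
  rw [e]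
  exact h

theorem measurable_volume_inter {A : Set Plane} (hA : IsCompact A) :
    Measurable fun K : ConvexBody Plane => volume (A ∩ (K : Set Plane)) := by
  have h := (measurable_volume_interBodies (k := 1) hA).comp
    (f := fun K : ConvexBody Plane => fun _ : Fin 1 => K) (by fun_prop)
  simpa only [Function.comp_def, interBodies, iInter_const] using h

/-- The intensity measure of the particles that meet `W`. -/
def windowIntensity (γ : ℝ) (Q : Measure (ConvexBody Plane)) (W : Set Plane) :
    Measure (ConvexBody Plane) :=
  (intensityMeasure γ Q).restrict (hitting W)

section Window

variable {γ : ℝ} {Q : Measure (ConvexBody Plane)} {W A : Set Plane}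

theorem IsSmoothGrainDistribution.isFiniteMeasure_windowIntensity
    (hQ : IsSmoothGrainDistribution Q) (hW : IsCompact W) :
    IsFiniteMeasure (windowIntensity γ Q W) :=
  isFiniteMeasure_restrict.2 (hQ.intensityMeasure_hitting_lt_top γ hW).ne

theorem inter_eq_empty_of_notMem_hitting (hAW : A ⊆ W) {K : ConvexBody Plane} (hK : K ∉ hitting W) :
    A ∩ (K : Set Plane) = ∅ :=
  not_nonempty_iff_eq_empty.1 fun h => hK (h.mono (inter_subset_inter_left _ hAW))

theorem integral_windowIntensity [SFinite Q] {E : Type*} [NormedAddCommGroup E] [NormedSpace ℝ E]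
    (hγ : 0 < γ) {f : ConvexBody Plane → E} (hm : StronglyMeasurable f)
    (hf : Integrable f (windowIntensity γ Q W)) (h0 : ∀ K ∉ hitting W, f K = 0) :
    ∫ K, f K ∂windowIntensity γ Q W = γ • ∫ K, (∫ x, f (translateBody K x)) ∂Q := by
  have hi : Integrable f (intensityMeasure γ Q) :=
    IntegrableOn.integrable_of_forall_notMem_eq_zero hf h0
  rw [intensityMeasure, integrable_smul_measure (by simpa using hγ) ENNReal.ofReal_ne_top,
    integrable_map_measure hm.aestronglyMeasurable measurable_translateBody.aemeasurable] at hi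
  rw [windowIntensity, setIntegral_eq_integral_of_forall_compl_eq_zero h0, intensityMeasure,
    integral_smul_measure, integral_map measurable_translateBody.aemeasurable
      hm.aestronglyMeasurable, integral_prod (fun p : ConvexBody Plane × Plane =>
        f (translateBody p.1 p.2)) hi, ENNReal.toReal_ofReal hγ.le]

theorem IsSmoothGrainDistribution.integral_windowIntensity_volume
    (hQ : IsSmoothGrainDistribution Q) (hγ : 0 < γ) (hA : IsCompact A) (hAW : A ⊆ W) :
    ∫ K, (volume (A ∩ (K : Set Plane))).toReal ∂windowIntensity γ Q W =
      particleAreaDensity γ Q * (volume A).toReal := by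
  have := hQ.isProbability
  have hfin : ∀ K : ConvexBody Plane, volume (A ∩ (K : Set Plane)) < ∞ := fun K =>
    (hA.inter_right K.isClosed).measure_lt_top
  rw [windowIntensity, setIntegral_eq_integral_of_forall_compl_eq_zero fun K hK => by
    rw [inter_eq_empty_of_notMem_hitting hAW hK]; simp]
  rw [integral_toReal (measurable_volume_inter hA).aemeasurable (.of_forall hfin), intensityMeasure,
    lintegral_smul_measure, lintegral_map (measurable_volume_inter hA) measurable_translateBody,
    lintegral_prod (fun p : ConvexBody Plane × Plane => volume (A ∩ translateBody p.1 p.2))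
      ((measurable_volume_inter hA).comp measurable_translateBody).aemeasurable]
  simp_rw [lintegral_volume_inter_translateBody hA.isClosed.measurableSet]
  rw [lintegral_const_mul _ measurable_volume_convexBody, particleAreaDensity,
    integral_toReal measurable_volume_convexBody.aemeasurable
      (.of_forall fun K => K.volume_lt_top), smul_eq_mul, ENNReal.toReal_mul, ENNReal.toReal_mul,
    ENNReal.toReal_ofReal hγ.le]
  ring

/-- The translative formula averaged over the grains. The area of `A` appears next to its tensor, so
only the pair of both is closed under iteration. -/
theorem IsSmoothGrainDistribution.integral_windowIntensity_surfaceTensor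
    (hQ : IsSmoothGrainDistribution Q) (hγ : 0 < γ) (s : ℕ) (hW : IsCompact W) (hA : IsCompact A)
    (hc : Convex ℝ A) (hAW : A ⊆ W) :
    ∫ K, surfaceTensorSet s (A ∩ (K : Set Plane)) ∂windowIntensity γ Q W =
      particleAreaDensity γ Q • surfaceTensorSet s A +
        (volume A).toReal • particleSurfaceDensity γ Q s := by
  have := hQ.isProbability
  have := hQ.isFiniteMeasure_windowIntensity (γ := γ) hW
  have hm := stronglyMeasurable_surfaceTensorSet_inter s hA hc
  have hi : Integrable (fun K : ConvexBody Plane => surfaceTensorSet s (A ∩ (K : Set Plane)))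
      (windowIntensity γ Q W) :=
    Integrable.of_bound hm.aestronglyMeasurable _ (.of_forall fun K =>
      norm_surfaceTensorSet_le s (hA.inter_right K.isClosed) (hc.inter K.convex) hW
        (inter_subset_left.trans hAW))
  have hzero : ∀ K ∉ hitting W, surfaceTensorSet s (A ∩ (K : Set Plane)) = 0 := fun K hK => by
    rw [inter_eq_empty_of_notMem_hitting hAW hK, surfaceTensorSet_empty]
  rw [integral_windowIntensity hγ hm hi hzero]
  simp_rw [(integral_surfaceTensorSet_inter_translateBody s hA hc _).2]
  have h1 : Integrable (fun K : ConvexBody Plane => volume.real (K : Set Plane) •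
      surfaceTensorSet s A) Q := hQ.integrable_volume.smul_const _
  have h2 : Integrable (fun K : ConvexBody Plane => volume.real A • surfaceTensor s K) Q :=
    (hQ.integrable_surfaceTensor s).smul (volume.real A)
  rw [integral_add h1 h2, integral_smul_const, integral_smul, particleAreaDensity,
    particleSurfaceDensity]
  simp only [Measure.real]
  module

end Window

/-! ### Expectations for the Poisson process of particles -/

theorem hasSum_poisson {t : ℝ} (ht : 0 ≤ t) :
    HasSum (fun n : ℕ => Real.exp (-t) * t ^ n / n.factorial) 1 :=
  hasSum_one_poissonMeasure ⟨t, ht⟩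

theorem tsum_poisson {t : ℝ} (ht : 0 ≤ t) :
    ∑' n : ℕ, ENNReal.ofReal (Real.exp (-t) * t ^ n / n.factorial) = 1 := by
  rw [← ENNReal.ofReal_tsum_of_nonneg (fun n => by positivity) (hasSum_poisson ht).summable,
    (hasSum_poisson ht).tsum_eq, ENNReal.ofReal_one]

theorem succ_mul_poisson {t : ℝ} (ht : 0 ≤ t) (n : ℕ) : ((n + 1 : ℕ) : ℝ≥0∞) *
    ENNReal.ofReal (Real.exp (-t) * t ^ (n + 1) / (n + 1).factorial) =
    ENNReal.ofReal t * ENNReal.ofReal (Real.exp (-t) * t ^ n / n.factorial) := by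
  rw [← ENNReal.ofReal_natCast, ← ENNReal.ofReal_mul (by positivity), ← ENNReal.ofReal_mul ht]
  congr 1
  rw [Nat.factorial_succ]
  push_cast
  field_simp
  ring

theorem tsum_mul_poisson {t : ℝ} (ht : 0 ≤ t) :
    ∑' n : ℕ, (n : ℝ≥0∞) * ENNReal.ofReal (Real.exp (-t) * t ^ n / n.factorial) =
      ENNReal.ofReal t := by
  rw [tsum_eq_zero_add' (f := fun n : ℕ => (n : ℝ≥0∞) *
    ENNReal.ofReal (Real.exp (-t) * t ^ n / n.factorial)) ENNReal.summable, tsum_congr (succ_mul_poisson ht), ENNReal.tsum_mul_left,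
    tsum_poisson ht, Nat.cast_zero, zero_mul, zero_add, mul_one]

/-- The Poisson weights add up to one, so the count is almost surely finite and the integral splits
according to its value. -/
theorem lintegral_encard_eq {Ω : Type*} [MeasurableSpace Ω] {P : Measure Ω} [IsProbabilityMeasure P]
    {N : Ω → ℕ∞} (hN : Measurable N) {t : ℝ} (ht : 0 ≤ t)
    (hlaw : ∀ k : ℕ, P {ω | N ω = k} = ENNReal.ofReal (Real.exp (-t) * t ^ k / k.factorial)) :
    ∫⁻ ω, (N ω : ℝ≥0∞) ∂P = ENNReal.ofReal t := by
  have hm : ∀ k : ℕ, MeasurableSet {ω | N ω = k} := fun k => hN (measurableSet_singleton _)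
  have hd : Pairwise fun i j : ℕ => Disjoint {ω | N ω = i} {ω | N ω = j} := fun i j hij =>
    Set.disjoint_left.2 fun ω (h1 : N ω = i) (h2 : N ω = j) => hij (by
      rw [h1] at h2
      exact_mod_cast h2)
  have hU : P (⋃ k : ℕ, {ω | N ω = k}) = 1 := by
    rw [measure_iUnion hd hm]
    simp_rw [hlaw]
    exact tsum_poisson ht
  have hae : ∀ᵐ ω ∂P, ω ∈ ⋃ k : ℕ, {ω | N ω = k} :=
    (mem_ae_iff_prob_eq_one (MeasurableSet.iUnion hm)).2 hU
  rw [← Measure.restrict_eq_self_of_ae_mem hae, lintegral_iUnion hm hd, ← tsum_mul_poisson ht]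
  refine tsum_congr fun k => ?_
  have hc : ∀ ω ∈ {ω | N ω = k}, (N ω : ℝ≥0∞) = k := fun ω hω => by
    rw [show N ω = k from hω]
    rfl
  rw [setLIntegral_congr_fun (hm k) hc, setLIntegral_const, hlaw]

section BooleanModel

variable {Ω : Type*} [MeasurableSpace Ω] {P : Measure Ω} {γ : ℝ}
  {Q : Measure (ConvexBody Plane)} {X : Ω → Set (ConvexBody Plane)} {W : Set Plane}

theorem IsSmoothBooleanModel.hasIndepCounts (hX : IsSmoothBooleanModel P γ Q X)
    (hW : IsCompact W) :
    HasIndepCounts P (fun ω => X ω ∩ hitting W) (windowIntensity γ Q W) where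
  measurable_encard B hB := by
    simp_rw [inter_assoc]
    exact hX.poisson.measurable_count _ ((measurableSet_hitting hW).inter hB)
  lintegral_encard B hB := by
    have := hX.isProbability
    have := hX.grains.isProbability
    have hm := (measurableSet_hitting hW).inter hB
    have hfin : intensityMeasure γ Q (hitting W ∩ B) < ∞ :=
      (measure_mono inter_subset_left).trans_lt (hX.grains.intensityMeasure_hitting_lt_top γ hW)
    have h := hX.poisson.law_count _ hm (by rw [← intensityMeasure_apply γ Q hm]; exact hfin.ne)
    rw [← intensityMeasure_apply γ Q hm] at h
    simp_rw [inter_assoc]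
    rw [lintegral_encard_eq (hX.poisson.measurable_count _ hm) ENNReal.toReal_nonneg h,
      ENNReal.ofReal_toReal hfin.ne, windowIntensity, Measure.restrict_apply hB, inter_comm]
  indep m B hB hd := by
    simp_rw [inter_assoc]
    exact hX.poisson.indep_count m (fun i => hitting W ∩ B i)
      (fun i => (measurableSet_hitting hW).inter (hB i)) fun i j hij =>
        (hd hij).mono inter_subset_right inter_subset_right

end BooleanModel

/-! ### Iterated intersections with independent particles -/

theorem interBodies_cons (A : Set Plane) {k : ℕ} (K : Fin (k + 1) → ConvexBody Plane) :
    interBodies A K = interBodies (A ∩ (K 0 : Set Plane)) fun i => K i.succ := by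
  ext x
  simp [interBodies, Fin.forall_fin_succ, and_assoc]

theorem interBodies_subset (A : Set Plane) {k : ℕ} (K : Fin k → ConvexBody Plane) :
    interBodies A K ⊆ A :=
  inter_subset_left

/-- A functional on compact convex sets which, in expectation, is transformed by a linear operator
if the set is intersected with a random particle. -/
structure IsIteratedFunctional {E : Type*} [NormedAddCommGroup E] [NormedSpace ℝ E]
    (θ : Measure (ConvexBody Plane)) (W : Set Plane) (ψ : Set Plane → E) (L : E →L[ℝ] E) :
    Prop where
  isCompact : IsCompact W
  exists_bound : ∃ C, ∀ A ⊆ W, IsCompact A → Convex ℝ A → ‖ψ A‖ ≤ C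
  measurable : ∀ (k : ℕ) (A : Set Plane), IsCompact A → Convex ℝ A →
    StronglyMeasurable fun K : Fin k → ConvexBody Plane => ψ (interBodies A K)
  integral_inter : ∀ A ⊆ W, IsCompact A → Convex ℝ A → ∫ K, ψ (A ∩ (K : Set Plane)) ∂θ = L (ψ A)

namespace IsIteratedFunctional

variable {E : Type*} [NormedAddCommGroup E] [NormedSpace ℝ E]
  {θ : Measure (ConvexBody Plane)} [IsFiniteMeasure θ] {W A : Set Plane} {ψ : Set Plane → E}
  {L : E →L[ℝ] E}

theorem integrable (h : IsIteratedFunctional θ W ψ L) (k : ℕ) (hAW : A ⊆ W) (hA : IsCompact A)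
    (hc : Convex ℝ A) :
    Integrable (fun K : Fin k → ConvexBody Plane => ψ (interBodies A K)) (Measure.pi fun _ => θ) := by
  obtain ⟨C, hC⟩ := h.exists_bound
  exact Integrable.of_bound (h.measurable k A hA hc).aestronglyMeasurable C (.of_forall fun K =>
    hC _ ((interBodies_subset A K).trans hAW) (isCompact_interBodies hA K) (convex_interBodies hc K))

/-- Split off the first body and use the induction hypothesis for `A ∩ K`; this is why `A` varies.
The continuous operator then commutes with the remaining integral. -/
theorem integral_interBodies [CompleteSpace E] (h : IsIteratedFunctional θ W ψ L) (k : ℕ) (hAW : A ⊆ W)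
    (hA : IsCompact A) (hc : Convex ℝ A) :
    ∫ K : Fin k → ConvexBody Plane, ψ (interBodies A K) ∂(Measure.pi fun _ => θ) =
      (L ^ k) (ψ A) := by
  induction k generalizing A with
  | zero =>
    have : ∀ K : Fin 0 → ConvexBody Plane, interBodies A K = A := fun K => by simp [interBodies]
    simp_rw [this]
    rw [integral_const, Measure.real, Measure.pi_of_empty]
    simp
  | succ k ih =>
    have hmp := measurePreserving_piFinSuccAbove (fun _ : Fin (k + 1) => θ) 0
    have he : ∀ K : Fin (k + 1) → ConvexBody Plane, ψ (interBodies A K) =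
        (fun p : ConvexBody Plane × (Fin k → ConvexBody Plane) =>
          ψ (interBodies (A ∩ (p.1 : Set Plane)) p.2))
            (MeasurableEquiv.piFinSuccAbove (fun _ => ConvexBody Plane) 0 K) := fun K => by
      rw [interBodies_cons]
      rfl
    have hi := h.integrable (k + 1) hAW hA hc
    simp_rw [he] at hi ⊢
    have hi2 := (hmp.integrable_comp_emb (MeasurableEquiv.measurableEmbedding _)
      (g := fun p : ConvexBody Plane × (Fin k → ConvexBody Plane) =>
          ψ (interBodies (A ∩ (p.1 : Set Plane)) p.2))).1 hi
    refine (hmp.integral_comp' (fun p : ConvexBody Plane × (Fin k → ConvexBody Plane) =>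
          ψ (interBodies (A ∩ (p.1 : Set Plane)) p.2))).trans ?_
    rw [integral_prod _ hi2]
    have h1 : ∀ K : ConvexBody Plane, ∫ p : Fin k → ConvexBody Plane,
        ψ (interBodies (A ∩ (K : Set Plane)) p) ∂(Measure.pi fun _ => θ) =
        (L ^ k) (ψ (A ∩ (K : Set Plane))) := fun K =>
      ih (inter_subset_left.trans hAW) (hA.inter_right K.isClosed) (hc.inter K.convex)
    simp only
    simp_rw [h1]
    have hi1 : Integrable (fun K : ConvexBody Plane => ψ (A ∩ (K : Set Plane))) θ := by
      obtain ⟨C, hC⟩ := h.exists_bound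
      have hm := (h.measurable 1 A hA hc).comp_measurable
        (g := fun K : ConvexBody Plane => fun _ : Fin 1 => K) (by fun_prop)
      have hm' : StronglyMeasurable fun K : ConvexBody Plane => ψ (A ∩ (K : Set Plane)) := by
        have e : (fun K : ConvexBody Plane => ψ (A ∩ (K : Set Plane))) =
            (fun K : Fin 1 → ConvexBody Plane => ψ (interBodies A K)) ∘ fun K _ => K := by
          ext1 K
          simp only [Function.comp_def, interBodies, iInter_const]
        rw [e]
        exact hm
      exact Integrable.of_bound hm'.aestronglyMeasurable C (.of_forall fun K =>
        hC _ (inter_subset_left.trans hAW) (hA.inter_right K.isClosed) (hc.inter K.convex))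
    rw [ContinuousLinearMap.integral_comp_comm _ hi1, h.integral_inter A hAW hA hc, pow_succ]
    rfl

end IsIteratedFunctional

/-! ### Inclusion-exclusion over the particles of a Poisson process -/

theorem card_embedding_map_eq {α : Type*} [Fintype α] [DecidableEq α] {k : ℕ} {I : Finset α}
    (hI : I.card = k) :
    (Finset.univ.filter fun e : Fin k ↪ α => Finset.univ.map e = I).card = k.factorial := by
  let f : {e : Fin k ↪ α // Finset.univ.map e = I} ≃ (Fin k ≃ I) :=
    { toFun := fun e => Equiv.ofBijective
        (fun i => (⟨e.1 i, e.2.subset (Finset.mem_map_of_mem e.1 (Finset.mem_univ i))⟩ : I))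
        ((Fintype.bijective_iff_injective_and_card _).2
          ⟨fun i j h => e.1.injective (congrArg Subtype.val h), by simp [hI]⟩)
      invFun := fun e => ⟨e.toEmbedding.trans (Function.Embedding.subtype _), by
        ext x
        simp only [Finset.mem_map, Finset.mem_univ, true_and]
        constructor
        · rintro ⟨i, rfl⟩
          exact (e i).2
        · intro hx
          exact ⟨e.symm ⟨x, hx⟩, by simp⟩⟩
      left_inv := fun e => by ext i; rfl
      right_inv := fun e => by ext i; rfl }
  rw [← Fintype.card_subtype, Fintype.card_congr f,
    Fintype.card_equiv (I.equivFinOfCardEq hI).symm, Fintype.card_fin]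

/-- Each set with `k` elements is the image of `k!` embeddings. -/
theorem factorial_smul_sum_powersetCard {α E : Type*} [Fintype α] [DecidableEq α] [AddCommGroup E]
    (k : ℕ) (G : Finset α → E) :
    k.factorial • ∑ I ∈ Finset.univ.powersetCard k, G I =
      ∑ e : Fin k ↪ α, G (Finset.univ.map e) := by
  have h := Finset.sum_fiberwise_of_maps_to (s := (Finset.univ : Finset (Fin k ↪ α)))
    (t := (Finset.univ : Finset α).powersetCard k) (g := fun e => Finset.univ.map e)
    (fun e _ => by simp [Finset.mem_powersetCard]) fun e => G (Finset.univ.map e)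
  rw [← h, Finset.smul_sum]
  refine Finset.sum_congr rfl fun I hI => ?_
  rw [Finset.sum_congr rfl (g := fun _ => G I) fun e he => by rw [(Finset.mem_filter.1 he).2],
    Finset.sum_const, card_embedding_map_eq (Finset.mem_powersetCard.1 hI).2]

/-- Measurability of `f` is not presupposed but comes from the partial sums. This matters for the
surface tensor of a random union, which is defined by a choice of representation. -/
theorem integrable_and_hasSum_integral {α E : Type*} [MeasurableSpace α] {μ : Measure α}
    [NormedAddCommGroup E] [NormedSpace ℝ E] {F : ℕ → α → E} {f : α → E}
    (hF : ∀ i, Integrable (F i) μ) (hs : Summable fun i => ∫ a, ‖F i a‖ ∂μ)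
    (hf : ∀ᵐ a ∂μ, HasSum (F · a) (f a)) :
    Integrable f μ ∧ HasSum (fun i => ∫ a, F i a ∂μ) (∫ a, f a ∂μ) := by
  have hts : (fun a => ∑' i, F i a) =ᵐ[μ] f := hf.mono fun a ha => ha.tsum_eq
  refine ⟨⟨?_, ?_⟩, ?_⟩
  · refine aestronglyMeasurable_of_tendsto_ae atTop
      (f := fun (n : ℕ) a => ∑ i ∈ Finset.range n, F i a)
      (fun n => (integrable_finsetSum _ fun i _ => hF i).1) ?_
    exact hf.mono fun a ha => ha.tendsto_sum_nat
  · rw [HasFiniteIntegral]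
    have h1 : ∫⁻ a, ‖f a‖ₑ ∂μ ≤ ∫⁻ a, ∑' i, ‖F i a‖ₑ ∂μ :=
      lintegral_mono_ae (hts.mono fun a ha => by
        rw [← ha]
        exact enorm_tsum_le_tsum_enorm)
    refine h1.trans_lt ?_
    rw [lintegral_tsum fun i => (hF i).1.enorm]
    simp_rw [← ofReal_integral_norm_eq_lintegral_enorm (hF _)]
    rw [← ENNReal.ofReal_tsum_of_nonneg (fun i => integral_nonneg fun a => norm_nonneg _) hs]
    exact ENNReal.ofReal_lt_top
  · rw [← integral_congr_ae hts]
    exact hasSum_integral_of_summable_integral_norm hF hs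

/-- Group the nonempty index sets by their cardinality `k + 1`; the factorial measure counts each of
them `(k + 1)!` times. -/
theorem hasSum_integral_factorialMeasure {E : Type*} [NormedAddCommGroup E] [NormedSpace ℝ E]
    [CompleteSpace E] {ψ : Set Plane → E} {W : Set Plane}
    (hm : ∀ k, StronglyMeasurable fun K : Fin k → ConvexBody Plane => ψ (interBodies W K))
    {F : Set (ConvexBody Plane)} [Fintype F] :
    HasSum (fun k : ℕ => ((-1 : ℝ) ^ k / (k + 1).factorial) •
        ∫ K, ψ (interBodies W K) ∂factorialMeasure (k + 1) F)
      (∑ I ∈ (Finset.univ : Finset F).powerset with I.Nonempty,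
        (-1 : ℝ) ^ (I.card + 1) • ψ (⋂ K ∈ I, W ∩ ((K : ConvexBody Plane) : Set Plane))) := by
  classical
  have hinter : ∀ (k : ℕ) (e : Fin (k + 1) ↪ F), interBodies W (fun i => (e i : ConvexBody Plane)) =
      ⋂ K ∈ Finset.univ.map e, W ∩ ((K : ConvexBody Plane) : Set Plane) := fun k e => by
    ext x
    simp only [interBodies, mem_inter_iff, mem_iInter, Finset.mem_map, Finset.mem_univ, true_and]
    constructor
    · rintro ⟨hW, h⟩ _ ⟨i, rfl⟩
      exact ⟨hW, h i⟩
    · intro h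
      exact ⟨(h _ ⟨0, rfl⟩).1, fun i => (h _ ⟨i, rfl⟩).2⟩
  have hterm : ∀ k : ℕ, ((-1 : ℝ) ^ k / (k + 1).factorial) •
      ∫ K, ψ (interBodies W K) ∂factorialMeasure (k + 1) F =
      ∑ I ∈ (Finset.univ : Finset F).powersetCard (k + 1),
        (-1 : ℝ) ^ (I.card + 1) • ψ (⋂ K ∈ I, W ∩ ((K : ConvexBody Plane) : Set Plane)) := by
    intro k
    rw [integral_factorialMeasure (hm (k + 1))]
    simp_rw [hinter]
    have h := factorial_smul_sum_powersetCard (k + 1) fun I : Finset F =>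
      ψ (⋂ K ∈ I, W ∩ ((K : ConvexBody Plane) : Set Plane))
    rw [← h, ← Nat.cast_smul_eq_nsmul ℝ, smul_smul, div_mul_cancel₀ _ (by positivity),
      Finset.smul_sum]
    refine Finset.sum_congr rfl fun I hI => ?_
    rw [(Finset.mem_powersetCard.1 hI).2, pow_add, pow_add]
    norm_num
  simp_rw [hterm]
  have hsum : ∑ I ∈ (Finset.univ : Finset F).powerset with I.Nonempty,
      (-1 : ℝ) ^ (I.card + 1) • ψ (⋂ K ∈ I, W ∩ ((K : ConvexBody Plane) : Set Plane)) =
      ∑ k ∈ Finset.range (Finset.univ : Finset F).card,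
        ∑ I ∈ (Finset.univ : Finset F).powersetCard (k + 1),
          (-1 : ℝ) ^ (I.card + 1) • ψ (⋂ K ∈ I, W ∩ ((K : ConvexBody Plane) : Set Plane)) := by
    rw [Finset.sum_filter, Finset.sum_powerset, Finset.sum_range_succ']
    have h0 : ∑ I ∈ (Finset.univ : Finset F).powersetCard 0, (if I.Nonempty then
        (-1 : ℝ) ^ (I.card + 1) • ψ (⋂ K ∈ I, W ∩ ((K : ConvexBody Plane) : Set Plane))
          else 0) = 0 := by
      simp
    rw [h0, add_zero]
    refine Finset.sum_congr rfl fun k _ => Finset.sum_congr rfl fun I hI => ?_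
    rw [if_pos (Finset.card_pos.1 (by rw [(Finset.mem_powersetCard.1 hI).2]; omega))]
  rw [hsum]
  -- Cardinalities larger than that of `F` contribute nothing, so the series is a finite sum.
  refine hasSum_sum_of_ne_finset_zero fun k hk => ?_
  rw [Finset.powersetCard_eq_empty.2, Finset.sum_empty]
  have := Finset.mem_range.not.1 hk
  omega

/-- Expectations are taken term by term: Campbell's theorem gives an integral over independent
bodies, and iteration gives `L^(k+1)`. The interchange is justified by the bound `C θ(univ)^(k+1) /
(k+1)!`. -/
theorem IsIteratedFunctional.integral_inclusionExclusion {Ω E : Type*} [MeasurableSpace Ω]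
    {P : Measure Ω} [NormedAddCommGroup E] [NormedSpace ℝ E] [CompleteSpace E]
    {θ : Measure (ConvexBody Plane)} [IsFiniteMeasure θ] [NullSingletonClass θ] {W : Set Plane}
    {ψ : Set Plane → E} {L : E →L[ℝ] E} (hψ : IsIteratedFunctional θ W ψ L) (hW : Convex ℝ W)
    {F : Ω → Set (ConvexBody Plane)} (hF : HasIndepCounts P F θ) {f : Ω → E}
    (hf : ∀ ω, ∀ _ : Fintype (F ω), f ω = ∑ I ∈ (Finset.univ : Finset (F ω)).powerset with
      I.Nonempty, (-1 : ℝ) ^ (I.card + 1) •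
        ψ (⋂ K ∈ I, W ∩ ((K : ConvexBody Plane) : Set Plane))) :
    Integrable f P ∧
      HasSum (fun k : ℕ => ((-1 : ℝ) ^ k / (k + 1).factorial) • (L ^ (k + 1)) (ψ W))
        (∫ ω, f ω ∂P) := by
  have hi := fun k => hψ.integrable k subset_rfl hψ.isCompact hW
  obtain ⟨C, hC⟩ := hψ.exists_bound
  have h := integrable_and_hasSum_integral (μ := P) (f := f)
    (F := fun (k : ℕ) ω => ((-1 : ℝ) ^ k / (k + 1).factorial) •
      ∫ K, ψ (interBodies W K) ∂factorialMeasure (k + 1) (F ω))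
    (fun k => (hF.integral_factorialMeasure (hi (k + 1))).1.smul _) ?_ ?_
  · refine ⟨h.1, ?_⟩
    have h2 := h.2
    simp_rw [integral_smul, (hF.integral_factorialMeasure (hi _)).2,
      hψ.integral_interBodies _ subset_rfl hψ.isCompact hW] at h2
    exact h2
  · have hsum := ((Real.summable_pow_div_factorial (θ.real univ)).mul_left C)
    have hsum' := (summable_nat_add_iff 1).2 hsum
    refine hsum'.of_nonneg_of_le (fun k => integral_nonneg fun ω => norm_nonneg _) fun k => ?_
    simp_rw [norm_smul]
    rw [integral_const_mul]
    have hn : ‖(-1 : ℝ) ^ k / (k + 1).factorial‖ = 1 / (k + 1).factorial := by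
      rw [norm_div, norm_pow, norm_neg, norm_one, one_pow, Real.norm_natCast]
    have h1 := hF.integral_norm_factorialMeasure (hi (k + 1))
    have h2 : ∫ K : Fin (k + 1) → ConvexBody Plane, ‖ψ (interBodies W K)‖
        ∂(Measure.pi fun _ => θ) ≤ C * (θ.real univ) ^ (k + 1) := by
      have h3 := integral_mono (hi (k + 1)).norm (integrable_const C) fun K =>
        hC _ (interBodies_subset W K) (isCompact_interBodies hψ.isCompact K)
          (convex_interBodies hW K)
      rw [integral_const, Measure.real, Measure.pi_univ, smul_eq_mul, mul_comm] at h3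
      simpa [Measure.real] using h3
    rw [hn, mul_div_assoc']
    calc _ ≤ 1 / ((k + 1).factorial : ℝ) * (C * (θ.real univ) ^ (k + 1)) := by
          gcongr
          exact h1.trans h2
      _ = _ := by ring
  · filter_upwards [hF.ae_finite] with ω hω
    have := hω.fintype
    rw [hf ω this]
    exact hasSum_integral_factorialMeasure fun k => hψ.measurable k W hψ.isCompact hW

/-! ### Densities of the Boolean model -/

/-- The surface tensor together with the area. -/
def tensorArea (s : ℕ) (A : Set Plane) : Tensor s × ℝ := (surfaceTensorSet s A, (volume A).toReal)

/-- The operator `(T, v) ↦ (V T + v T₀, V v)`. -/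
def densityOperator {E : Type*} [NormedAddCommGroup E] [NormedSpace ℝ E] (V : ℝ) (T₀ : E) :
    E × ℝ →L[ℝ] E × ℝ :=
  (V • ContinuousLinearMap.fst ℝ E ℝ + (ContinuousLinearMap.snd ℝ E ℝ).smulRight T₀).prod
    (V • ContinuousLinearMap.snd ℝ E ℝ)

section DensityOperator

variable {E : Type*} [NormedAddCommGroup E] [NormedSpace ℝ E] (V : ℝ) (T₀ : E)

theorem densityOperator_apply (p : E × ℝ) :
    densityOperator V T₀ p = (V • p.1 + p.2 • T₀, V * p.2) := by
  simp [densityOperator]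

theorem densityOperator_pow_apply (k : ℕ) (p : E × ℝ) :
    (densityOperator V T₀ ^ (k + 1)) p =
      (V ^ (k + 1) • p.1 + ((k + 1 : ℝ) * V ^ k * p.2) • T₀, V ^ (k + 1) * p.2) := by
  induction k with
  | zero => simp [densityOperator_apply]
  | succ k ih =>
    rw [pow_succ', mul_apply_eq_comp, ih, densityOperator_apply]
    refine Prod.ext ?_ ?_
    · simp only
      push_cast
      module
    · simp only
      ring

theorem hasSum_one_sub_exp :
    HasSum (fun k : ℕ => (-1 : ℝ) ^ k / (k + 1).factorial * V ^ (k + 1)) (1 - Real.exp (-V)) := by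
  have h := NormedSpace.expSeries_div_hasSum_exp (-V)
  rw [← Real.exp_eq_exp_ℝ] at h
  have h1 := (hasSum_nat_add_iff' 1).2 h
  simp only [Finset.range_one, Finset.sum_singleton, pow_zero, Nat.factorial_zero, Nat.cast_one,
    div_one] at h1
  have h2 := h1.neg
  rw [neg_sub] at h2
  have e : (fun k : ℕ => -((-V) ^ (k + 1) / ((k + 1).factorial : ℝ))) =
      fun k : ℕ => (-1 : ℝ) ^ k / (k + 1).factorial * V ^ (k + 1) := by
    funext k
    rw [neg_pow, pow_succ]
    ring
  rwa [e] at h2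

theorem hasSum_exp_neg :
    HasSum (fun k : ℕ => (-1 : ℝ) ^ k / (k + 1).factorial * ((k + 1 : ℝ) * V ^ k))
      (Real.exp (-V)) := by
  have h := NormedSpace.expSeries_div_hasSum_exp (-V)
  rw [← Real.exp_eq_exp_ℝ] at h
  have e : (fun k : ℕ => (-V) ^ k / (k.factorial : ℝ)) =
      fun k : ℕ => (-1 : ℝ) ^ k / (k + 1).factorial * ((k + 1 : ℝ) * V ^ k) := by
    funext k
    rw [Nat.factorial_succ, neg_pow]
    push_cast
    field_simp
  rwa [e] at h

/-- With this decomposition, `1 - exp(-L) = (1 - exp(-V)) + exp(-V) N`. -/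
theorem hasSum_densityOperator (p : E × ℝ) :
    HasSum (fun k : ℕ => ((-1 : ℝ) ^ k / (k + 1).factorial) • (densityOperator V T₀ ^ (k + 1)) p)
      ((1 - Real.exp (-V)) • p.1 + (Real.exp (-V) * p.2) • T₀, (1 - Real.exp (-V)) * p.2) := by
  have h1 := hasSum_one_sub_exp V
  have h2 := hasSum_exp_neg V
  have h := ((h1.smul_const p.1).add ((h2.mul_right p.2).smul_const T₀)).prodMk (h1.mul_right p.2)
  convert h using 1
  ext1 k
  rw [densityOperator_pow_apply]
  refine Prod.ext ?_ ?_
  · simp only [Prod.smul_fst]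
    module
  · simp only [Prod.smul_snd, smul_eq_mul]
    ring

end DensityOperator

section BooleanModel

variable {Ω : Type*} {γ : ℝ} {Q : Measure (ConvexBody Plane)} {X : Ω → Set (ConvexBody Plane)} {W : Set Plane}

theorem IsSmoothGrainDistribution.isIteratedFunctional (hQ : IsSmoothGrainDistribution Q)
    (hγ : 0 < γ) (s : ℕ) (hW : IsCompact W) :
    IsIteratedFunctional (windowIntensity γ Q W) W (tensorArea s)
      (densityOperator (particleAreaDensity γ Q) (particleSurfaceDensity γ Q s)) where
  isCompact := hW
  exists_bound := by
    refine ⟨max (surfaceConst s * (volume (W + Metric.closedBall (0 : Plane) 1)).toReal)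
      (volume W).toReal, fun A hAW hA hc => ?_⟩
    rw [Prod.norm_def]
    refine max_le_max (norm_surfaceTensorSet_le s hA hc hW hAW) ?_
    simp only [tensorArea]
    rw [Real.norm_of_nonneg ENNReal.toReal_nonneg]
    exact ENNReal.toReal_mono hW.measure_lt_top.ne (measure_mono hAW)
  measurable k A hA hc :=
    (stronglyMeasurable_surfaceTensorSet_interBodies s hA hc).prodMk
      (measurable_volume_interBodies hA).ennreal_toReal.stronglyMeasurable
  integral_inter A hAW hA hc := by
    have := hQ.isFiniteMeasure_windowIntensity (γ := γ) hW
    have hi1 : Integrable (fun K : ConvexBody Plane => surfaceTensorSet s (A ∩ (K : Set Plane)))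
        (windowIntensity γ Q W) :=
      Integrable.of_bound (stronglyMeasurable_surfaceTensorSet_inter s hA hc).aestronglyMeasurable
        _ (.of_forall fun K => norm_surfaceTensorSet_le s (hA.inter_right K.isClosed)
          (hc.inter K.convex) hW (inter_subset_left.trans hAW))
    have hi2 : Integrable (fun K : ConvexBody Plane => (volume (A ∩ (K : Set Plane))).toReal)
        (windowIntensity γ Q W) :=
      Integrable.of_bound (measurable_volume_inter hA).ennreal_toReal.aestronglyMeasurable
        (volume A).toReal (.of_forall fun K => by
          rw [Real.norm_of_nonneg ENNReal.toReal_nonneg]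
          exact ENNReal.toReal_mono hA.measure_lt_top.ne (measure_mono inter_subset_left))
    have h := integral_pair hi1 hi2
    rw [hQ.integral_windowIntensity_surfaceTensor hγ s hW hA hc hAW,
      hQ.integral_windowIntensity_volume hγ hA hAW] at h
    rw [densityOperator_apply]
    exact h

theorem unionSet_inter_eq (ω : Ω) (W : Set Plane) [Fintype ↥(X ω ∩ hitting W)] :
    unionSet X ω ∩ W = ⋃ K ∈ (Finset.univ : Finset ↥(X ω ∩ hitting W)),
      W ∩ ((K : ConvexBody Plane) : Set Plane) := by
  ext x
  simp only [unionSet, mem_inter_iff, mem_iUnion, Finset.mem_univ, exists_prop, true_and]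
  constructor
  · rintro ⟨⟨K, hK, hx⟩, hW⟩
    exact ⟨⟨K, hK, x, hW, hx⟩, hW, hx⟩
  · rintro ⟨K, hW, hx⟩
    exact ⟨⟨K, K.2.1, hx⟩, hW⟩

variable [MeasurableSpace Ω] {P : Measure Ω}

/-- The mean surface tensor and the mean area of a Boolean model in a window. -/
theorem IsSmoothBooleanModel.integral_window (hX : IsSmoothBooleanModel P γ Q X) (s : ℕ)
    (hW : IsCompact W) (hc : Convex ℝ W) :
    (Integrable (fun ω => surfaceTensorPoly s (unionSet X ω ∩ W)) P ∧
      ∫ ω, surfaceTensorPoly s (unionSet X ω ∩ W) ∂P =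
        (1 - Real.exp (-particleAreaDensity γ Q)) • surfaceTensorSet s W +
          (Real.exp (-particleAreaDensity γ Q) * (volume W).toReal) •
            particleSurfaceDensity γ Q s) ∧
    (Integrable (fun ω => (volume (unionSet X ω ∩ W)).toReal) P ∧
      ∫ ω, (volume (unionSet X ω ∩ W)).toReal ∂P =
        (1 - Real.exp (-particleAreaDensity γ Q)) * (volume W).toReal) := by
  have hfun := hX.grains.isIteratedFunctional hX.intensity_pos s hW
  have := hX.grains.isProbability
  have := hX.grains.isFiniteMeasure_windowIntensity (γ := γ) hW
  have : NullSingletonClass (windowIntensity γ Q W) := by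
    unfold windowIntensity
    infer_instance
  have hA : ∀ K : ConvexBody Plane, IsCompact (W ∩ (K : Set Plane)) := fun K =>
    hW.inter_right K.isClosed
  obtain ⟨h1, h2⟩ := hfun.integral_inclusionExclusion hc (hX.hasIndepCounts hW)
    (f := fun ω => (surfaceTensorPoly s (unionSet X ω ∩ W), (volume (unionSet X ω ∩ W)).toReal))
    (fun ω _ => by
      have e1 := surfaceTensorPoly_biUnion s (Finset.univ : Finset ↥(X ω ∩ hitting W))
        (A := fun K => W ∩ ((K : ConvexBody Plane) : Set Plane)) (fun K => hA K)
        fun K => hc.inter K.1.convex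
      have e2 := measureReal_biUnion_eq_sum_powerset (μ := (volume : Measure Plane))
        (t := (Finset.univ : Finset ↥(X ω ∩ hitting W)))
        (s := fun K => W ∩ ((K : ConvexBody Plane) : Set Plane))
        (fun K _ => (hA K).isClosed.measurableSet) (fun K _ => (hA K).measure_lt_top.ne)
      rw [← unionSet_inter_eq] at e1 e2
      rw [e1, ← measureReal_def, e2]
      refine Prod.ext ?_ ?_
      · rw [Prod.fst_sum]
        rfl
      · rw [Prod.snd_sum]
        rfl)
  have h3 := h2.unique (hasSum_densityOperator _ _ _)
  refine ⟨⟨h1.fst, ?_⟩, h1.snd, ?_⟩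
  · have := congrArg Prod.fst h3
    rw [fst_integral h1] at this
    exact this
  · have := congrArg Prod.snd h3
    rw [snd_integral h1] at this
    exact this

theorem supportFun_smul_body (W : ConvexBody Plane) {ϱ : ℝ} (hϱ : 0 < ϱ) (x : Plane) :
    supportFun (ϱ • W) x = ϱ * supportFun W x := by
  apply le_antisymm
  · refine supportFun_le fun y hy => ?_
    obtain ⟨z, hz, rfl⟩ := hy
    simp only [real_inner_smul_right]
    exact mul_le_mul_of_nonneg_left (inner_le_supportFun W x hz) hϱ.le
  · rw [← le_div_iff₀' hϱ]
    refine supportFun_le fun y hy => ?_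
    rw [le_div_iff₀' hϱ, ← real_inner_smul_right]
    exact inner_le_supportFun _ x (smul_mem_smul_set hy)

theorem surfaceTensor_smul (s : ℕ) (W : ConvexBody Plane) {ϱ : ℝ} (hϱ : 0 < ϱ) :
    surfaceTensor s (ϱ • W) = ϱ • surfaceTensor s W := by
  have h : ∀ φ, angularSupport (ϱ • W) φ • surfaceKernel s φ =
      ϱ • angularSupport W φ • surfaceKernel s φ := fun φ => by
    change supportFun (ϱ • W) (unitVec φ) • _ = ϱ • supportFun W (unitVec φ) • _
    rw [supportFun_smul_body W hϱ, mul_smul]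
  rw [surfaceTensor_eq_integral, surfaceTensor_eq_integral]
  simp_rw [h]
  rw [intervalIntegral.integral_smul, smul_comm]

theorem toReal_volume_smul (W : Set Plane) {ϱ : ℝ} (hϱ : 0 < ϱ) :
    (volume (ϱ • W)).toReal = ϱ ^ 2 * (volume W).toReal := by
  rw [Measure.addHaar_smul, ENNReal.toReal_mul, ENNReal.toReal_ofReal (abs_nonneg _)]
  simp [abs_of_pos hϱ]

/-- The tensor of the window grows like `ϱ` and its area like `ϱ²`, so the contribution of the
boundary of the window disappears. -/
theorem IsSmoothBooleanModel.hasSurfaceDensity (hX : IsSmoothBooleanModel P γ Q X) (s : ℕ) :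
    HasSurfaceDensity P (unionSet X) s
      (Real.exp (-particleAreaDensity γ Q) • particleSurfaceDensity γ Q s) := by
  intro W hW
  have hwin : ∀ ϱ : ℝ, _ := fun ϱ => hX.integral_window s (ϱ • W).isCompact (ϱ • W).convex
  refine ⟨fun ϱ _ => (hwin ϱ).1.1, ?_⟩
  have hv : 0 < (volume (W : Set Plane)).toReal := ENNReal.toReal_pos hW.ne' W.volume_lt_top.ne
  set V := particleAreaDensity γ Q
  set v := (volume (W : Set Plane)).toReal
  have h1 : Tendsto (fun ϱ : ℝ => (ϱ⁻¹ * (v⁻¹ * (1 - Real.exp (-V)))) • surfaceTensor s W +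
      Real.exp (-V) • particleSurfaceDensity γ Q s) atTop
      (𝓝 ((0 * (v⁻¹ * (1 - Real.exp (-V)))) • surfaceTensor s W +
        Real.exp (-V) • particleSurfaceDensity γ Q s)) :=
    ((tendsto_inv_atTop_zero.mul_const _).smul_const _).add_const _
  rw [zero_mul, zero_smul, zero_add] at h1
  refine h1.congr' ?_
  filter_upwards [eventually_gt_atTop 0] with ϱ hϱ
  have e := (hwin ϱ).1.2
  rw [ConvexBody.coe_smul] at e
  rw [e, ← ConvexBody.coe_smul, surfaceTensorSet_coe, surfaceTensor_smul s W hϱ,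
    ConvexBody.coe_smul, toReal_volume_smul _ hϱ, smul_add, smul_smul, smul_smul, smul_smul]
  have hv' : (volume (W : Set Plane)).toReal = v := rfl
  rw [hv']
  congr 2
  · field_simp
  · field_simp

theorem IsSmoothBooleanModel.hasAreaDensity (hX : IsSmoothBooleanModel P γ Q X) :
    HasAreaDensity P (unionSet X) (1 - Real.exp (-particleAreaDensity γ Q)) := by
  intro W hW
  have hwin : ∀ ϱ : ℝ, _ := fun ϱ => hX.integral_window 0 (ϱ • W).isCompact (ϱ • W).convex
  refine ⟨fun ϱ _ => (hwin ϱ).2.1, ?_⟩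
  have hv : 0 < (volume (W : Set Plane)).toReal := ENNReal.toReal_pos hW.ne' W.volume_lt_top.ne
  -- There is no boundary term for the area: the quotient is constant in `ϱ`.
  refine tendsto_const_nhds.congr' ?_
  filter_upwards [eventually_gt_atTop 0] with ϱ hϱ
  have e := (hwin ϱ).2.2
  rw [ConvexBody.coe_smul] at e
  rw [e, toReal_volume_smul _ hϱ]
  field_simp

end BooleanModel

/-! ### The mean radius of curvature -/

section Curvature

variable {γ : ℝ} {Q : Measure (ConvexBody Plane)}

theorem IsSmoothGrainDistribution.integrable_supportMeasure_univ
    (hQ : IsSmoothGrainDistribution Q) :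
    Integrable (fun K => 2 * (supportMeasure K univ).toReal) Q := by
  refine ⟨(measurable_supportMeasure_univ.const_mul 2).aestronglyMeasurable, ?_⟩
  rw [HasFiniteIntegral]
  refine lt_of_le_of_lt (lintegral_mono (g := fun K : ConvexBody Plane =>
    volume ((K : Set Plane) + Metric.closedBall (0 : Plane) 1)) fun K => ?_) hQ.integrability
  rw [Real.enorm_of_nonneg (by positivity), ENNReal.ofReal_mul two_pos.le,
    ENNReal.ofReal_toReal (measure_ne_top _ _)]
  simpa using two_mul_supportMeasure_univ_le K

theorem IsC2Plus.curvatureRadius_pos {K : ConvexBody Plane} (hK : IsC2Plus K) (φ : ℝ) :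
    0 < curvatureRadius K (unitVec φ) :=
  hK.2 _ (norm_unitVec φ)

/-- The radius of curvature is positive, so its inner norm integral is the perimeter, which has
finite mean. Finiteness of `g` almost everywhere and its integrability both follow by Fubini's
theorem. -/
theorem IsSmoothGrainDistribution.integrable_curvatureRadius_prod
    (hQ : IsSmoothGrainDistribution Q) :
    Integrable (fun p : ConvexBody Plane × ℝ => curvatureRadius p.1 (unitVec p.2))
      (Q.prod (volume.restrict (Ioc 0 (2 * Real.pi)))) := by
  have := hQ.isProbability
  have hC : ∀ᵐ K ∂Q, IsC2Plus K := hQ.concentrated.mono fun K hK => hK.2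
  refine (integrable_prod_iff (aestronglyMeasurable_curvatureRadius hC _)).2 ⟨?_, ?_⟩
  · filter_upwards [hC] with K hK
    exact hK.continuous_curvatureRadius.integrableOn_Ioc
  · refine hQ.integrable_supportMeasure_univ.congr ?_
    filter_upwards [hC] with K hK
    rw [← hK.integral_curvatureRadius, intervalIntegral.integral_of_le Real.two_pi_pos.le]
    refine integral_congr_ae (.of_forall fun φ => ?_)
    exact (Real.norm_of_nonneg (hK.curvatureRadius_pos φ).le).symm

theorem IsSmoothGrainDistribution.ae_integrable_curvatureRadius
    (hQ : IsSmoothGrainDistribution Q) :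
    ∀ᵐ φ ∂volume.restrict (Icc 0 (2 * Real.pi)),
      Integrable (fun K => curvatureRadius K (unitVec φ)) Q := by
  have := hQ.isProbability
  rw [Measure.restrict_congr_set Ioc_ae_eq_Icc.symm]
  exact hQ.integrable_curvatureRadius_prod.prod_left_ae

theorem IsSmoothGrainDistribution.integrableOn_meanCurvatureRadius
    (hQ : IsSmoothGrainDistribution Q) (γ : ℝ) :
    IntegrableOn (meanCurvatureRadius γ Q) (Icc 0 (2 * Real.pi)) := by
  have := hQ.isProbability
  rw [IntegrableOn, Measure.restrict_congr_set Ioc_ae_eq_Icc.symm]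
  exact hQ.integrable_curvatureRadius_prod.integral_prod_right.const_mul γ

theorem IsSmoothGrainDistribution.intervalIntegrable_meanCurvatureRadius
    (hQ : IsSmoothGrainDistribution Q) (γ : ℝ) :
    IntervalIntegrable (meanCurvatureRadius γ Q) volume 0 (2 * Real.pi) :=
  (intervalIntegrable_iff_integrableOn_Icc_of_le Real.two_pi_pos.le).2
    (hQ.integrableOn_meanCurvatureRadius γ)

theorem IsSmoothGrainDistribution.particleSurfaceDensity_eq
    (hQ : IsSmoothGrainDistribution Q) (γ : ℝ) (s : ℕ) :
    particleSurfaceDensity γ Q s = (surfaceConst s * γ) •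
      ∫ K, (∫ φ in (0 : ℝ)..(2 * Real.pi),
        curvatureRadius K (unitVec φ) • tensorPower s (unitVec φ)) ∂Q := by
  have h : ∀ᵐ K ∂Q, surfaceTensor s K = surfaceConst s • ∫ φ in (0 : ℝ)..(2 * Real.pi),
      curvatureRadius K (unitVec φ) • tensorPower s (unitVec φ) :=
    hQ.concentrated.mono fun K hK => hK.2.surfaceTensor_eq s
  rw [particleSurfaceDensity, integral_congr_ae h, integral_smul, smul_smul, mul_comm]

theorem integrable_smul_of_norm_le_one {α E : Type*} [MeasurableSpace α] [NormedAddCommGroup E]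
    [NormedSpace ℝ E] {μ : Measure α} {f : α → ℝ} {T : α → E} (hf : Integrable f μ)
    (hT : AEStronglyMeasurable T μ) (h1 : ∀ a, ‖T a‖ ≤ 1) : Integrable (fun a => f a • T a) μ := by
  refine hf.norm.mono' (hf.1.smul hT) (.of_forall fun a => ?_)
  rw [norm_smul]
  exact mul_le_of_le_one_right (norm_nonneg _) (h1 a)

theorem continuous_tensorPower_unitVec (s : ℕ) : Continuous fun φ => tensorPower s (unitVec φ) :=
  (continuous_tensorPower s).comp continuous_unitVec

theorem IsSmoothGrainDistribution.particleSurfaceDensity_eq_integral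
    (hQ : IsSmoothGrainDistribution Q) (γ : ℝ) (s : ℕ) :
    particleSurfaceDensity γ Q s = surfaceConst s •
      ∫ φ in (0 : ℝ)..(2 * Real.pi),
        meanCurvatureRadius γ Q φ • tensorPower s (unitVec φ) := by
  have := hQ.isProbability
  rw [hQ.particleSurfaceDensity_eq, mul_smul]
  congr 1
  simp_rw [intervalIntegral.integral_of_le Real.two_pi_pos.le]
  have hI : Integrable (Function.uncurry fun (K : ConvexBody Plane) (φ : ℝ) =>
      curvatureRadius K (unitVec φ) • tensorPower s (unitVec φ))
      (Q.prod (volume.restrict (Ioc 0 (2 * Real.pi)))) :=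
    integrable_smul_of_norm_le_one (T := fun p : ConvexBody Plane × ℝ => tensorPower s (unitVec p.2))
      hQ.integrable_curvatureRadius_prod
      ((continuous_tensorPower_unitVec s).comp continuous_snd).aestronglyMeasurable
      fun p => norm_tensorPower_le s (norm_unitVec p.2)
  rw [integral_integral_swap hI, ← integral_smul]
  refine integral_congr_ae (.of_forall fun φ => ?_)
  simp only [meanCurvatureRadius]
  rw [integral_smul_const, smul_smul]

/-! ### Fourier coefficients -/

theorem prod_ite_lt {s j : ℕ} (hj : j ≤ s) (a b : ℝ) :
    ∏ i : Fin s, (if (i : ℕ) < j then a else b) = a ^ j * b ^ (s - j) := by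
  rw [Fin.prod_univ_eq_prod_range (fun i => if i < j then a else b) s,
    ← Finset.prod_range_mul_prod_Ico _ hj]
  congr 1
  · rw [Finset.prod_congr rfl fun i hi => if_pos (Finset.mem_range.1 hi), Finset.prod_const,
      Finset.card_range]
  · rw [Finset.prod_congr rfl fun i hi => if_neg (not_lt.2 (Finset.mem_Ico.1 hi).1),
      Finset.prod_const, Nat.card_Ico]

theorem coord_tensorPower_unitVec {s j : ℕ} (hj : j ≤ s) (φ : ℝ) :
    (tensorPower s (unitVec φ)).coord j = Real.cos φ ^ j * Real.sin φ ^ (s - j) := by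
  rw [Tensor.coord, tensorPower_apply, ← prod_ite_lt hj]
  refine Finset.prod_congr rfl fun i _ => ?_
  split_ifs <;> simp [inner_plane, unitVec]

theorem IsSmoothGrainDistribution.coord_particleSurfaceDensity
    (hQ : IsSmoothGrainDistribution Q) (γ : ℝ) {s j : ℕ} (hj : j ≤ s) :
    (particleSurfaceDensity γ Q s).coord j = surfaceConst s *
      ∫ φ in (0 : ℝ)..(2 * Real.pi),
        meanCurvatureRadius γ Q φ * (Real.cos φ ^ j * Real.sin φ ^ (s - j)) := by
  let m : Fin s → Plane := fun i =>
    if (i : ℕ) < j then EuclideanSpace.single 0 1 else EuclideanSpace.single 1 1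
  let A := ContinuousMultilinearMap.apply ℝ (fun _ : Fin s => Plane) ℝ m
  have hI : IntervalIntegrable (fun φ => meanCurvatureRadius γ Q φ • tensorPower s (unitVec φ))
      volume 0 (2 * Real.pi) := by
    rw [intervalIntegrable_iff]
    exact integrable_smul_of_norm_le_one
      (intervalIntegrable_iff.1 (hQ.intervalIntegrable_meanCurvatureRadius γ))
      (continuous_tensorPower_unitVec s).aestronglyMeasurable
      fun φ => norm_tensorPower_le s (norm_unitVec φ)
  have h1 := A.intervalIntegral_comp_comm hI
  rw [hQ.particleSurfaceDensity_eq_integral]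
  have h2 : ∀ T : Tensor s, (surfaceConst s • T).coord j = surfaceConst s * A T := fun T => rfl
  rw [h2, ← h1]
  congr 1
  refine intervalIntegral.integral_congr fun φ _ => ?_
  rw [← coord_tensorPower_unitVec hj]
  rfl

theorem meanCurvatureCoeff_eq (γ : ℝ) (Q : Measure (ConvexBody Plane)) (n : ℤ) :
    meanCurvatureCoeff γ Q n = (1 / (2 * Real.pi) : ℝ) •
      ∫ φ in (0 : ℝ)..(2 * Real.pi),
        Complex.exp (-(Complex.I * n * φ)) * (meanCurvatureRadius γ Q φ : ℂ) := by
  rw [meanCurvatureCoeff, fourierCoeffOn_eq_integral, sub_zero]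
  congr 1
  refine intervalIntegral.integral_congr fun φ _ => ?_
  simp only [fourier_coe_apply, smul_eq_mul]
  congr 2
  have := Real.pi_ne_zero
  push_cast
  field_simp

/-- The binomial expansion of `(cos φ + c sin φ)^s`, for both signs at once. -/
theorem exp_eq_sum (s : ℕ) (φ : ℝ) {c : ℂ} (hc : c = Complex.I ∨ c = -Complex.I) :
    Complex.exp (c * s * φ) = ∑ j ∈ Finset.range (s + 1), (s.choose j : ℂ) * c ^ (s - j) *
      ((Real.cos φ ^ j * Real.sin φ ^ (s - j) : ℝ) : ℂ) := by
  have h1 : Complex.exp (c * φ) = Complex.cos φ + c * Complex.sin φ := by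
    rcases hc with rfl | rfl
    · rw [mul_comm, Complex.exp_mul_I]
      ring
    · rw [show -Complex.I * φ = (-φ : ℂ) * Complex.I by ring, Complex.exp_mul_I, Complex.cos_neg,
        Complex.sin_neg]
      ring
  rw [show c * s * φ = (s : ℂ) * (c * φ) by ring, Complex.exp_nat_mul, h1, add_pow]
  refine Finset.sum_congr rfl fun j _ => ?_
  push_cast
  rw [mul_pow]
  ring

theorem IsSmoothGrainDistribution.integral_exp_mul_meanCurvatureRadius
    (hQ : IsSmoothGrainDistribution Q) (γ : ℝ) (s : ℕ) {c : ℂ}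
    (hc : c = Complex.I ∨ c = -Complex.I) :
    (1 / (2 * Real.pi) : ℝ) • ∫ φ in (0 : ℝ)..(2 * Real.pi),
        Complex.exp (c * s * φ) * (meanCurvatureRadius γ Q φ : ℂ) =
      ∑ j ∈ Finset.range (s + 1), (s.choose j : ℂ) * c ^ (s - j) *
        (((s.factorial : ℝ) * sphereArea (1 + s) / (2 * Real.pi) : ℝ) : ℂ) *
        ((particleSurfaceDensity γ Q s).coord j : ℂ) := by
  have hg := hQ.intervalIntegrable_meanCurvatureRadius γ
  have hterm : ∀ j, IntervalIntegrable (fun φ => meanCurvatureRadius γ Q φ *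
      (Real.cos φ ^ j * Real.sin φ ^ (s - j))) volume 0 (2 * Real.pi) := fun j =>
    hg.mul_continuousOn (by fun_prop)
  have hofReal : ∀ j, IntervalIntegrable (fun φ => ((meanCurvatureRadius γ Q φ *
      (Real.cos φ ^ j * Real.sin φ ^ (s - j)) : ℝ) : ℂ)) volume 0 (2 * Real.pi) := fun j =>
    intervalIntegrable_iff.2 (intervalIntegrable_iff.1 (hterm j)).ofReal
  have e : ∀ φ : ℝ, Complex.exp (c * s * φ) * (meanCurvatureRadius γ Q φ : ℂ) =
      ∑ j ∈ Finset.range (s + 1), ((s.choose j : ℂ) * c ^ (s - j)) *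
        ((meanCurvatureRadius γ Q φ * (Real.cos φ ^ j * Real.sin φ ^ (s - j)) : ℝ) : ℂ) := by
    intro φ
    rw [exp_eq_sum s φ hc, Finset.sum_mul]
    refine Finset.sum_congr rfl fun j _ => ?_
    push_cast
    ring
  simp_rw [e]
  rw [intervalIntegral.integral_finsetSum fun j _ => (hofReal j).const_mul _,
    Finset.smul_sum]
  refine Finset.sum_congr rfl fun j hj => ?_
  rw [intervalIntegral.integral_const_mul, intervalIntegral.integral_ofReal,
    hQ.coord_particleSurfaceDensity γ (Finset.mem_range_succ_iff.1 hj), surfaceConst]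
  have h1 := (sphereArea_pos s).ne'
  have h1' : (sphereArea (1 + s) : ℂ) ≠ 0 := by exact_mod_cast h1
  have h2 : (s.factorial : ℂ) ≠ 0 := by exact_mod_cast s.factorial_ne_zero
  have h3 : (Real.pi : ℂ) ≠ 0 := by exact_mod_cast Real.pi_ne_zero
  rw [Complex.real_smul]
  push_cast
  field_simp

theorem IsSmoothGrainDistribution.meanCurvatureCoeff_natCast
    (hQ : IsSmoothGrainDistribution Q) (γ : ℝ) (s : ℕ) :
    meanCurvatureCoeff γ Q s =
      ∑ j ∈ Finset.range (s + 1), (s.choose j : ℂ) * (-Complex.I) ^ (s - j) *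
        (((s.factorial : ℝ) * sphereArea (1 + s) / (2 * Real.pi) : ℝ) : ℂ) *
        ((particleSurfaceDensity γ Q s).coord j : ℂ) := by
  rw [← hQ.integral_exp_mul_meanCurvatureRadius γ s (Or.inr rfl), meanCurvatureCoeff_eq]
  congr 1
  refine intervalIntegral.integral_congr fun φ _ => ?_
  congr 2
  push_cast
  ring

theorem IsSmoothGrainDistribution.meanCurvatureCoeff_neg_natCast
    (hQ : IsSmoothGrainDistribution Q) (γ : ℝ) (s : ℕ) :
    meanCurvatureCoeff γ Q (-(s : ℤ)) =
      ∑ j ∈ Finset.range (s + 1), (s.choose j : ℂ) * Complex.I ^ (s - j) *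
        (((s.factorial : ℝ) * sphereArea (1 + s) / (2 * Real.pi) : ℝ) : ℂ) *
        ((particleSurfaceDensity γ Q s).coord j : ℂ) := by
  rw [← hQ.integral_exp_mul_meanCurvatureRadius γ s (Or.inl rfl), meanCurvatureCoeff_eq]
  congr 1
  refine intervalIntegral.integral_congr fun φ _ => ?_
  congr 2
  push_cast
  ring

end Curvature

/-! ### Fejér summation of Fourier series -/

/-- The powers are grouped as the cross terms that arise when both factors in
`sum_Icc_sub_abs_mul_zpow` receive one more summand. -/
theorem sum_Icc_zpow {z : ℂ} (hz : z ≠ 0) (N : ℕ) :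
    ∑ n ∈ Finset.Icc (-(N : ℤ)) N, z ^ n =
      z ^ N * ∑ k ∈ Finset.range N, z⁻¹ ^ k + z⁻¹ ^ N * ∑ k ∈ Finset.range N, z ^ k + 1 := by
  induction N with
  | zero => simp
  | succ N ih =>
    rw [Nat.cast_add, Nat.cast_one, Finset.Icc_succ_succ, Finset.sum_union (by simp),
      Finset.sum_pair (by lia), ih, Finset.sum_range_succ' (fun k => z⁻¹ ^ k),
      Finset.sum_range_succ' (fun k => z ^ k), zpow_neg]
    have h1 : z ^ ((N : ℤ) + 1) = z ^ N * z := by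
      rw [← Nat.cast_one, ← Nat.cast_add, zpow_natCast, pow_succ]
    rw [h1]
    simp only [pow_succ, ← Finset.sum_mul, pow_zero, inv_pow]
    field_simp
    ring

/-- Exactly `N + 1 - |n|` pairs of exponents have difference `n`. -/
theorem sum_Icc_sub_abs_mul_zpow {z : ℂ} (hz : z ≠ 0) (N : ℕ) :
    ∑ n ∈ Finset.Icc (-(N : ℤ)) N, ((N : ℂ) + 1 - ((|n| : ℤ) : ℂ)) * z ^ n =
      (∑ k ∈ Finset.range (N + 1), z ^ k) * ∑ k ∈ Finset.range (N + 1), z⁻¹ ^ k := by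
  induction N with
  | zero => simp
  | succ N ih =>
    have h0 := sum_Icc_zpow hz (N + 1)
    have h1 : ∀ n : ℤ, (((N + 1 : ℕ) : ℂ) + 1 - ((|n| : ℤ) : ℂ)) * z ^ n =
        ((N : ℂ) + 1 - ((|n| : ℤ) : ℂ)) * z ^ n + z ^ n := fun n => by push_cast; ring
    simp_rw [h1]
    rw [Finset.sum_add_distrib, h0, Nat.cast_add, Nat.cast_one, Finset.Icc_succ_succ,
      Finset.sum_union (by simp), Finset.sum_pair (by lia), ih,
      Finset.sum_range_succ _ (N + 1), Finset.sum_range_succ _ (N + 1)]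
    have h2 : (|(N : ℤ) + 1| : ℤ) = N + 1 := abs_of_nonneg (by positivity)
    have h3 : z ^ (N + 1) * z⁻¹ ^ (N + 1) = 1 := by rw [← mul_pow, mul_inv_cancel₀ hz, one_pow]
    rw [abs_neg, h2]
    push_cast
    linear_combination -h3

/-- The Fejér kernel. -/
def fejerKernel (N : ℕ) (t : ℝ) : ℂ :=
  ∑ n ∈ Finset.Icc (-(N : ℤ)) N,
    (1 - ((|n| : ℤ) : ℂ) / ((N : ℂ) + 1)) * Complex.exp (Complex.I * n * t)

theorem continuous_fejerKernel (N : ℕ) : Continuous (fejerKernel N) := by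
  unfold fejerKernel
  fun_prop

theorem exp_I_mul_int_mul (n : ℤ) (t : ℝ) :
    Complex.exp (Complex.I * n * t) = Complex.exp (Complex.I * t) ^ n := by
  rw [← Complex.exp_int_mul]
  ring_nf

theorem norm_exp_I_mul (t : ℝ) : ‖Complex.exp (Complex.I * t)‖ = 1 := by
  rw [mul_comm, Complex.norm_exp_ofReal_mul_I]

/-- On the unit circle `z⁻¹` is the conjugate of `z`, so the two geometric sums have equal norm. -/
theorem norm_fejerKernel (N : ℕ) (t : ℝ) :
    ‖fejerKernel N t‖ =
      ‖∑ k ∈ Finset.range (N + 1), Complex.exp (Complex.I * t) ^ k‖ ^ 2 / ((N : ℝ) + 1) := by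
  set z := Complex.exp (Complex.I * t) with hzdef
  have hz : z ≠ 0 := Complex.exp_ne_zero _
  have hN : ((N : ℂ) + 1) ≠ 0 := by exact_mod_cast N.succ_ne_zero
  have h1 : fejerKernel N t = (∑ k ∈ Finset.range (N + 1), z ^ k) *
      (∑ k ∈ Finset.range (N + 1), z⁻¹ ^ k) / ((N : ℂ) + 1) := by
    rw [← sum_Icc_sub_abs_mul_zpow hz, Finset.sum_div]
    refine Finset.sum_congr rfl fun n _ => ?_
    rw [exp_I_mul_int_mul, ← hzdef]
    field_simp
  have h2 : ‖∑ k ∈ Finset.range (N + 1), z⁻¹ ^ k‖ = ‖∑ k ∈ Finset.range (N + 1), z ^ k‖ := by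
    have h3 : z⁻¹ = starRingEnd ℂ z := Complex.inv_eq_conj (norm_exp_I_mul t)
    rw [h3, ← Complex.norm_conj (∑ k ∈ Finset.range (N + 1), z ^ k), map_sum]
    simp_rw [map_pow]
  rw [h1, norm_div, norm_mul, h2, ← sq]
  congr 1
  exact_mod_cast Complex.norm_natCast (N + 1)

theorem norm_fejerKernel_le (N : ℕ) (t : ℝ) : ‖fejerKernel N t‖ ≤ (N : ℝ) + 1 := by
  have hN : (0 : ℝ) < N + 1 := by positivity
  have h : ‖∑ k ∈ Finset.range (N + 1), Complex.exp (Complex.I * t) ^ k‖ ≤ (N : ℝ) + 1 := by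
    refine (norm_sum_le _ _).trans ?_
    simp [norm_pow]
  rw [norm_fejerKernel, div_le_iff₀ hN, sq]
  gcongr

/-- The geometric sum times `z - 1` is `z^(N+1) - 1`, of norm at most two, and `‖z - 1‖ = 2
|sin(t/2)|`. -/
theorem norm_fejerKernel_mul_sin_sq_le (N : ℕ) (t : ℝ) :
    ‖fejerKernel N t‖ * Real.sin (t / 2) ^ 2 ≤ 1 / ((N : ℝ) + 1) := by
  have hN : (0 : ℝ) < N + 1 := by positivity
  rw [norm_fejerKernel, div_mul_eq_mul_div]
  gcongr
  set z := Complex.exp (Complex.I * t) with hz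
  have h1 := Complex.norm_exp_I_mul_ofReal_sub_one t
  have h2 : ‖∑ k ∈ Finset.range (N + 1), z ^ k‖ * ‖z - 1‖ ≤ 2 := by
    rw [← norm_mul, geom_sum_mul]
    refine (norm_sub_le _ _).trans ?_
    rw [norm_pow, hz, norm_exp_I_mul]
    norm_num
  rw [← hz, Real.norm_eq_abs, abs_mul, abs_two] at h1
  rw [h1] at h2
  rw [← sq_abs (Real.sin _), ← mul_pow]
  refine pow_le_one₀ (by positivity) ?_
  linarith

/-- Jordan's inequality gives `|sin(t/2)| ≥ |t|/π`. -/
theorem norm_fejerKernel_le_div_sq (N : ℕ) {t : ℝ} (ht0 : t ≠ 0) (ht : |t| ≤ Real.pi) :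
    ‖fejerKernel N t‖ ≤ Real.pi ^ 2 / (((N : ℝ) + 1) * t ^ 2) := by
  have hN : (0 : ℝ) < N + 1 := by positivity
  have hpi := Real.pi_pos
  have h1 := norm_fejerKernel_mul_sin_sq_le N t
  have h2 : |t| / Real.pi ≤ |Real.sin (t / 2)| := by
    have h3 : |t / 2| = |t| / 2 := by rw [abs_div, abs_two]
    have h4 := Real.mul_le_sin (abs_nonneg (t / 2)) (by rw [h3]; linarith)
    rw [Real.abs_sin_eq_sin_abs_of_abs_le_pi (by rw [h3]; linarith)]
    refine le_trans (le_of_eq ?_) h4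
    rw [h3]; field_simp
  have h5 : t ^ 2 / Real.pi ^ 2 ≤ Real.sin (t / 2) ^ 2 := by
    rw [← sq_abs t, ← sq_abs (Real.sin _), ← div_pow]
    gcongr
  have h6 : ‖fejerKernel N t‖ * (t ^ 2 / Real.pi ^ 2) ≤ 1 / ((N : ℝ) + 1) :=
    (mul_le_mul_of_nonneg_left h5 (norm_nonneg _)).trans h1
  have ht2 : 0 < t ^ 2 := by positivity
  rw [le_div_iff₀ (by positivity)]
  rw [mul_div_assoc', div_le_div_iff₀ (by positivity) hN] at h6
  linarith

theorem integral_exp_I_mul_int_sub (n : ℤ) (x : ℝ) :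
    ∫ ψ in (0 : ℝ)..(2 * Real.pi), Complex.exp (Complex.I * n * ((x - ψ : ℝ) : ℂ)) =
      if n = 0 then ((2 * Real.pi : ℝ) : ℂ) else 0 := by
  split_ifs with hn
  · simp [hn]
  · have h0 : -(Complex.I * n) ≠ 0 := by simp [hn]
    have h1 : ∀ ψ : ℝ, Complex.exp (Complex.I * n * ((x - ψ : ℝ) : ℂ)) =
        Complex.exp (Complex.I * n * x) * Complex.exp (-(Complex.I * n) * ψ) := fun ψ => by
      rw [← Complex.exp_add]
      push_cast
      ring_nf
    simp_rw [h1]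
    rw [intervalIntegral.integral_const_mul, integral_exp_mul_complex h0]
    have h2 : -(Complex.I * n) * ((2 * Real.pi : ℝ) : ℂ) = ((-n : ℤ) : ℂ) * (2 * Real.pi * Complex.I) := by
      push_cast; ring
    rw [h2, Complex.exp_int_mul_two_pi_mul_I]
    simp

theorem integral_fejerKernel (N : ℕ) (x : ℝ) :
    ∫ ψ in (0 : ℝ)..(2 * Real.pi), fejerKernel N (x - ψ) = ((2 * Real.pi : ℝ) : ℂ) := by
  simp only [fejerKernel]
  rw [intervalIntegral.integral_finsetSum]
  · simp_rw [intervalIntegral.integral_const_mul, integral_exp_I_mul_int_sub]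
    simp
  · intro n _
    refine Continuous.intervalIntegrable ?_ _ _
    fun_prop

/-! ### Fejér means at Lebesgue points. -/

/-- A kernel with the decay of the Fejér kernel is bounded by a combination of indicators of
dyadic balls. -/
theorem kernel_le_sum_indicator {k : ℝ → ℝ} {x δ M B : ℝ} (hM : 0 < M) (hB : 0 ≤ B)
    (hkM : ∀ y, k y ≤ B * M)
    (hkB : ∀ y, y ≠ x → |y - x| ≤ δ → k y ≤ B / (M * (y - x) ^ 2))
    {n : ℕ} (hn : M * δ < 2 ^ (n + 1)) {y : ℝ} (hy : |y - x| ≤ δ) :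
    k y ≤ ∑ i ∈ Finset.range (n + 2),
      (Metric.closedBall x (2 ^ i / M)).indicator (fun _ => 4 * B * M * (1 / 4) ^ i) y := by
  have hnn : ∀ i ∈ Finset.range (n + 2), 0 ≤
      (Metric.closedBall x (2 ^ i / M)).indicator (fun _ => 4 * B * M * (1 / 4) ^ i) y :=
    fun i _ => indicator_nonneg (fun _ _ => by positivity) _
  have key : ∀ i ∈ Finset.range (n + 2), M * |y - x| ≤ 2 ^ i → k y ≤ 4 * B * M * (1 / 4) ^ i →
      k y ≤ ∑ i ∈ Finset.range (n + 2),
        (Metric.closedBall x (2 ^ i / M)).indicator (fun _ => 4 * B * M * (1 / 4) ^ i) y := by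
    intro i hi h1 h2
    refine le_trans ?_ (Finset.single_le_sum hnn hi)
    rw [indicator_of_mem]
    · exact h2
    · rw [Metric.mem_closedBall, Real.dist_eq, le_div_iff₀ hM]
      linarith
  by_cases h1 : M * |y - x| ≤ 1
  · refine key 0 (by simp) (by simpa using h1) ?_
    have := hkM y
    have : 0 ≤ B * M := by positivity
    simp only [pow_zero]
    linarith
  -- In the shell `2^m ≤ M |y - x| < 2^(m+1)` the decay gives `B M / 4^m`, which is the weight of
  -- the ball with index `m + 1`.
  · obtain ⟨m, hm1, hm2⟩ := exists_nat_pow_near (not_le.1 h1).le one_lt_two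
    have hmn : m < n + 1 := by
      have h2 : (2 : ℝ) ^ m < 2 ^ (n + 1) :=
        hm1.trans_lt ((mul_le_mul_of_nonneg_left hy hM.le).trans_lt hn)
      exact (pow_lt_pow_iff_right₀ one_lt_two).1 h2
    refine key (m + 1) (by simp; lia) hm2.le ?_
    have hyx : y ≠ x := by
      rintro rfl
      simp at h1
    refine (hkB y hyx hy).trans ?_
    have ht : 0 < (y - x) ^ 2 := by
      have : y - x ≠ 0 := sub_ne_zero.2 hyx
      positivity
    have h3 : (4 : ℝ) ^ m ≤ M ^ 2 * (y - x) ^ 2 := by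
      rw [← sq_abs (y - x), ← mul_pow, show (4 : ℝ) = 2 ^ 2 by norm_num, ← pow_mul, mul_comm 2 m,
        pow_mul]
      gcongr
    have h4 : 4 * B * M * (1 / 4) ^ (m + 1) = B * M / 4 ^ m := by
      rw [pow_succ, one_div, inv_pow]
      field_simp
    rw [h4, div_le_div_iff₀ (by positivity) (by positivity)]
    calc B * 4 ^ m ≤ B * (M ^ 2 * (y - x) ^ 2) := by gcongr
      _ = B * M * (M * (y - x) ^ 2) := by ring

/-- The ball of radius `2^i / M` contributes at most `4 B M 4^(-i) · ε 2^i / M = 4 B ε 2^(-i)`, and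
the geometric series sums to `8 B ε`. The last ball may exceed `δ`, but not `2δ`, hence the range of
radii in `hε`. -/
theorem setIntegral_mul_kernel_le {h k : ℝ → ℝ} {x δ ε M B : ℝ}
    (hh : LocallyIntegrable h) (hh0 : ∀ y, 0 ≤ h y) (hk : Continuous k)
    (hM : 0 < M) (hMδ : 1 ≤ M * δ) (hB : 0 ≤ B)
    (hkM : ∀ y, k y ≤ B * M)
    (hkB : ∀ y, y ≠ x → |y - x| ≤ δ → k y ≤ B / (M * (y - x) ^ 2))
    (hε : ∀ r, 0 < r → r ≤ 2 * δ → ∫ y in Metric.closedBall x r, h y ≤ ε * r) :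
    ∫ y in Metric.closedBall x δ, h y * k y ≤ 8 * B * ε := by
  have hδ : 0 < δ := by
    by_contra hc
    have := mul_nonpos_of_nonneg_of_nonpos hM.le (not_lt.1 hc)
    linarith
  have hε0 : 0 ≤ ε := by
    have h1 := (setIntegral_nonneg (Metric.isClosed_closedBall (x := x) (ε := δ)).measurableSet
      fun y _ => hh0 y).trans (hε δ hδ (by linarith))
    exact nonneg_of_mul_nonneg_left h1 hδ
  obtain ⟨n, hn1, hn2⟩ := exists_nat_pow_near hMδ one_lt_two
  have hball : ∀ r : ℝ, IntegrableOn h (Metric.closedBall x r) := fun r =>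
    hh.integrableOn_isCompact (isCompact_closedBall x r)
  have hint : ∀ i : ℕ, Integrable (fun y => h y *
      (Metric.closedBall x (2 ^ i / M)).indicator (fun _ => 4 * B * M * (1 / 4) ^ i) y) := by
    intro i
    have : (fun y => h y *
      (Metric.closedBall x (2 ^ i / M)).indicator (fun _ => 4 * B * M * (1 / 4) ^ i) y) =
      (Metric.closedBall x (2 ^ i / M)).indicator (fun y => h y * (4 * B * M * (1 / 4) ^ i)) := by
      funext y
      by_cases hy : y ∈ Metric.closedBall x (2 ^ i / M) <;> simp [hy]
    rw [this]
    refine IntegrableOn.integrable_indicator ?_ Metric.isClosed_closedBall.measurableSet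
    exact Integrable.mul_const (hball _) _
  have hsum : Integrable (fun y => ∑ i ∈ Finset.range (n + 2), h y *
      (Metric.closedBall x (2 ^ i / M)).indicator (fun _ => 4 * B * M * (1 / 4) ^ i) y) :=
    integrable_finsetSum _ fun i _ => hint i
  calc ∫ y in Metric.closedBall x δ, h y * k y
      ≤ ∫ y in Metric.closedBall x δ, ∑ i ∈ Finset.range (n + 2), h y *
          (Metric.closedBall x (2 ^ i / M)).indicator (fun _ => 4 * B * M * (1 / 4) ^ i) y := by
        refine setIntegral_mono_on ?_ hsum.integrableOn
          Metric.isClosed_closedBall.measurableSet fun y hy => ?_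
        · exact (hball δ).mul_continuousOn hk.continuousOn (isCompact_closedBall x δ)
        · rw [← Finset.mul_sum]
          refine mul_le_mul_of_nonneg_left ?_ (hh0 y)
          exact kernel_le_sum_indicator hM hB hkM hkB hn2 (by simpa [Real.dist_eq] using hy)
    _ ≤ ∫ y, ∑ i ∈ Finset.range (n + 2), h y *
          (Metric.closedBall x (2 ^ i / M)).indicator (fun _ => 4 * B * M * (1 / 4) ^ i) y := by
        refine setIntegral_le_integral hsum (Eventually.of_forall fun y => ?_)
        exact Finset.sum_nonneg fun i _ => mul_nonneg (hh0 y)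
          (indicator_nonneg (fun _ _ => by positivity) _)
    _ = ∑ i ∈ Finset.range (n + 2), 4 * B * M * (1 / 4) ^ i *
          ∫ y in Metric.closedBall x (2 ^ i / M), h y := by
        rw [integral_finsetSum _ fun i _ => hint i]
        refine Finset.sum_congr rfl fun i _ => ?_
        rw [← integral_const_mul, ← integral_indicator Metric.isClosed_closedBall.measurableSet]
        refine integral_congr_ae (Eventually.of_forall fun y => ?_)
        by_cases hy : y ∈ Metric.closedBall x (2 ^ i / M) <;> simp [hy, mul_comm]
    _ ≤ ∑ i ∈ Finset.range (n + 2), 4 * B * ε * (1 / 2) ^ i := by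
        refine Finset.sum_le_sum fun i hi => ?_
        have h1 : (2 : ℝ) ^ i / M ≤ 2 * δ := by
          rw [div_le_iff₀ hM]
          have h2 : (2 : ℝ) ^ i ≤ 2 ^ (n + 1) :=
            pow_le_pow_right₀ one_le_two (by have := Finset.mem_range.1 hi; lia)
          rw [pow_succ] at h2
          nlinarith
        refine (mul_le_mul_of_nonneg_left (hε _ (by positivity) h1) (by positivity)).trans
          (le_of_eq ?_)
        have h3 : (1 / 4 : ℝ) ^ i * 2 ^ i = (1 / 2) ^ i := by
          rw [← mul_pow]; norm_num
        rw [← h3]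
        field_simp
    _ ≤ 8 * B * ε := by
        rw [← Finset.mul_sum]
        have h1 : ∑ i ∈ Finset.range (n + 2), (1 / 2 : ℝ) ^ i ≤ 2 := sum_geometric_two_le _
        have h2 : 0 ≤ 4 * B * ε := by positivity
        nlinarith

theorem norm_fejerKernel_le_of_far (N : ℕ) {δ t : ℝ} (hδ : 0 < δ) (h1 : δ ≤ |t|)
    (h2 : |t| ≤ 2 * Real.pi - δ) :
    ‖fejerKernel N t‖ ≤ 1 / Real.sin (δ / 2) ^ 2 / ((N : ℝ) + 1) := by
  have hδπ : δ ≤ Real.pi := by linarith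
  have hs : 0 < Real.sin (δ / 2) := Real.sin_pos_of_pos_of_lt_pi (by linarith) (by linarith)
  have h3 : Real.sin (δ / 2) ≤ |Real.sin (t / 2)| := by
    have h4 : |t / 2| = |t| / 2 := by rw [abs_div, abs_two]
    rw [Real.abs_sin_eq_sin_abs_of_abs_le_pi (by rw [h4]; linarith), h4]
    rcases le_total (|t| / 2) (Real.pi / 2) with h | h
    · exact Real.sin_le_sin_of_le_of_le_pi_div_two (by linarith) h (by linarith)
    · rw [← Real.sin_pi_sub (|t| / 2)]
      exact Real.sin_le_sin_of_le_of_le_pi_div_two (by linarith) (by linarith) (by linarith)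
  have h5 : Real.sin (δ / 2) ^ 2 ≤ Real.sin (t / 2) ^ 2 := by
    rw [← sq_abs (Real.sin (t / 2))]
    gcongr
  have h6 := (mul_le_mul_of_nonneg_left h5 (norm_nonneg _)).trans
    (norm_fejerKernel_mul_sin_sq_le N t)
  rw [div_right_comm, le_div_iff₀ (by positivity)]
  exact h6

/-- Near `x` the dyadic estimate applies with `M = N + 1` and `B = π²`; at distance at least `δ` the
kernel is `O(1/N)`. Since `x` is `δ`-far from both endpoints, `x - y` also keeps distance `δ` from
`±2π`. -/
theorem setIntegral_mul_fejerKernel_le {h : ℝ → ℝ} (hh : LocallyIntegrable h)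
    (hh0 : ∀ y, 0 ≤ h y) {x δ ε : ℝ} (hδ : 0 < δ) (hδx : δ ≤ x) (hδx' : x ≤ 2 * Real.pi - δ)
    (hε : ∀ r, 0 < r → r ≤ 2 * δ → ∫ y in Metric.closedBall x r, h y ≤ ε * r)
    {N : ℕ} (hN : 1 ≤ ((N : ℝ) + 1) * δ) :
    ∫ y in Icc 0 (2 * Real.pi), h y * ‖fejerKernel N (x - y)‖ ≤
      8 * Real.pi ^ 2 * ε + (∫ y in Icc 0 (2 * Real.pi), h y) * (1 / Real.sin (δ / 2) ^ 2) /
        ((N : ℝ) + 1) := by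
  have hkc : Continuous fun y => ‖fejerKernel N (x - y)‖ :=
    ((continuous_fejerKernel N).comp (continuous_const.sub continuous_id)).norm
  have hI : IntegrableOn h (Icc 0 (2 * Real.pi)) := hh.integrableOn_isCompact isCompact_Icc
  have hm : MeasurableSet (Metric.closedBall x δ) := Metric.isClosed_closedBall.measurableSet
  have hsub : Metric.closedBall x δ ⊆ Icc 0 (2 * Real.pi) := by
    rw [Real.closedBall_eq_Icc]
    exact Icc_subset_Icc (by linarith) (by linarith)
  have hpi : 1 ≤ Real.pi ^ 2 := by nlinarith [Real.two_le_pi]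
  rw [← integral_inter_add_sdiff hm (hI.mul_continuousOn hkc.continuousOn isCompact_Icc),
    inter_eq_right.2 hsub]
  refine add_le_add ?_ ?_
  · refine setIntegral_mul_kernel_le hh hh0 hkc (by positivity) hN (by positivity) (fun y => ?_)
      (fun y hy hyδ => ?_) hε
    · refine (norm_fejerKernel_le N _).trans ?_
      have : (0 : ℝ) ≤ N + 1 := by positivity
      nlinarith
    · have := norm_fejerKernel_le_div_sq N (t := x - y) (sub_ne_zero.2 hy.symm)
        (by rw [abs_sub_comm]; linarith)
      rwa [sub_sq_comm] at this
  · set C := 1 / Real.sin (δ / 2) ^ 2 / ((N : ℝ) + 1) with hC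
    have hC0 : 0 ≤ C := by positivity
    have hIC : IntegrableOn (fun y => h y * C) (Icc 0 (2 * Real.pi)) := Integrable.mul_const hI C
    rw [mul_div_assoc, ← hC, ← integral_mul_const]
    refine (setIntegral_mono_on ((hI.mul_continuousOn hkc.continuousOn isCompact_Icc).mono_set
      sdiff_subset) (hIC.mono_set sdiff_subset) (measurableSet_Icc.diff hm)
      fun y hy => ?_).trans ?_
    · refine mul_le_mul_of_nonneg_left (norm_fejerKernel_le_of_far N hδ ?_ ?_) (hh0 y)
      · have h1 := hy.2
        rw [Metric.mem_closedBall, Real.dist_eq, not_le, abs_sub_comm] at h1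
        exact h1.le
      · have h1 := hy.1.1
        have h2 := hy.1.2
        rw [abs_le]
        constructor <;> linarith
    · exact setIntegral_mono_set hIC
        (Eventually.of_forall fun y => mul_nonneg (hh0 y) hC0)
        (Eventually.of_forall fun y hy => hy.1)

/-- The Fejér-Lebesgue theorem. The kernel has mean one, so the error at `x` is at most the mean of
`|f - f(x)|` weighted by the kernel, and at a Lebesgue point the averages of this function over
small balls tend to zero. -/
theorem ae_tendsto_integral_fejerKernel {f : ℝ → ℝ} (hf : IntegrableOn f (Icc 0 (2 * Real.pi))) :
    ∀ᵐ x ∂volume.restrict (Icc 0 (2 * Real.pi)),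
      Tendsto (fun N : ℕ => (1 / (2 * Real.pi) : ℝ) •
        ∫ ψ in (0 : ℝ)..(2 * Real.pi), (f ψ : ℂ) * fejerKernel N (x - ψ))
        atTop (𝓝 (f x : ℂ)) := by
  have hpi := Real.pi_pos
  set F : ℝ → ℝ := (Icc 0 (2 * Real.pi)).indicator f with hF
  have hFi : Integrable F := hf.integrable_indicator measurableSet_Icc
  -- Dropping the endpoints lets a small ball around `x` fit into the interval.
  rw [← Measure.restrict_congr_set (Ioo_ae_eq_Icc (μ := volume) (a := (0 : ℝ)) (b := 2 * Real.pi)),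
    ae_restrict_iff' measurableSet_Ioo]
  filter_upwards [IsUnifLocDoublingMeasure.ae_tendsto_average_norm_sub (volume : Measure ℝ)
    hFi.locallyIntegrable 1] with x hx hx0
  have havg := hx (fun _ : ℝ => x) id (l := 𝓝[>] (0 : ℝ)) tendsto_id (by
    filter_upwards [self_mem_nhdsWithin] with r hr
    exact Metric.mem_closedBall_self (by simpa using (mem_Ioi.1 hr).le))
  set h : ℝ → ℝ := fun y => ‖F y - F x‖ with hh
  have hhl : LocallyIntegrable h := by
    refine locallyIntegrable_iff.2 fun K hK => ?_
    exact (Integrable.sub hFi.integrableOn (integrableOn_const hK.measure_lt_top.ne)).norm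
  have hxI : x ∈ Icc 0 (2 * Real.pi) := Ioo_subset_Icc_self hx0
  have hbound : ∀ N : ℕ, ‖(1 / (2 * Real.pi) : ℝ) •
        (∫ ψ in (0 : ℝ)..(2 * Real.pi), (f ψ : ℂ) * fejerKernel N (x - ψ)) - (f x : ℂ)‖ ≤
      1 / (2 * Real.pi) * ∫ y in Icc 0 (2 * Real.pi), h y * ‖fejerKernel N (x - y)‖ := by
    intro N
    have hkc : Continuous fun y => fejerKernel N (x - y) :=
      (continuous_fejerKernel N).comp (continuous_const.sub continuous_id)
    have h1 : (f x : ℂ) = (1 / (2 * Real.pi) : ℝ) •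
        ∫ ψ in (0 : ℝ)..(2 * Real.pi), (f x : ℂ) * fejerKernel N (x - ψ) := by
      rw [intervalIntegral.integral_const_mul, integral_fejerKernel, Complex.real_smul]
      have : (Real.pi : ℂ) ≠ 0 := by exact_mod_cast hpi.ne'
      push_cast
      field_simp
    have hi1 : IntervalIntegrable (fun ψ => (f ψ : ℂ) * fejerKernel N (x - ψ)) volume 0
        (2 * Real.pi) := by
      rw [intervalIntegrable_iff_integrableOn_Icc_of_le (by positivity)]
      exact IntegrableOn.mul_continuousOn hf.ofReal hkc.continuousOn isCompact_Icc
    have hi2 : IntervalIntegrable (fun ψ => (f x : ℂ) * fejerKernel N (x - ψ)) volume 0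
        (2 * Real.pi) := (continuous_const.mul hkc).intervalIntegrable _ _
    nth_rewrite 1 [h1]
    rw [← smul_sub, ← intervalIntegral.integral_sub hi1 hi2, norm_smul,
      Real.norm_of_nonneg (by positivity : (0 : ℝ) ≤ 1 / (2 * Real.pi)),
      intervalIntegral.integral_of_le (by positivity), ← integral_Icc_eq_integral_Ioc]
    gcongr
    refine (norm_integral_le_integral_norm _).trans (le_of_eq ?_)
    refine setIntegral_congr_fun measurableSet_Icc fun y hy => ?_
    simp only [hh, hF, indicator_of_mem hy, indicator_of_mem hxI]
    rw [← sub_mul, norm_mul, ← Complex.ofReal_sub, Complex.norm_real]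
  rw [tendsto_iff_norm_sub_tendsto_zero, Metric.tendsto_atTop]
  intro η hη
  -- A ball has length `2r`, so this bound on averages gives `ε = η/(8π)`, and the final estimate
  -- has the limit `(1/2π) · 8π² ε = η/2`.
  have hη' : 0 < η / (16 * Real.pi) := by positivity
  have hev : ∀ᶠ r in 𝓝[>] (0 : ℝ), ⨍ y in Metric.closedBall x r, ‖F y - F x‖ < η / (16 * Real.pi) :=
    havg.eventually_lt_const hη'
  obtain ⟨δ₀, hδ₀, hδ₀r⟩ := (mem_nhdsGT_iff_exists_Ioc_subset).1 hev
  set δ := min (δ₀ / 2) (min x (2 * Real.pi - x)) with hδ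
  have hδpos : 0 < δ := lt_min (by simpa using hδ₀) (lt_min hx0.1 (by linarith [hx0.2]))
  have hδx : δ ≤ x := (min_le_right _ _).trans (min_le_left _ _)
  have hδx' : x ≤ 2 * Real.pi - δ := by
    have : δ ≤ 2 * Real.pi - x := (min_le_right _ _).trans (min_le_right _ _)
    linarith
  have hε : ∀ r, 0 < r → r ≤ 2 * δ → ∫ y in Metric.closedBall x r, h y ≤ η / (8 * Real.pi) * r := by
    intro r hr0 hr
    have h1 : δ ≤ δ₀ / 2 := min_le_left _ _
    have h2 : ⨍ y in Metric.closedBall x r, ‖F y - F x‖ < η / (16 * Real.pi) :=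
      hδ₀r ⟨hr0, by linarith⟩
    rw [setAverage_eq, measureReal_def, Real.volume_closedBall,
      ENNReal.toReal_ofReal (by positivity), smul_eq_mul, inv_mul_lt_iff₀ (by positivity)] at h2
    refine h2.le.trans (le_of_eq ?_)
    field_simp
    ring
  set C := (∫ y in Icc 0 (2 * Real.pi), h y) * (1 / Real.sin (δ / 2) ^ 2) with hC
  have hlim : Tendsto (fun N : ℕ => 1 / (2 * Real.pi) *
      (8 * Real.pi ^ 2 * (η / (8 * Real.pi)) + C / ((N : ℝ) + 1))) atTop
      (𝓝 (1 / (2 * Real.pi) * (8 * Real.pi ^ 2 * (η / (8 * Real.pi)) + 0))) := by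
    have h1 : Tendsto (fun N : ℕ => C / ((N : ℝ) + 1)) atTop (𝓝 0) := by
      have := (tendsto_one_div_add_atTop_nhds_zero_nat (𝕜 := ℝ)).const_mul C
      simpa [div_eq_mul_inv] using this
    exact (h1.const_add _).const_mul _
  have hlt : 1 / (2 * Real.pi) * (8 * Real.pi ^ 2 * (η / (8 * Real.pi)) + 0) < η := by
    have : 1 / (2 * Real.pi) * (8 * Real.pi ^ 2 * (η / (8 * Real.pi)) + 0) = η / 2 := by
      field_simp
      ring
    linarith
  have hbig : ∀ᶠ N : ℕ in atTop, 1 ≤ ((N : ℝ) + 1) * δ := by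
    filter_upwards [(tendsto_natCast_atTop_atTop (R := ℝ)).eventually_ge_atTop (1 / δ)] with N hN
    rw [div_le_iff₀ hδpos] at hN
    nlinarith
  obtain ⟨N₀, hN₀⟩ := eventually_atTop.1 ((hlim.eventually_lt_const hlt).and hbig)
  refine ⟨N₀, fun N hN => ?_⟩
  obtain ⟨h1, h2⟩ := hN₀ N hN
  rw [dist_zero_right, norm_norm]
  refine (hbound N).trans_lt (lt_of_le_of_lt ?_ h1)
  gcongr
  exact setIntegral_mul_fejerKernel_le hhl (fun y => norm_nonneg _) hδpos hδx hδx' hε h2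

/-! ### Determination of the mean curvature radius -/

section Determination

variable {Q : Measure (ConvexBody Plane)}

/-- The Cesàro means of the Fourier series of `g`. -/
def cesaroMean (γ : ℝ) (Q : Measure (ConvexBody Plane)) (N : ℕ) (φ : ℝ) : ℂ :=
  ∑ n ∈ Finset.Icc (-(N : ℤ)) N,
    (1 - ((|n| : ℤ) : ℂ) / ((N : ℂ) + 1)) * meanCurvatureCoeff γ Q n *
      Complex.exp (Complex.I * (n : ℂ) * (φ : ℂ))

theorem IsSmoothGrainDistribution.cesaroMean_eq (hQ : IsSmoothGrainDistribution Q) (γ : ℝ)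
    (N : ℕ) (φ : ℝ) :
    cesaroMean γ Q N φ = (1 / (2 * Real.pi) : ℝ) •
      ∫ ψ in (0 : ℝ)..(2 * Real.pi), (meanCurvatureRadius γ Q ψ : ℂ) * fejerKernel N (φ - ψ) := by
  have hg : IntervalIntegrable (fun ψ => (meanCurvatureRadius γ Q ψ : ℂ)) volume 0
      (2 * Real.pi) := by
    rw [intervalIntegrable_iff]
    exact (intervalIntegrable_iff.1 (hQ.intervalIntegrable_meanCurvatureRadius γ)).ofReal
  simp only [cesaroMean, fejerKernel, Finset.mul_sum]
  rw [intervalIntegral.integral_finsetSum, Finset.smul_sum]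
  · refine Finset.sum_congr rfl fun n _ => ?_
    have h1 : ∀ ψ : ℝ, (meanCurvatureRadius γ Q ψ : ℂ) *
        ((1 - ((|n| : ℤ) : ℂ) / ((N : ℂ) + 1)) * Complex.exp (Complex.I * n * ((φ - ψ : ℝ) : ℂ))) =
        ((1 - ((|n| : ℤ) : ℂ) / ((N : ℂ) + 1)) * Complex.exp (Complex.I * n * φ)) *
          (Complex.exp (-(Complex.I * n * ψ)) * (meanCurvatureRadius γ Q ψ : ℂ)) := fun ψ => by
      have h2 : Complex.exp (Complex.I * n * ((φ - ψ : ℝ) : ℂ)) =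
          Complex.exp (Complex.I * n * φ) * Complex.exp (-(Complex.I * n * ψ)) := by
        rw [← Complex.exp_add]
        push_cast
        ring_nf
      rw [h2]
      ring
    simp_rw [h1]
    rw [intervalIntegral.integral_const_mul, meanCurvatureCoeff_eq, mul_smul_comm, smul_mul_assoc]
    congr 1
    ring
  · intro n _
    refine hg.mul_continuousOn (Continuous.continuousOn ?_)
    fun_prop

theorem IsSmoothGrainDistribution.ae_tendsto_cesaroMean (hQ : IsSmoothGrainDistribution Q)
    (γ : ℝ) :
    ∀ᵐ φ : ℝ ∂volume.restrict (Icc 0 (2 * Real.pi)),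
      Tendsto (fun N : ℕ => cesaroMean γ Q N φ) atTop (𝓝 (meanCurvatureRadius γ Q φ : ℂ)) := by
  filter_upwards [ae_tendsto_integral_fejerKernel (hQ.integrableOn_meanCurvatureRadius γ)] with φ h
  simpa only [hQ.cesaroMean_eq γ] using h

theorem IsSmoothGrainDistribution.meanCurvatureCoeff_congr (hQ : IsSmoothGrainDistribution Q)
    {Q' : Measure (ConvexBody Plane)} (hQ' : IsSmoothGrainDistribution Q') {γ γ' : ℝ}
    (h : ∀ s : ℕ, particleSurfaceDensity γ Q s = particleSurfaceDensity γ' Q' s) (n : ℤ) :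
    meanCurvatureCoeff γ Q n = meanCurvatureCoeff γ' Q' n := by
  obtain ⟨s, rfl | rfl⟩ := n.eq_nat_or_neg
  · rw [hQ.meanCurvatureCoeff_natCast, hQ'.meanCurvatureCoeff_natCast, h]
  · rw [hQ.meanCurvatureCoeff_neg_natCast, hQ'.meanCurvatureCoeff_neg_natCast, h]

theorem IsSmoothGrainDistribution.ae_meanCurvatureRadius_eq (hQ : IsSmoothGrainDistribution Q)
    {Q' : Measure (ConvexBody Plane)} (hQ' : IsSmoothGrainDistribution Q') {γ γ' : ℝ}
    (h : ∀ s : ℕ, particleSurfaceDensity γ Q s = particleSurfaceDensity γ' Q' s) :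
    ∀ᵐ φ ∂volume.restrict (Icc 0 (2 * Real.pi)),
      meanCurvatureRadius γ Q φ = meanCurvatureRadius γ' Q' φ := by
  filter_upwards [hQ.ae_tendsto_cesaroMean γ, hQ'.ae_tendsto_cesaroMean γ'] with φ h1 h2
  have h3 : ∀ N, cesaroMean γ Q N φ = cesaroMean γ' Q' N φ := fun N => by
    simp only [cesaroMean, hQ.meanCurvatureCoeff_congr hQ' h]
  simp_rw [h3] at h1
  exact_mod_cast tendsto_nhds_unique h1 h2

/-- A constant factor can be absorbed into the intensity, which reduces determination up to a factor
to exact determination. -/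
theorem particleSurfaceDensity_mul (c γ : ℝ) (Q : Measure (ConvexBody Plane)) (s : ℕ) :
    particleSurfaceDensity (c * γ) Q s = c • particleSurfaceDensity γ Q s :=
  mul_smul c γ _

theorem meanCurvatureRadius_mul (c γ : ℝ) (Q : Measure (ConvexBody Plane)) (φ : ℝ) :
    meanCurvatureRadius (c * γ) Q φ = c * meanCurvatureRadius γ Q φ :=
  mul_assoc c γ _

theorem exists_convexBody_volume_pos : ∃ W : ConvexBody Plane, 0 < volume (W : Set Plane) :=
  ⟨⟨Metric.closedBall 0 1, convex_closedBall 0 1, isCompact_closedBall 0 1,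
    ⟨0, Metric.mem_closedBall_self zero_le_one⟩⟩, Metric.measure_closedBall_pos _ _ one_pos⟩

section

variable {Ω : Type*} [MeasurableSpace Ω] {P : Measure Ω} {Z : Ω → Set Plane}

theorem HasSurfaceDensity.unique {s : ℕ} {T T' : Tensor s} (h : HasSurfaceDensity P Z s T)
    (h' : HasSurfaceDensity P Z s T') : T = T' := by
  obtain ⟨W, hW⟩ := exists_convexBody_volume_pos
  exact tendsto_nhds_unique (h W hW).2 (h' W hW).2

theorem HasAreaDensity.unique {v v' : ℝ} (h : HasAreaDensity P Z v)
    (h' : HasAreaDensity P Z v') : v = v' := by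
  obtain ⟨W, hW⟩ := exists_convexBody_volume_pos
  exact tendsto_nhds_unique (h W hW).2 (h' W hW).2

end

section

variable {Ω Ω' : Type*} [MeasurableSpace Ω] [MeasurableSpace Ω'] {P : Measure Ω} {P' : Measure Ω'}
  {γ γ' : ℝ} {Q' : Measure (ConvexBody Plane)} {X : Ω → Set (ConvexBody Plane)}
  {X' : Ω' → Set (ConvexBody Plane)}

theorem IsSmoothBooleanModel.ae_meanCurvatureRadius_eq_mul (hX : IsSmoothBooleanModel P γ Q X)
    (hX' : IsSmoothBooleanModel P' γ' Q' X')
    (h : ∀ s : ℕ, ∃ T : Tensor s,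
      HasSurfaceDensity P (unionSet X) s T ∧ HasSurfaceDensity P' (unionSet X') s T) :
    ∀ᵐ φ ∂volume.restrict (Icc 0 (2 * Real.pi)), meanCurvatureRadius γ Q φ =
      Real.exp (particleAreaDensity γ Q - particleAreaDensity γ' Q') *
        meanCurvatureRadius γ' Q' φ := by
  simp_rw [← meanCurvatureRadius_mul]
  refine hX.grains.ae_meanCurvatureRadius_eq hX'.grains fun s => ?_
  obtain ⟨T, hT, hT'⟩ := h s
  have h1 := (hX.hasSurfaceDensity s).unique hT
  have h2 := (hX'.hasSurfaceDensity s).unique hT'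
  rw [particleSurfaceDensity_mul, sub_eq_add_neg, Real.exp_add, mul_smul, h2, ← h1, smul_smul,
    ← Real.exp_add, add_neg_cancel, Real.exp_zero, one_smul]

theorem IsSmoothBooleanModel.particleAreaDensity_eq (hX : IsSmoothBooleanModel P γ Q X)
    (hX' : IsSmoothBooleanModel P' γ' Q' X') {v : ℝ} (h : HasAreaDensity P (unionSet X) v)
    (h' : HasAreaDensity P' (unionSet X') v) :
    particleAreaDensity γ Q = particleAreaDensity γ' Q' := by
  have h1 := (hX.hasAreaDensity.unique h).trans (hX'.hasAreaDensity.unique h').symm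
  have h2 := Real.exp_injective (sub_right_injective h1)
  exact neg_injective h2

end

end Determination

end

theorem mainTheorem11 {Ω : Type*} [MeasurableSpace Ω] (P : Measure Ω)
    (γ : ℝ) (Q : Measure (ConvexBody Plane)) (X : Ω → Set (ConvexBody Plane))
    (hX : IsSmoothBooleanModel P γ Q X) :
    -- the function `g` is well defined almost everywhere and integrable
    ((∀ᵐ φ ∂volume.restrict (Icc 0 (2 * Real.pi)),
        Integrable (fun K => curvatureRadius K (unitVec φ)) Q) ∧
      IntegrableOn (meanCurvatureRadius γ Q) (Icc 0 (2 * Real.pi))) ∧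
    -- the surface tensor densities of `X` exist and are trigonometric moments of `g`
    (∀ s : ℕ, Integrable (surfaceTensor s) Q ∧
      particleSurfaceDensity γ Q s =
        (1 / ((s.factorial : ℝ) * sphereArea (1 + s)) * γ) •
          ∫ K, (∫ φ in (0 : ℝ)..(2 * Real.pi),
            curvatureRadius K (unitVec φ) • tensorPower s (unitVec φ)) ∂Q ∧
      particleSurfaceDensity γ Q s =
        (1 / ((s.factorial : ℝ) * sphereArea (1 + s))) •
          ∫ φ in (0 : ℝ)..(2 * Real.pi),
            meanCurvatureRadius γ Q φ • tensorPower s (unitVec φ)) ∧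
    -- the Fourier coefficients of `g` in terms of the surface tensor densities of `X`
    (∀ s : ℕ,
      meanCurvatureCoeff γ Q s =
        ∑ j ∈ Finset.range (s + 1), (s.choose j : ℂ) * (-Complex.I) ^ (s - j) *
          (((s.factorial : ℝ) * sphereArea (1 + s) / (2 * Real.pi) : ℝ) : ℂ) *
          ((particleSurfaceDensity γ Q s).coord j : ℂ) ∧
      meanCurvatureCoeff γ Q (-(s : ℤ)) =
        ∑ j ∈ Finset.range (s + 1), (s.choose j : ℂ) * Complex.I ^ (s - j) *
          (((s.factorial : ℝ) * sphereArea (1 + s) / (2 * Real.pi) : ℝ) : ℂ) *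
          ((particleSurfaceDensity γ Q s).coord j : ℂ)) ∧
    -- `g` is recovered almost everywhere from its Fourier coefficients, by Cesaro summation
    (∀ᵐ φ : ℝ ∂volume.restrict (Icc 0 (2 * Real.pi)),
      Tendsto (fun N : ℕ => ∑ n ∈ Finset.Icc (-(N : ℤ)) N,
          (1 - ((|n| : ℤ) : ℂ) / ((N : ℂ) + 1)) * meanCurvatureCoeff γ Q n *
            Complex.exp (Complex.I * (n : ℂ) * (φ : ℂ)))
        atTop (𝓝 (meanCurvatureRadius γ Q φ : ℂ))) ∧
    -- the surface tensor densities of `X` determine `g` almost everywhere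
    (∀ (γ' : ℝ) (Q' : Measure (ConvexBody Plane)), 0 < γ' → IsSmoothGrainDistribution Q' →
      (∀ s : ℕ, particleSurfaceDensity γ Q s = particleSurfaceDensity γ' Q' s) →
      ∀ᵐ φ ∂volume.restrict (Icc 0 (2 * Real.pi)),
        meanCurvatureRadius γ Q φ = meanCurvatureRadius γ' Q' φ) ∧
    -- the densities of the Boolean model `Z` in terms of those of `X`
    ((∀ s : ℕ, HasSurfaceDensity P (unionSet X) s
        (Real.exp (-particleAreaDensity γ Q) • particleSurfaceDensity γ Q s)) ∧
      HasAreaDensity P (unionSet X) (1 - Real.exp (-particleAreaDensity γ Q))) ∧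
    -- the surface tensor densities of `Z` determine `g` almost everywhere up to a positive factor,
    -- and together with the area fraction of `Z` they determine `g` almost everywhere
    (∀ {Ω' : Type*} [MeasurableSpace Ω'] (P' : Measure Ω') (γ' : ℝ)
        (Q' : Measure (ConvexBody Plane)) (X' : Ω' → Set (ConvexBody Plane)),
      IsSmoothBooleanModel P' γ' Q' X' →
      (∀ s : ℕ, ∃ T : Tensor s,
        HasSurfaceDensity P (unionSet X) s T ∧ HasSurfaceDensity P' (unionSet X') s T) →
      (∃ c : ℝ, 0 < c ∧ ∀ᵐ φ ∂volume.restrict (Icc 0 (2 * Real.pi)),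
        meanCurvatureRadius γ Q φ = c * meanCurvatureRadius γ' Q' φ) ∧
      ((∃ v : ℝ, HasAreaDensity P (unionSet X) v ∧ HasAreaDensity P' (unionSet X') v) →
        ∀ᵐ φ ∂volume.restrict (Icc 0 (2 * Real.pi)),
          meanCurvatureRadius γ Q φ = meanCurvatureRadius γ' Q' φ)) := by
  have hQ := hX.grains
  refine ⟨⟨hQ.ae_integrable_curvatureRadius, hQ.integrableOn_meanCurvatureRadius γ⟩,
    fun s => ⟨hQ.integrable_surfaceTensor s, hQ.particleSurfaceDensity_eq γ s,
      hQ.particleSurfaceDensity_eq_integral γ s⟩,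
    fun s => ⟨hQ.meanCurvatureCoeff_natCast γ s, hQ.meanCurvatureCoeff_neg_natCast γ s⟩,
    hQ.ae_tendsto_cesaroMean γ,
    fun γ' Q' _ hQ' h => hQ.ae_meanCurvatureRadius_eq hQ' h,
    ⟨hX.hasSurfaceDensity, hX.hasAreaDensity⟩, ?_⟩
  intro Ω' _ P' γ' Q' X' hX' h
  have hmul := hX.ae_meanCurvatureRadius_eq_mul hX' h
  refine ⟨⟨_, Real.exp_pos _, hmul⟩, ?_⟩
  rintro ⟨v, hv, hv'⟩
  -- Equal area fractions force equal area densities, so the exponential factor becomes one.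
  rw [hX.particleAreaDensity_eq hX' hv hv', sub_self, Real.exp_zero] at hmul
  simpa only [one_mul] using hmul
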